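/- **Setting.** Let $\mu$ be a $\sigma$-finite measure on a nonempty set $X$. A Banach function space over $(X,\mu)$ is a complex Banach space $L$ of (classes of a.e. equal) complex measurable functions on $X$ such that $f\in L$, $g$ measurable and $|g|\le|f|$ imply $g\in L$ and $\|g\|\le\|f\|$; it is assumed that $X$ is the carrier of $L$, i.e. no set of positive measure is one on which all $f\in L$ vanish a.e. A kernel operator on $L$ is an operator $(Af)(x)=\int_X a(x,y)f(y)\,d\mu(y)$, where $a$ is $\mu\times\mu$-measurable and, for every $f\in L$, the integral converges absolutely for a.e. $x$; it is positive if it maps nonnegative functions to nonnegative functions, and then $a\ge0$ a.e. For positive kernel operators $A_1,\dots,A_m$ with kernels $a_1,\dots,a_m$ and $\alpha_j>0$, $A_1^{(\alpha_1)}\circ\cdots\circ A_m^{(\alpha_m)}$ denotes the operator on $L$ with kernel $a_1^{\alpha_1}\cdots a_m^{\alpha_m}$ (when there is one), and $A^{(t)}$ the one with kernel $a^t$. For sets of operators, $\Psi\Sigma=\{AB:A\in\Psi,B\in\Sigma\}$, $\Psi^n$ is the set of products of $n$ elements of $\Psi$, $\Psi^{(t)}=\{A^{(t)}:A\in\Psi\}$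 and $\Psi_1^{(\alpha_1)}\circ\cdots\circ\Psi_m^{(\alpha_m)}=\{A_1^{(\alpha_1)}\circ\cdots\circ A_m^{(\alpha_m)}:A_j\in\Psi_j\}$. For a bounded set $\Sigma$ of bounded operators put $$\rho(\Sigma)=\limsup_{p\to\infty}\Big[\sup_{A\in\Sigma^p}\rho(A)\Big]^{1/p},\quad \hat\rho(\Sigma)=\lim_{p\to\infty}\Big[\sup_{A\in\Sigma^p}\|A\|\Big]^{1/p},$$ $$\rho_{ess}(\Sigma)=\limsup_{p\to\infty}\Big[\sup_{A\in\Sigma^p}\rho_{ess}(A)\Big]^{1/p},\quad \hat\rho_{ess}(\Sigma)=\lim_{p\to\infty}\Big[\sup_{A\in\Sigma^p}\gamma(A)\Big]^{1/p},$$ where $\rho(A)$ is the spectral radius, $\rho_{ess}(A)$ the spectral radius of the image of $A$ in the Calkin algebra and $\gamma(A)$ the Hausdorff measure of noncompactness of $A$; suprema over the empty set are $0$. A norm is order continuous if every decreasing sequence of positive elements with infimum $0$ tends to $0$ in norm. **Theorem.** Let $k,m,n\ge1$ be integers and let $\alpha_1,\dots,\alpha_m>0$. (i) Let $\sum_{j=1}^m\alpha_j=1$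 and let $L$ be a Banach function space. If $A_1,\dots,A_m$ are positive kernel operators on $L$, then $A_1^{(\alpha_1)}\circ\cdots\circ A_m^{(\alpha_m)}$ is a well-defined operator on $L$. If $\Psi_{ij}$ ($1\le i\le k$, $1\le j\le m$) are bounded sets of positive kernel operators on $L$ and $r\in\{\rho,\hat\rho\}$, then $$\begin{aligned} & r\Big(\big(\Psi_{11}^{(\alpha_1)}\circ\cdots\circ\Psi_{1m}^{(\alpha_m)}\big)\cdots\big(\Psi_{k1}^{(\alpha_1)}\circ\cdots\circ\Psi_{km}^{(\alpha_m)}\big)\Big)\\ &\le r\Big((\Psi_{11}\cdots\Psi_{k1})^{(\alpha_1)}\circ\cdots\circ(\Psi_{1m}\cdots\Psi_{km})^{(\alpha_m)}\Big)\\ &\le r\Big(((\Psi_{11}\cdots\Psi_{k1})^n)^{(\alpha_1)}\circ\cdots\circ((\Psi_{1m}\cdots\Psi_{km})^n)^{(\alpha_m)}\Big)^{1/n}\\ &\le r(\Psi_{11}\cdots\Psi_{k1})^{\alpha_1}\cdots r(\Psi_{1m}\cdots\Psi_{km})^{\alpha_m}.\qquad(*) \end{aligned}$$ If, in addition, $L$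 and its Banach dual $L^*$ have order continuous norms, then $(*)$ holds also for each $r\in\{\rho_{ess},\hat\rho_{ess}\}$. (ii) Let $L$ be a Banach sequence space, i.e. a Banach function space over a nonempty finite or countably infinite index set $R$ with the counting measure, such that $e_n=\chi_{\{n\}}\in L$ and $\|e_n\|=1$ for all $n\in R$, and let $r\in\{\rho,\hat\rho\}$. A nonnegative matrix $[a_{ij}]_{i,j\in R}$ defines the positive operator $(Ax)_i=\sum_{j\in R}a_{ij}x_j$ on $L$ if $Ax\in L$ for all $x\in L$; its kernel is the matrix itself. If $\sum_{j=1}^m\alpha_j\ge1$ and $A_1,\dots,A_m$ are nonnegative matrices that define operators on $L$, then so is $A_1^{(\alpha_1)}\circ\cdots\circ A_m^{(\alpha_m)}$; and if $\Psi_{ij}$ are bounded sets of nonnegative matrices that define operators on $L$, then $(*)$ holds. In particular, if $t\ge1$ and $\Psi_1,\dots,\Psi_k$ are bounded sets of nonnegative matrices that define operators on $L$, then $A^{(t)}$ defines an operator on $L$ for every nonnegative matrix $A$ that does, and $$r(\Psi_1^{(t)}\cdots\Psi_k^{(t)})\le r((\Psi_1\cdots\Psi_k)^{(t)})\le r(((\Psi_1\cdots\Psi_k)^n)^{(t)})^{1/n}\le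 r(\Psi_1\cdots\Psi_k)^t.$$ -/

import Mathlib

open MeasureTheory Filter Topology
open scoped ENNReal NNReal Pointwise

noncomputable section

section GeneralOperators

/-! ### Spectral radii of sets of operators on a complex Banach space

All radii take values in `ℝ≥0∞`, so that no supremum or limes superior carries a junk value. -/

variable {E : Type*} [NormedAddCommGroup E] [NormedSpace ℂ E]

/-- The two-sided ideal of compact operators on `E`. -/
def compactIdeal (E : Type*) [NormedAddCommGroup E] [NormedSpace ℂ E] :
    TwoSidedIdeal (E →L[ℂ] E) :=
  TwoSidedIdeal.mk' {T : E →L[ℂ] E | IsCompactOperator T}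
    isCompactOperator_zero
    (fun hx hy => hx.add hy)
    (fun hx => hx.neg)
    (fun {x _} hy => hy.clm_comp x)
    (fun {_ y} hx => hx.comp_clm y)

/-- The Calkin algebra of `E`: bounded operators modulo compact operators. -/
abbrev CalkinAlgebra (E : Type*) [NormedAddCommGroup E] [NormedSpace ℂ E] : Type _ :=
  (compactIdeal E).ringCon.Quotient

/-- The essential spectral radius: the spectral radius of the image in the Calkin algebra. -/
def essentialSpectralRadius (A : E →L[ℂ] E) : ℝ≥0∞ :=
  spectralRadius ℂ (A : CalkinAlgebra E)

/-- The Hausdorff measure of noncompactness `γ(A)` of an operator `A`: the infimum of the `δ > 0`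
such that `A(D) ⊆ M + δ D` for a finite set `M`, where `D` is the closed unit ball. -/
def hausdorffMNC (A : E →L[ℂ] E) : ℝ≥0∞ :=
  ⨅ (δ : ℝ≥0) (_ : 0 < δ ∧ ∃ M : Set E, M.Finite ∧
    A '' Metric.closedBall 0 1 ⊆ M + (δ : ℝ) • Metric.closedBall (0 : E) 1), (δ : ℝ≥0∞)

/-- `limsup_p (sup_{A ∈ S^p} φ(A))^{1/p}`, where `S^p` is the set of products of `p` elements
of `S`. -/
def growthRate (φ : (E →L[ℂ] E) → ℝ≥0∞) (S : Set (E →L[ℂ] E)) : ℝ≥0∞ :=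
  limsup (fun p : ℕ => (⨆ A ∈ S ^ p, φ A) ^ (1 / (p : ℝ))) atTop

/-- The generalized spectral radius `ρ(S)` of a set of operators. -/
def generalizedSpectralRadius (S : Set (E →L[ℂ] E)) : ℝ≥0∞ :=
  growthRate (fun A => spectralRadius ℂ A) S

/-- The joint spectral radius `ρ̂(S)`. For a bounded set the limes superior is a limit, by
submultiplicativity of the norm. -/
def jointSpectralRadius (S : Set (E →L[ℂ] E)) : ℝ≥0∞ :=
  growthRate (fun A => ‖A‖ₑ) S

/-- The generalized essential spectral radius `ρ_ess(S)`. -/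
def generalizedEssentialSpectralRadius (S : Set (E →L[ℂ] E)) : ℝ≥0∞ :=
  growthRate essentialSpectralRadius S

/-- The joint essential spectral radius `ρ̂_ess(S)`. For a bounded set the limes superior is a
limit, by submultiplicativity of the measure of noncompactness. -/
def jointEssentialSpectralRadius (S : Set (E →L[ℂ] E)) : ℝ≥0∞ :=
  growthRate hausdorffMNC S

/-- The norm of `E` is order continuous for the order with positive cone `P` (`f ≤ g` means
`g - f ∈ P`): every decreasing sequence in `P` with infimum `0` tends to `0` in norm. -/
def HasOrderContinuousNorm (P : Set E) : Prop :=
  ∀ f : ℕ → E, (∀ n, f n ∈ P) → (∀ n, f n - f (n + 1) ∈ P) →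
    (∀ g : E, (∀ n, f n - g ∈ P) → 0 - g ∈ P) →
    Tendsto (fun n => ‖f n‖) atTop (𝓝 0)

end GeneralOperators

/-- A Banach function space over `(X, μ)`: a complete normed space `L` of classes of a.e. equal
complex measurable functions, such that `f ∈ L`, `g` measurable and `|g| ≤ |f|` imply `g ∈ L` and
`‖g‖ ≤ ‖f‖`, and whose carrier is all of `X`. -/
structure BanachFunctionSpace {X : Type*} [MeasurableSpace X] (μ : Measure X) where
  carrier : Submodule ℂ (X →ₘ[μ] ℂ)
  nrm : Seminorm ℂ carrier
  eq_zero_of_nrm_eq_zero : ∀ f : carrier, nrm f = 0 → f = 0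
  complete : ∀ u : ℕ → carrier,
    (∀ ε : ℝ, 0 < ε → ∃ N : ℕ, ∀ p, N ≤ p → ∀ q, N ≤ q → nrm (u p - u q) < ε) →
    ∃ f : carrier, ∀ ε : ℝ, 0 < ε → ∃ N : ℕ, ∀ p, N ≤ p → nrm (u p - f) < ε
  solid : ∀ (f : carrier) (g : X →ₘ[μ] ℂ), (∀ᵐ x ∂μ, ‖g x‖ ≤ ‖(f : X →ₘ[μ] ℂ) x‖) →
    ∃ hg : g ∈ carrier, nrm ⟨g, hg⟩ ≤ nrm f
  full : ¬ ∃ Y : Set X, MeasurableSet Y ∧ 0 < μ Y ∧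
    ∀ f : carrier, ∀ᵐ x ∂μ, x ∈ Y → (f : X →ₘ[μ] ℂ) x = 0

namespace BanachFunctionSpace

variable {X : Type*} [MeasurableSpace X] {μ : Measure X}

/-- The normed space of elements of a Banach function space. -/
def Space (L : BanachFunctionSpace μ) : Type _ := L.carrier

variable (L : BanachFunctionSpace μ)

instance : AddCommGroup L.Space := inferInstanceAs (AddCommGroup L.carrier)

instance : Module ℂ L.Space := inferInstanceAs (Module ℂ L.carrier)

/-- The class of functions underlying an element of `L`. -/
def toAE (f : L.Space) : X →ₘ[μ] ℂ := Subtype.val f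

instance : CoeFun L.Space (fun _ => X → ℂ) := ⟨fun f => (L.toAE f : X → ℂ)⟩

/-- The norm of `L`. -/
def addGroupNorm : AddGroupNorm L.Space where
  toFun f := L.nrm f
  map_zero' := map_zero L.nrm
  add_le' f g := map_add_le_add L.nrm f g
  neg' f := map_neg_eq_map L.nrm f
  eq_zero_of_map_eq_zero' f hf := L.eq_zero_of_nrm_eq_zero f hf

instance : NormedAddCommGroup L.Space := L.addGroupNorm.toNormedAddCommGroup

theorem norm_eq_nrm (f : L.Space) : ‖f‖ = L.nrm f := rfl

instance : NormedSpace ℂ L.Space where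
  norm_smul_le c f := (map_smul_eq_mul L.nrm c f).le

instance : CompleteSpace L.Space := by
  refine Metric.complete_of_cauchySeq_tendsto fun u hu => ?_
  obtain ⟨f, hf⟩ := L.complete u (fun ε hε => by
    obtain ⟨N, hN⟩ := Metric.cauchySeq_iff.1 hu ε hε
    exact ⟨N, fun p hp q hq => by
      have h := hN p hp q hq
      rwa [dist_eq_norm] at h⟩)
  let g : L.Space := f
  refine ⟨g, Metric.tendsto_atTop.2 fun ε hε => ?_⟩
  obtain ⟨N, hN⟩ := hf ε hε
  exact ⟨N, fun p hp => (dist_eq_norm (u p) g).trans_lt (hN p hp)⟩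

/-- The bounded operators on `L`. -/
abbrev Op : Type _ := L.Space →L[ℂ] L.Space

/-- The cone `L₊` of the elements of `L` that are nonnegative almost everywhere. -/
def posCone : Set L.Space := {f | ∀ᵐ x ∂μ, 0 ≤ (f x).re ∧ (f x).im = 0}

/-- The cone of the positive functionals in the Banach dual `L*`. -/
def dualPosCone : Set (L.Space →L[ℂ] ℂ) :=
  {φ | ∀ f ∈ L.posCone, 0 ≤ (φ f).re ∧ (φ f).im = 0}

/-- `A` is the kernel operator with kernel `a`. -/
def HasKernel (A : L.Op) (a : X × X → ℂ) : Prop :=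
  AEMeasurable a (μ.prod μ) ∧
  ∀ f : L.Space, ∀ᵐ x ∂μ,
    Integrable (fun y => a (x, y) * f y) μ ∧ A f x = ∫ y, a (x, y) * f y ∂μ

/-- `A` is the kernel operator with the nonnegative kernel `a`. -/
def HasNonnegKernel (A : L.Op) (a : X × X → ℝ≥0) : Prop :=
  L.HasKernel A (fun p => ((a p : ℝ) : ℂ))

/-- `A` is a kernel operator that maps `L₊` into itself. -/
def IsPositiveKernelOperator (A : L.Op) : Prop :=
  (∀ f ∈ L.posCone, A f ∈ L.posCone) ∧ ∃ a : X × X → ℂ, L.HasKernel A a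

/-- `B` is the Hadamard weighted geometric mean `A₁^{(α₁)} ∘ ⋯ ∘ Aₘ^{(αₘ)}`: the operator on `L`
with kernel `a₁^{α₁} ⋯ aₘ^{αₘ}`, where `aⱼ` is the (nonnegative) kernel of `Aⱼ`. -/
def IsHadamardMean {m : ℕ} (α : Fin m → ℝ) (A : Fin m → L.Op) (B : L.Op) : Prop :=
  ∃ a : Fin m → X × X → ℝ≥0, (∀ j, L.HasNonnegKernel (A j) (a j)) ∧
    L.HasNonnegKernel B (fun p => ∏ j, a j p ^ α j)

/-- The weighted Hadamard geometric mean `Ψ₁^{(α₁)} ∘ ⋯ ∘ Ψₘ^{(αₘ)}` of sets of operators. -/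
def hadamardMean {m : ℕ} (α : Fin m → ℝ) (Ψ : Fin m → Set L.Op) : Set L.Op :=
  {B | ∃ A : Fin m → L.Op, (∀ j, A j ∈ Ψ j) ∧ L.IsHadamardMean α A B}

/-- `B` is the Hadamard power `A^{(t)}`: the operator on `L` with kernel `a^t`, where `a` is the
(nonnegative) kernel of `A`. -/
def IsHadamardPower (t : ℝ) (A B : L.Op) : Prop :=
  ∃ a : X × X → ℝ≥0, L.HasNonnegKernel A a ∧ L.HasNonnegKernel B (fun p => a p ^ t)

/-- The Hadamard power `Ψ^{(t)}` of a set of operators. -/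
def hadamardPower (t : ℝ) (Ψ : Set L.Op) : Set L.Op :=
  {B | ∃ A ∈ Ψ, L.IsHadamardPower t A B}

end BanachFunctionSpace

/-- The product `Ψ₁ Ψ₂ ⋯ Ψₖ = {A₁ A₂ ⋯ Aₖ : Aᵢ ∈ Ψᵢ}` of sets of operators, in this order. -/
def setProduct {E : Type*} [NormedAddCommGroup E] [NormedSpace ℂ E] {k : ℕ}
    (Ψ : Fin k → Set (E →L[ℂ] E)) : Set (E →L[ℂ] E) :=
  (List.ofFn Ψ).prod

section Sequences

/-! ### Banach sequence spaces

A Banach sequence space over a countable index set `R` is a Banach function space over `R` with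
the counting measure. Almost everywhere then means everywhere, and a kernel is a matrix. -/

variable {R : Type*} [MeasurableSpace R]

/-- The class `𝓛`: every `eₙ = χ_{{n}}` belongs to `L` and has norm one. -/
def BanachFunctionSpace.HasUnitVectors
    (L : BanachFunctionSpace (Measure.count : Measure R)) : Prop :=
  ∀ n : R, ∃ e : L.Space, (∀ i, e i = Set.indicator {n} (fun _ => (1 : ℂ)) i) ∧ ‖e‖ = 1

/-- `A` is the operator on `L` defined by a nonnegative matrix: `(A f)ᵢ = ∑ⱼ aᵢⱼ fⱼ`. -/
def BanachFunctionSpace.IsNonnegMatrixOperator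
    (L : BanachFunctionSpace (Measure.count : Measure R)) (A : L.Op) : Prop :=
  ∃ a : R → R → ℝ≥0, ∀ (f : L.Space) (i : R),
    HasSum (fun j => ((a i j : ℝ) : ℂ) * f j) (A f i)

end Sequences

end

/-!
All four radii have the form `growthRate φ`, where `φ` is the operator norm, the Hausdorff measure
of noncompactness `γ`, or one of the corresponding spectral radii; the latter are the growth rates
of `φ` on singletons, by Gelfand's formula (`growthRate_enorm_singleton`) and by Nussbaum's formula
`ρ_ess(A) = lim γ(A ^ p) ^ (1 / p)` (`growthRate_hausdorffMNC_singleton`). It is therefore enough to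
treat the norm and `γ`, and to show that the required properties of `φ` are inherited by
`A ↦ growthRate φ {A}` (`IsLogConvexSize.growthRate_singleton`).

The basic relation is `Dominated α T A`: the kernel of `T` is at most `∏ a_j ^ α_j`. By Hölder's
inequality for the kernels of products it is compatible with multiplication (`Dominated.mul`), hence
passes to products and powers of sets of operators. Three properties of `φ` then give the chain of
inequalities (`IsLogConvexSize.growthRate_chain`): `φ` is monotone in the kernel, domination
implies `φ(T) ≤ ∏ φ(A_j) ^ α_j`, and `growthRate φ S ≤ growthRate φ (S ^ n) ^ (1 / n)`. The first
two inequalities of the chain compare a product of geometric means with the geometric mean of the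
products by monotonicity, the second after passing to `n`-th powers; the third inequality is the
product estimate applied to all powers of the set.

If the exponents sum to one, logarithmic convexity follows from monotonicity and the seminorm
properties alone (`le_mul_prod_rpow_of_monotone`): by the arithmetic-geometric mean inequality
`∏ a_j ^ α_j` is at most a weighted sum of the `a_j`, with weights adapted to the numbers `φ(A_j)`.
The same estimate shows that geometric means of kernels are again kernels of operators on `L`.

The essential point for `γ` is monotonicity (`KernelLE.hausdorffMNC_le`). If the norm of `L` is
order continuous, there is a strictly positive function `φ` in the associate space, and on order
intervals the norm is controlled by the `L¹` norm with weight `φ`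
(`exists_norm_le_of_lintegral_le`). If the norm of `L*` is order continuous, every positive kernel
operator maps the unit ball to a totally bounded set for this `L¹` norm
(`HasNonnegKernel.isPrecompactLOne`), because its kernel is the increasing limit of kernels that are
built from rank one kernels. When `0 ≤ T ≤ B` and `B` maps the unit ball into finitely many balls of
radius `δ`, it maps it into an order interval plus a ball of radius `δ`, hence so does `T`; truncating
a finite net for the weighted `L¹` norm to the order interval gives the required net for `T`.

For nonnegative matrices and exponents with sum `s ≥ 1` the entries are bounded by the norms of the
operators, so that `∏ a_j ^ α_j` is at most a constant times the product with the exponents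
`α_j / s`, and Hölder's inequality persists because the `ℓ¹` norm dominates the `ℓˢ` norm. Hadamard
powers are the geometric means of a single operator.
-/

set_option linter.unusedSectionVars false

/-! ### Growth rates of sets of operators -/

section GrowthRate

variable {E : Type*} [NormedAddCommGroup E] [NormedSpace ℂ E]

lemma growthRate_mono {φ ψ : (E →L[ℂ] E) → ℝ≥0∞} {S Q : Set (E →L[ℂ] E)}
    (h : ∀ p : ℕ, 0 < p → ⨆ A ∈ S ^ p, φ A ≤ ⨆ A ∈ Q ^ p, ψ A) :
    growthRate φ S ≤ growthRate ψ Q := by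
  refine limsup_le_limsup ?_
  filter_upwards [eventually_gt_atTop 0] with p hp
  exact ENNReal.rpow_le_rpow (h p hp) (by positivity)

lemma limsup_rpow_ennreal {ι : Type*} (f : Filter ι) (u : ι → ℝ≥0∞) {c : ℝ} (hc : 0 < c) :
    limsup u f ^ c = limsup (fun i => u i ^ c) f :=
  (ENNReal.orderIsoRpow c hc).limsup_apply

lemma tendsto_const_rpow_one_div {M : ℝ≥0∞} (hM0 : M ≠ 0) (hM : M ≠ ⊤) :
    Tendsto (fun p : ℕ => M ^ (1 / (p : ℝ))) atTop (𝓝 1) := by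
  lift M to ℝ≥0 using hM
  have hM' : M ≠ 0 := by exact_mod_cast hM0
  have := (tendsto_const_nhds (x := M)).nnrpow tendsto_one_div_atTop_nhds_zero_nat (Or.inl hM')
  simp_rw [← ENNReal.coe_rpow_of_ne_zero hM']
  simpa using ENNReal.tendsto_coe.2 this

/-- Passing to powers of the set can only decrease the growth rate: the products of length `n * p`
form a subsequence. -/
lemma growthRate_pow_le (φ : (E →L[ℂ] E) → ℝ≥0∞) (S : Set (E →L[ℂ] E)) {n : ℕ} (hn : 0 < n) :
    growthRate φ (S ^ n) ^ (1 / (n : ℝ)) ≤ growthRate φ S := by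
  have hn' : (0 : ℝ) < n := by exact_mod_cast hn
  unfold growthRate
  rw [limsup_rpow_ennreal _ _ (by positivity)]
  have h1 : (fun p : ℕ => ((⨆ A ∈ (S ^ n) ^ p, φ A) ^ (1 / (p : ℝ))) ^ (1 / (n : ℝ))) =
      (fun p : ℕ => (⨆ A ∈ S ^ p, φ A) ^ (1 / (p : ℝ))) ∘ (fun p => n * p) := by
    funext p
    simp only [Function.comp_apply, ← pow_mul]
    rw [← ENNReal.rpow_mul]
    congr 1
    push_cast
    rw [one_div_mul_one_div, mul_comm]
  rw [h1, limsup_comp]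
  exact limsup_le_limsup_of_le (tendsto_id.const_mul_atTop' hn)

/-- If `φ(A)^n ≤ φ(A^n)`, as for a spectral radius, the growth rate of `S` is controlled by that of
`S^n`, because `A ∈ S^p` gives `A^n ∈ (S^n)^p`. -/
lemma growthRate_le_pow_of_pow_le {φ : (E →L[ℂ] E) → ℝ≥0∞} (S : Set (E →L[ℂ] E)) {n : ℕ}
    (hn : 0 < n) (hφ : ∀ A, φ A ^ n ≤ φ (A ^ n)) :
    growthRate φ S ≤ growthRate φ (S ^ n) ^ (1 / (n : ℝ)) := by
  have hn' : (0 : ℝ) < n := by exact_mod_cast hn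
  unfold growthRate
  rw [limsup_rpow_ennreal _ _ (by positivity)]
  refine limsup_le_limsup (Eventually.of_forall fun p => ?_)
  simp only
  rw [← ENNReal.rpow_mul, mul_comm, ENNReal.rpow_mul]
  refine ENNReal.rpow_le_rpow (iSup₂_le fun A hA => ?_) (by positivity)
  rw [one_div, ENNReal.le_rpow_inv_iff hn', ENNReal.rpow_natCast]
  refine (hφ A).trans (le_iSup₂_of_le (A ^ n) ?_ le_rfl)
  rw [← pow_mul, mul_comm, pow_mul]
  exact Set.pow_mem_pow hA

/-- The same control for submultiplicative `φ` that is bounded on `S`: split a product of `p`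
factors into blocks of length `n` and fewer than `n` remaining factors. -/
lemma growthRate_le_pow_of_submultiplicative {φ : (E →L[ℂ] E) → ℝ≥0∞} (S : Set (E →L[ℂ] E))
    {n : ℕ} (hn : 0 < n) (hφ : ∀ A B, φ (A * B) ≤ φ A * φ B)
    {C : ℝ≥0} (hC : ∀ A ∈ S, φ A ≤ C) :
    growthRate φ S ≤ growthRate φ (S ^ n) ^ (1 / (n : ℝ)) := by
  have hn' : (0 : ℝ) < n := by exact_mod_cast hn
  rw [one_div, ENNReal.le_rpow_inv_iff hn', ENNReal.rpow_natCast]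
  refine le_of_forall_gt_imp_ge_of_dense fun c hc => ?_
  rcases eq_or_ne c ⊤ with rfl | hctop
  · exact le_top
  have hc0 : c ≠ 0 := (bot_le.trans_lt hc).ne'
  -- the products of `s` factors, times a further factor
  have hmul : ∀ s : ℕ, ∀ A ∈ S ^ s, ∀ B, φ (B * A) ≤ φ B * (C : ℝ≥0∞) ^ s := by
    intro s
    induction s with
    | zero =>
      intro A hA B
      rw [pow_zero, Set.mem_one] at hA
      simp [hA]
    | succ s ih =>
      intro A hA B
      rw [pow_succ] at hA
      obtain ⟨A', hA', A'', hA'', rfl⟩ := Set.mem_mul.1 hA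
      rw [← mul_assoc, pow_succ, ← mul_assoc]
      exact (hφ _ _).trans (mul_le_mul' (ih A' hA' B) (hC _ hA''))
  have hev : ∀ᶠ q : ℕ in atTop, (⨆ A ∈ (S ^ n) ^ q, φ A) ≤ c ^ q := by
    filter_upwards [eventually_lt_of_limsup_lt hc, eventually_gt_atTop 0] with q hq hq0
    have hq' : (0 : ℝ) < q := by exact_mod_cast hq0
    have := ENNReal.rpow_le_rpow hq.le hq'.le
    rwa [← ENNReal.rpow_mul, one_div, inv_mul_cancel₀ hq'.ne', ENNReal.rpow_one,
      ENNReal.rpow_natCast] at this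
  obtain ⟨N, hN⟩ := eventually_atTop.1 hev
  set D : ℝ≥0∞ := (1 + C) ^ n with hD
  have hD1 : (1 : ℝ≥0∞) ≤ 1 + C := le_self_add
  have hDtop : D ≠ ⊤ := by simp [hD]
  set c' : ℝ≥0∞ := c ^ (1 / (n : ℝ)) with hc'
  have hc'n : c' ^ n = c := by
    rw [hc', ← ENNReal.rpow_natCast, ← ENNReal.rpow_mul, one_div, inv_mul_cancel₀ hn'.ne',
      ENNReal.rpow_one]
  have hc'0 : c' ≠ 0 := by
    rintro h
    rw [h, zero_pow hn.ne'] at hc'n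
    exact hc0 hc'n.symm
  have hc't : c' ≠ ⊤ := by
    rintro h
    rw [h, ENNReal.top_pow hn.ne'] at hc'n
    exact hctop hc'n.symm
  set M : ℝ≥0∞ := D * (1 + c'⁻¹) ^ n with hM
  have hMtop : M ≠ ⊤ := by
    refine ENNReal.mul_ne_top hDtop (ENNReal.pow_ne_top ?_)
    exact ENNReal.add_ne_top.2 ⟨ENNReal.one_ne_top, ENNReal.inv_ne_top.2 hc'0⟩
  have hM0 : M ≠ 0 := by simp [hM, hD]
  have hbound : ∀ p, n * N ≤ p → (⨆ A ∈ S ^ p, φ A) ≤ M * c' ^ p := by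
    intro p hp
    refine iSup₂_le fun A hA => ?_
    have hpe : p = n * (p / n) + p % n := (Nat.div_add_mod p n).symm
    rw [hpe, pow_add, pow_mul] at hA
    obtain ⟨B, hB, A', hA', rfl⟩ := Set.mem_mul.1 hA
    have hq : N ≤ p / n := (Nat.le_div_iff_mul_le hn).2 (by rwa [mul_comm])
    have h1 : φ B ≤ c ^ (p / n) := (le_iSup₂ (f := fun A _ => φ A) B hB).trans (hN _ hq)
    have h2 : (C : ℝ≥0∞) ^ (p % n) ≤ D :=
      calc (C : ℝ≥0∞) ^ (p % n) ≤ (1 + C) ^ (p % n) := by gcongr; exact le_add_self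
        _ ≤ D := pow_le_pow_right₀ hD1 (Nat.mod_lt _ hn).le
    have h3 : c ^ (p / n) ≤ (1 + c'⁻¹) ^ n * c' ^ p := by
      have : c' ^ p = c ^ (p / n) * c' ^ (p % n) := by
        conv_lhs => rw [hpe, pow_add, pow_mul, hc'n]
      rw [this, mul_comm, mul_assoc]
      refine le_mul_of_one_le_right' ?_
      calc (1 : ℝ≥0∞) = c' ^ (p % n) * c'⁻¹ ^ (p % n) := by
            rw [← mul_pow, ENNReal.mul_inv_cancel hc'0 hc't, one_pow]
        _ ≤ c' ^ (p % n) * (1 + c'⁻¹) ^ n := by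
            refine mul_le_mul_right ?_ _
            calc c'⁻¹ ^ (p % n) ≤ (1 + c'⁻¹) ^ (p % n) := by gcongr; exact le_add_self
              _ ≤ _ := pow_le_pow_right₀ le_self_add (Nat.mod_lt _ hn).le
    calc φ (B * A') ≤ φ B * (C : ℝ≥0∞) ^ (p % n) := hmul _ _ hA' _
      _ ≤ ((1 + c'⁻¹) ^ n * c' ^ p) * D := mul_le_mul' (h1.trans h3) h2
      _ = M * c' ^ p := by rw [hM]; ring
  have hlim : Tendsto (fun p : ℕ => M ^ (1 / (p : ℝ)) * c') atTop (𝓝 (1 * c')) := by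
    refine ENNReal.Tendsto.mul_const ?_ (Or.inr hc't)
    exact tendsto_const_rpow_one_div hM0 hMtop
  have hfin : growthRate φ S ≤ c' := by
    unfold growthRate
    rw [one_mul] at hlim
    rw [← hlim.limsup_eq]
    refine limsup_le_limsup ?_
    filter_upwards [eventually_ge_atTop (n * N), eventually_gt_atTop 0] with p hp hp0
    have hp' : (0 : ℝ) < p := by exact_mod_cast hp0
    calc (⨆ A ∈ S ^ p, φ A) ^ (1 / (p : ℝ)) ≤ (M * c' ^ p) ^ (1 / (p : ℝ)) :=
          ENNReal.rpow_le_rpow (hbound p hp) (by positivity)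
      _ = M ^ (1 / (p : ℝ)) * c' := by
          rw [ENNReal.mul_rpow_of_nonneg _ _ (by positivity), ← ENNReal.rpow_natCast,
            ← ENNReal.rpow_mul, mul_one_div, div_self hp'.ne', ENNReal.rpow_one]
  calc growthRate φ S ^ n ≤ c' ^ n := by gcongr
    _ = c := hc'n

lemma norm_le_of_mem_pow {S : Set (E →L[ℂ] E)} {C : ℝ≥0} (hC : ∀ A ∈ S, ‖A‖ₑ ≤ C) :
    ∀ p : ℕ, 0 < p → ∀ A ∈ S ^ p, ‖A‖ₑ ≤ (C : ℝ≥0∞) ^ p := by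
  intro p hp
  induction p, hp using Nat.le_induction with
  | base => simpa using hC
  | succ p hp ih =>
    intro A hA
    rw [pow_succ] at hA
    obtain ⟨B, hB, A', hA', rfl⟩ := Set.mem_mul.1 hA
    rw [pow_succ]
    refine le_trans ?_ (mul_le_mul' (ih B hB) (hC A' hA'))
    rw [← ofReal_norm, ← ofReal_norm, ← ofReal_norm, ← ENNReal.ofReal_mul (norm_nonneg _)]
    exact ENNReal.ofReal_le_ofReal (norm_mul_le B A')

lemma growthRate_le_of_le_enorm {φ : (E →L[ℂ] E) → ℝ≥0∞} (hφ : ∀ A, φ A ≤ ‖A‖ₑ)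
    {S : Set (E →L[ℂ] E)} {C : ℝ≥0} (hC : ∀ A ∈ S, ‖A‖ₑ ≤ C) : growthRate φ S ≤ C := by
  refine limsup_le_of_le (h := ?_)
  filter_upwards [eventually_gt_atTop 0] with p hp
  have hp' : (0 : ℝ) < p := by exact_mod_cast hp
  rw [one_div, ENNReal.rpow_inv_le_iff hp', ENNReal.rpow_natCast]
  exact iSup₂_le fun A hA => (hφ A).trans (norm_le_of_mem_pow hC p hp A hA)

/-- The limes superior of a finite product is at most the product of the limites superiores,
provided these are finite. -/
lemma limsup_finset_prod_le {ι κ : Type*} (s : Finset κ) (f : Filter ι) [f.NeBot]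
    (u : κ → ι → ℝ≥0∞)
    (hu : ∀ j ∈ s, limsup (u j) f ≠ ⊤) :
    limsup (fun i => ∏ j ∈ s, u j i) f ≤ ∏ j ∈ s, limsup (u j) f := by
  have hlim : Tendsto (fun ε : ℝ≥0∞ => ∏ j ∈ s, (limsup (u j) f + ε)) (𝓝[>] 0)
      (𝓝 (∏ j ∈ s, (limsup (u j) f + 0))) := by
    refine ENNReal.tendsto_finsetProd_of_ne_top s (fun j hj => ?_) (fun j hj => by simpa using hu j hj)
    exact (tendsto_const_nhds.add tendsto_id).mono_left nhdsWithin_le_nhds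
  simp only [add_zero] at hlim
  refine ge_of_tendsto hlim ?_
  filter_upwards [self_mem_nhdsWithin] with ε (hε : 0 < ε)
  refine limsup_le_of_le (h := ?_)
  have : ∀ j ∈ s, ∀ᶠ i in f, u j i < limsup (u j) f + ε := fun j hj =>
    eventually_lt_of_limsup_lt (ENNReal.lt_add_right (hu j hj) hε.ne')
  filter_upwards [(eventually_all_finset s).2 this] with i hi
  exact Finset.prod_le_prod' fun j hj => (hi j hj).le

lemma growthRate_le_prod {m : ℕ} {α : Fin m → ℝ} (hα : ∀ j, 0 < α j)
    {φ : (E →L[ℂ] E) → ℝ≥0∞} {S : Set (E →L[ℂ] E)} {Φ : Fin m → Set (E →L[ℂ] E)}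
    (hΦ : ∀ j, growthRate φ (Φ j) ≠ ⊤)
    (h : ∀ p : ℕ, 0 < p → ⨆ A ∈ S ^ p, φ A ≤ ∏ j, (⨆ A ∈ Φ j ^ p, φ A) ^ α j) :
    growthRate φ S ≤ ∏ j, growthRate φ (Φ j) ^ α j := by
  have h1 : ∀ j, growthRate φ (Φ j) ^ α j =
      limsup (fun p : ℕ => ((⨆ A ∈ Φ j ^ p, φ A) ^ (1 / (p : ℝ))) ^ α j) atTop := fun j =>
    limsup_rpow_ennreal _ _ (hα j)
  simp_rw [h1]
  refine le_trans (limsup_le_limsup ?_) (limsup_finset_prod_le _ _ _ fun j _ => ?_)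
  · filter_upwards [eventually_gt_atTop 0] with p hp
    refine (ENNReal.rpow_le_rpow (h p hp) (by positivity)).trans_eq ?_
    rw [← ENNReal.prod_rpow_of_nonneg (by positivity)]
    refine Finset.prod_congr rfl fun j _ => ?_
    rw [← ENNReal.rpow_mul, ← ENNReal.rpow_mul, mul_comm]
  · rw [← h1 j]
    exact ENNReal.rpow_ne_top_of_nonneg (hα j).le (hΦ j)

lemma growthRate_singleton (φ : (E →L[ℂ] E) → ℝ≥0∞) (A : E →L[ℂ] E) :
    growthRate φ {A} = limsup (fun p : ℕ => φ (A ^ p) ^ (1 / (p : ℝ))) atTop := by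
  unfold growthRate
  congr 1
  funext p
  simp [Set.singleton_pow]

end GrowthRate

/-! ### The Hausdorff measure of noncompactness -/

section MeasureOfNoncompactness

variable {E : Type*} [NormedAddCommGroup E] [NormedSpace ℂ E]

/-- `A` maps the unit ball into a finite union of closed balls of radius `δ`. -/
def HasFiniteNet (A : E →L[ℂ] E) (δ : ℝ) : Prop :=
  ∃ M : Set E, M.Finite ∧ ∀ x : E, ‖x‖ ≤ 1 → ∃ m ∈ M, ‖A x - m‖ ≤ δ

lemma HasFiniteNet.mono {A : E →L[ℂ] E} {δ δ' : ℝ} (h : HasFiniteNet A δ) (hδ : δ ≤ δ') :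
    HasFiniteNet A δ' := by
  obtain ⟨M, hM, hA⟩ := h
  exact ⟨M, hM, fun x hx => (hA x hx).imp fun m hm => ⟨hm.1, hm.2.trans hδ⟩⟩

lemma hasFiniteNet_iff {A : E →L[ℂ] E} {δ : ℝ≥0} (hδ : 0 < δ) : HasFiniteNet A δ ↔
    ∃ M : Set E, M.Finite ∧
      A '' Metric.closedBall 0 1 ⊆ M + (δ : ℝ) • Metric.closedBall (0 : E) 1 := by
  have hδ' : (0 : ℝ) < δ := by exact_mod_cast hδ
  refine exists_congr fun M => and_congr_right fun _ => ?_
  rw [smul_closedBall (δ : ℝ) (0 : E) zero_le_one]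
  simp only [smul_zero, NNReal.norm_eq, mul_one]
  constructor
  · rintro h _ ⟨x, hx, rfl⟩
    obtain ⟨m, hm, hmx⟩ := h x (by simpa using hx)
    exact Set.mem_add.2 ⟨m, hm, A x - m, by simpa using hmx, by abel⟩
  · intro h x hx
    obtain ⟨m, hm, r, hr, hmr⟩ := Set.mem_add.1 (h ⟨x, by simpa using hx, rfl⟩)
    refine ⟨m, hm, ?_⟩
    rw [← hmr, add_sub_cancel_left]
    simpa using hr

/-- The infimum defining `γ` runs over `δ > 0` only, so that `γ(A) ≤ 0` has to be tested with all
`δ + ε`. -/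
lemma hausdorffMNC_le {A : E →L[ℂ] E} {δ : ℝ≥0} (h : ∀ ε : ℝ≥0, 0 < ε → HasFiniteNet A (δ + ε)) :
    hausdorffMNC A ≤ δ := by
  refine ENNReal.le_of_forall_pos_le_add fun ε hε _ => ?_
  refine iInf₂_le_of_le (δ + ε) ⟨by positivity, ?_⟩ (by simp)
  rw [← hasFiniteNet_iff (by positivity)]
  simpa using h ε hε

lemma exists_hasFiniteNet {A : E →L[ℂ] E} {c : ℝ≥0∞} (h : hausdorffMNC A < c) :
    ∃ δ : ℝ≥0, 0 < δ ∧ (δ : ℝ≥0∞) < c ∧ HasFiniteNet A δ := by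
  unfold hausdorffMNC at h
  simp only [iInf_lt_iff] at h
  obtain ⟨δ, ⟨hδ, hM⟩, hc⟩ := h
  exact ⟨δ, hδ, hc, (hasFiniteNet_iff hδ).2 hM⟩

lemma hasFiniteNet_of_lt {A : E →L[ℂ] E} {δ : ℝ≥0} (h : hausdorffMNC A < δ) :
    HasFiniteNet A δ := by
  obtain ⟨δ', _, hlt, hA⟩ := exists_hasFiniteNet h
  exact hA.mono (by exact_mod_cast hlt.le)

lemma hasFiniteNet_norm (A : E →L[ℂ] E) : HasFiniteNet A ‖A‖ :=
  ⟨{0}, Set.finite_singleton 0, fun x hx => ⟨0, rfl, by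
    simpa using A.le_of_opNorm_le_of_le le_rfl hx⟩⟩

lemma HasFiniteNet.add {A B : E →L[ℂ] E} {a b : ℝ} (hA : HasFiniteNet A a)
    (hB : HasFiniteNet B b) : HasFiniteNet (A + B) (a + b) := by
  obtain ⟨M, hM, hA⟩ := hA
  obtain ⟨N, hN, hB⟩ := hB
  refine ⟨M + N, hM.add hN, fun x hx => ?_⟩
  obtain ⟨m, hm, h1⟩ := hA x hx
  obtain ⟨n, hn, h2⟩ := hB x hx
  refine ⟨m + n, Set.add_mem_add hm hn, ?_⟩
  have : (A + B) x - (m + n) = (A x - m) + (B x - n) := by simp; abel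
  rw [this]
  exact (norm_add_le _ _).trans (add_le_add h1 h2)

lemma HasFiniteNet.smul {A : E →L[ℂ] E} {a : ℝ} (hA : HasFiniteNet A a) (c : ℂ) :
    HasFiniteNet (c • A) (‖c‖ * a) := by
  obtain ⟨M, hM, hA⟩ := hA
  refine ⟨c • M, hM.smul_set, fun x hx => ?_⟩
  obtain ⟨m, hm, h1⟩ := hA x hx
  refine ⟨c • m, Set.smul_mem_smul_set hm, ?_⟩
  rw [smul_apply, ← smul_sub, norm_smul]
  gcongr

/-- The vectors `B x` are within `b` of finitely many vectors `n`; rescaling `B x - n` to the unit ball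
gives the net `A n + b m` for `A * B`. -/
lemma HasFiniteNet.mul {A B : E →L[ℂ] E} {a b : ℝ} (hA : HasFiniteNet A a)
    (hB : HasFiniteNet B b) (hb : 0 < b) : HasFiniteNet (A * B) (a * b) := by
  obtain ⟨M, hM, hA⟩ := hA
  obtain ⟨N, hN, hB⟩ := hB
  refine ⟨A '' N + (b : ℂ) • M, (hN.image A).add hM.smul_set, fun x hx => ?_⟩
  obtain ⟨n, hn, h1⟩ := hB x hx
  have hbc : ((b : ℂ)) ≠ 0 := by exact_mod_cast hb.ne'
  obtain ⟨m, hm, h2⟩ := hA ((b : ℂ)⁻¹ • (B x - n)) (by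
    rw [norm_smul, norm_inv, Complex.norm_real, Real.norm_of_nonneg hb.le]
    rwa [inv_mul_le_iff₀ hb, mul_one])
  refine ⟨A n + (b : ℂ) • m, Set.add_mem_add ⟨n, hn, rfl⟩ (Set.smul_mem_smul_set hm), ?_⟩
  have : (A * B) x - (A n + (b : ℂ) • m) =
      (b : ℂ) • (A ((b : ℂ)⁻¹ • (B x - n)) - m) := by
    rw [map_smul, smul_sub, smul_smul, mul_inv_cancel₀ hbc, one_smul, map_sub,
      mul_apply_eq_comp]
    abel
  rw [this, norm_smul, Complex.norm_real, Real.norm_of_nonneg hb.le, mul_comm]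
  gcongr

lemma hausdorffMNC_le_enorm (A : E →L[ℂ] E) : hausdorffMNC A ≤ ‖A‖ₑ :=
  hausdorffMNC_le fun ε _ => (hasFiniteNet_norm A).mono (by simp)

lemma hausdorffMNC_ne_top (A : E →L[ℂ] E) : hausdorffMNC A ≠ ⊤ :=
  ((hausdorffMNC_le_enorm A).trans_lt enorm_lt_top).ne

lemma hausdorffMNC_add_le (A B : E →L[ℂ] E) :
    hausdorffMNC (A + B) ≤ hausdorffMNC A + hausdorffMNC B := by
  lift hausdorffMNC A to ℝ≥0 using hausdorffMNC_ne_top A with a ha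
  lift hausdorffMNC B to ℝ≥0 using hausdorffMNC_ne_top B with b hb
  rw [← ENNReal.coe_add]
  refine hausdorffMNC_le fun ε hε => ?_
  have h1 : HasFiniteNet A ((a + ε / 2 : ℝ≥0)) := hasFiniteNet_of_lt (by
    rw [← ha]; exact_mod_cast lt_add_of_pos_right a (half_pos hε))
  have h2 : HasFiniteNet B ((b + ε / 2 : ℝ≥0)) := hasFiniteNet_of_lt (by
    rw [← hb]; exact_mod_cast lt_add_of_pos_right b (half_pos hε))
  refine (h1.add h2).mono (le_of_eq ?_)
  push_cast
  ring

lemma hausdorffMNC_smul_le (c : ℂ) (A : E →L[ℂ] E) :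
    hausdorffMNC (c • A) ≤ ‖c‖ₑ * hausdorffMNC A := by
  lift hausdorffMNC A to ℝ≥0 using hausdorffMNC_ne_top A with a ha
  rw [enorm_eq_nnnorm, ← ENNReal.coe_mul]
  refine hausdorffMNC_le fun ε hε => ?_
  have hc : 0 < ‖c‖₊ + 1 := by positivity
  have h1 : HasFiniteNet A ((a + ε / (‖c‖₊ + 1) : ℝ≥0)) := hasFiniteNet_of_lt (by
    rw [← ha]; exact_mod_cast lt_add_of_pos_right a (div_pos hε hc))
  refine (h1.smul c).mono ?_
  have h2 : ‖c‖₊ * (a + ε / (‖c‖₊ + 1)) ≤ ‖c‖₊ * a + ε := by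
    rw [mul_add]
    gcongr
    rw [mul_div_assoc', div_le_iff₀ hc, mul_comm]
    gcongr
    exact le_self_add
  exact_mod_cast h2

lemma hausdorffMNC_mul_le (A B : E →L[ℂ] E) :
    hausdorffMNC (A * B) ≤ hausdorffMNC A * hausdorffMNC B := by
  refine le_of_forall_gt_imp_ge_of_dense fun c hc => ?_
  obtain ⟨a, ha, b, hb, hab⟩ : ∃ a, hausdorffMNC A < a ∧ ∃ b, hausdorffMNC B < b ∧ a * b < c := by
    have hA := hausdorffMNC_ne_top A
    have hB := hausdorffMNC_ne_top B
    have h : ∀ x : ℝ≥0∞, Tendsto (fun ε : ℝ≥0∞ => x + ε) (𝓝[>] 0) (𝓝 x) := fun x => by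
      have : Tendsto (fun ε : ℝ≥0∞ => x + ε) (𝓝 0) (𝓝 (x + 0)) :=
        tendsto_const_nhds.add tendsto_id
      rw [add_zero] at this
      exact this.mono_left nhdsWithin_le_nhds
    have hlim := ENNReal.Tendsto.mul (h (hausdorffMNC A)) (Or.inr hB) (h (hausdorffMNC B))
      (Or.inr hA)
    obtain ⟨ε, hε, hε0⟩ := ((hlim.eventually_lt_const hc).and self_mem_nhdsWithin).exists
    have hε0 : ε ≠ 0 := (Set.mem_Ioi.1 hε0).ne'
    exact ⟨_, ENNReal.lt_add_right hA hε0, _, ENNReal.lt_add_right hB hε0, hε⟩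
  obtain ⟨a', -, ha', hA⟩ := exists_hasFiniteNet ha
  obtain ⟨b', hb0, hb', hB⟩ := exists_hasFiniteNet hb
  refine le_trans ?_ hab.le
  refine le_trans ?_ (mul_le_mul' ha'.le hb'.le)
  rw [← ENNReal.coe_mul]
  exact hausdorffMNC_le fun ε hε => (hA.mul hB (by exact_mod_cast hb0)).mono (by push_cast; simp)

lemma hausdorffMNC_eq_zero_of_isCompactOperator {K : E →L[ℂ] E} (hK : IsCompactOperator K) :
    hausdorffMNC K = 0 := by
  refine le_antisymm (hausdorffMNC_le (δ := 0) fun ε hε => ?_) bot_le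
  obtain ⟨C, hC, hKC⟩ := hK.image_closedBall_subset_compact (f := (K : E →ₗ[ℂ] E)) 1
  obtain ⟨t, ht, hcov⟩ := Metric.totallyBounded_iff.1 hC.totallyBounded ε (by exact_mod_cast hε)
  refine ⟨t, ht, fun x hx => ?_⟩
  have := hcov (hKC ⟨x, by simpa using hx, rfl⟩)
  simp only [Set.mem_iUnion, Metric.mem_ball, dist_eq_norm] at this
  obtain ⟨y, hy, hxy⟩ := this
  exact ⟨y, hy, by simpa using hxy.le⟩

lemma hausdorffMNC_pow_le (A : E →L[ℂ] E) (n : ℕ) (hn : 0 < n) :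
    hausdorffMNC (A ^ n) ≤ hausdorffMNC A ^ n := by
  induction n, hn using Nat.le_induction with
  | base => simp
  | succ n hn ih =>
    rw [pow_succ, pow_succ]
    exact (hausdorffMNC_mul_le _ _).trans (mul_le_mul_left ih _)

end MeasureOfNoncompactness

/-! ### The Calkin algebra and the essential spectral radius -/

section Calkin

variable {E : Type*} [NormedAddCommGroup E] [NormedSpace ℂ E]

/-- The quotient map onto the Calkin algebra. -/
def calkinMk (E : Type*) [NormedAddCommGroup E] [NormedSpace ℂ E] :
    (E →L[ℂ] E) →+* CalkinAlgebra E :=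
  (compactIdeal E).ringCon.mk'

lemma mem_compactIdeal {K : E →L[ℂ] E} : K ∈ compactIdeal E ↔ IsCompactOperator K := by
  exact TwoSidedIdeal.mem_mk' _ _ _ _ _ _ _

lemma calkinMk_eq_iff {A B : E →L[ℂ] E} :
    calkinMk E A = calkinMk E B ↔ IsCompactOperator (A - B) := by
  rw [← mem_compactIdeal, ← TwoSidedIdeal.rel_iff]
  exact RingCon.eq _

lemma calkinMk_smul (c : ℂ) (A : E →L[ℂ] E) : calkinMk E (c • A) = c • calkinMk E A := rfl

lemma essentialSpectralRadius_eq (A : E →L[ℂ] E) :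
    essentialSpectralRadius A = spectralRadius ℂ (calkinMk E A) := rfl

lemma calkinMk_surjective : Function.Surjective (calkinMk E) := RingCon.mk'_surjective _

variable [CompleteSpace E]

/-- The kernel of `1 - S` is finite-dimensional when `γ(S) < 1`: its unit ball is contained in
`Sᵏ(D)` for every `k`, and so is totally bounded. -/
lemma finiteDimensional_ker_one_sub {S : E →L[ℂ] E} (hS : hausdorffMNC S < 1) :
    FiniteDimensional ℂ (LinearMap.ker ((1 - S : E →L[ℂ] E) : E →ₗ[ℂ] E)) := by
  set N := LinearMap.ker ((1 - S : E →L[ℂ] E) : E →ₗ[ℂ] E) with hN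
  have hclosed : IsClosed (N : Set E) := (1 - S).isClosed_ker
  have hfix : ∀ x ∈ N, ∀ k : ℕ, (S ^ k) x = x := by
    intro x hx k
    have h1 : S x = x := by
      have : x - S x = 0 := by simpa [hN] using hx
      exact (sub_eq_zero.1 this).symm
    induction k with
    | zero => simp
    | succ k ih => rw [pow_succ, mul_apply_eq_comp, h1, ih]
  have htb : TotallyBounded (N ∩ Metric.closedBall (0 : E) 1) := by
    refine Metric.totallyBounded_iff.2 fun ε hε => ?_
    have hlim : Tendsto (fun k : ℕ => hausdorffMNC S ^ k) atTop (𝓝 0) :=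
      ENNReal.tendsto_pow_atTop_nhds_zero_iff.2 hS
    have hε' : (0 : ℝ≥0∞) < ENNReal.ofReal (ε / 2) := by simpa using hε
    obtain ⟨k, hk, hk0⟩ :=
      ((hlim.eventually_lt_const hε').and (eventually_gt_atTop 0)).exists
    have hlt := (hausdorffMNC_pow_le S k hk0).trans_lt hk
    obtain ⟨M, hM, hMS⟩ := hasFiniteNet_of_lt (δ := (ε / 2).toNNReal) hlt
    refine ⟨M, hM, fun x hx => ?_⟩
    obtain ⟨m, hm, hmx⟩ := hMS x (by simpa using hx.2)
    rw [hfix x hx.1, Real.coe_toNNReal _ (by positivity)] at hmx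
    simp only [Set.mem_iUnion, Metric.mem_ball, dist_eq_norm]
    exact ⟨m, hm, hmx.trans_lt (by linarith)⟩
  have hcpt : IsCompact (N ∩ Metric.closedBall (0 : E) 1) :=
    htb.isCompact_of_isClosed (hclosed.inter Metric.isClosed_closedBall)
  refine FiniteDimensional.of_isCompact_closedBall₀ ℂ (r := 1) one_pos ?_
  rw [Subtype.isCompact_iff]
  convert hcpt using 1
  ext x
  simp [and_comm]

/-- When `γ(S) < 1`, the range of `1 - S` has a finite-dimensional supplement: modulo the span `V`
of a finite net of `S(D)`, the operator `S` is a contraction, so that `(1 - S) x ≡ y` can be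
solved by successive approximation. -/
lemma exists_finiteDimensional_sup_range {S : E →L[ℂ] E} (hS : hausdorffMNC S < 1) :
    ∃ V : Submodule ℂ E, FiniteDimensional ℂ V ∧
      LinearMap.range ((1 - S : E →L[ℂ] E) : E →ₗ[ℂ] E) ⊔ V = ⊤ := by
  obtain ⟨δ, hδ0, hδ1, M, hM, hMS⟩ := exists_hasFiniteNet hS
  have hδ1' : (δ : ℝ) < 1 := by exact_mod_cast hδ1
  set V := Submodule.span ℂ M with hV
  have hVf : FiniteDimensional ℂ V := FiniteDimensional.span_of_finite ℂ hM
  refine ⟨V, hVf, ?_⟩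
  have hstep : ∀ y : E, ∃ r : E, ‖r‖ ≤ δ * ‖y‖ ∧ S y - r ∈ V := by
    intro y
    rcases eq_or_ne y 0 with rfl | hy
    · exact ⟨0, by simp⟩
    have hy' : (0 : ℝ) < ‖y‖ := norm_pos_iff.2 hy
    have hyc : (‖y‖ : ℂ) ≠ 0 := by exact_mod_cast hy'.ne'
    obtain ⟨m, hm, hmx⟩ := hMS ((‖y‖ : ℂ)⁻¹ • y) (by
      rw [norm_smul, norm_inv, Complex.norm_real, norm_norm, inv_mul_cancel₀ hy'.ne'])
    refine ⟨S y - (‖y‖ : ℂ) • m, ?_, ?_⟩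
    · have : S y - (‖y‖ : ℂ) • m = (‖y‖ : ℂ) • (S ((‖y‖ : ℂ)⁻¹ • y) - m) := by
        rw [map_smul, smul_sub, smul_smul, mul_inv_cancel₀ hyc, one_smul]
      rw [this, norm_smul, Complex.norm_real, norm_norm, mul_comm]
      gcongr
    · rw [sub_sub_cancel]
      exact V.smul_mem _ (Submodule.subset_span hm)
  choose r hr hrV using hstep
  rw [eq_top_iff]
  intro y _
  set u : ℕ → E := fun n => r^[n] y with hu
  have hu_succ : ∀ n, u (n + 1) = r (u n) := fun n => by
    simp only [hu, Function.iterate_succ_apply']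
  have hun : ∀ n, ‖u n‖ ≤ ‖y‖ * (δ : ℝ) ^ n := by
    intro n
    induction n with
    | zero => simp [hu]
    | succ n ih =>
      rw [hu_succ, pow_succ, ← mul_assoc, mul_comm]
      refine (hr (u n)).trans ?_
      gcongr
  have hsum : Summable u := Summable.of_norm_bounded
    ((summable_geometric_of_lt_one δ.2 hδ1').mul_left _) hun
  have hpart : ∀ N, y - u N - (1 - S) (∑ n ∈ Finset.range N, u n) ∈ V := by
    intro N
    induction N with
    | zero => simp [hu]
    | succ N ih =>
      have : y - u (N + 1) - (1 - S) (∑ n ∈ Finset.range (N + 1), u n) =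
          (y - u N - (1 - S) (∑ n ∈ Finset.range N, u n)) + (S (u N) - r (u N)) := by
        rw [Finset.sum_range_succ, map_add, hu_succ]
        simp only [sub_apply, one_apply_eq_self]
        abel
      rw [this]
      exact V.add_mem ih (hrV _)
  have hlim : Tendsto (fun N => y - u N - (1 - S) (∑ n ∈ Finset.range N, u n)) atTop
      (𝓝 (y - 0 - (1 - S) (∑' n, u n))) :=
    (tendsto_const_nhds.sub hsum.tendsto_atTop_zero).sub
      (((1 - S).continuous.tendsto _).comp hsum.hasSum.tendsto_sum_nat)
  have hmem : y - 0 - (1 - S) (∑' n, u n) ∈ V :=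
    (Submodule.closed_of_finiteDimensional V).mem_of_tendsto hlim (Eventually.of_forall hpart)
  rw [sub_zero] at hmem
  rw [Submodule.mem_sup]
  exact ⟨(1 - S) (∑' n, u n), ⟨_, rfl⟩, _, hmem, by abel⟩

/-- An operator with finite-dimensional kernel whose range has a finite-dimensional supplement is
invertible modulo compact operators. -/
lemma isUnit_calkinMk_of_finiteDimensional {T : E →L[ℂ] E}
    (hker : FiniteDimensional ℂ (LinearMap.ker (T : E →ₗ[ℂ] E)))
    {V : Submodule ℂ E} (hV : FiniteDimensional ℂ V)
    (hVT : LinearMap.range (T : E →ₗ[ℂ] E) ⊔ V = ⊤) : IsUnit (calkinMk E T) := by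
  set N := LinearMap.ker (T : E →ₗ[ℂ] E) with hN
  set Rg := LinearMap.range (T : E →ₗ[ℂ] E) with hRg
  obtain ⟨N', hN'c, hNN'⟩ :=
    (Submodule.ClosedComplemented.of_finiteDimensional N).exists_isClosed_isCompl
  -- a supplement of the range inside `V`
  obtain ⟨W, hWV, hW⟩ : ∃ W : Submodule ℂ E, W ≤ V ∧ IsCompl Rg W := by
    obtain ⟨W', hW'⟩ := Submodule.exists_isCompl ((Rg).comap V.subtype)
    refine ⟨W'.map V.subtype, Submodule.map_subtype_le _ _, ?_, ?_⟩
    · rw [Submodule.disjoint_def]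
      rintro x hx ⟨w, hw, rfl⟩
      have := Submodule.disjoint_def.1 hW'.disjoint w hx hw
      simp [this]
    · rw [codisjoint_iff, eq_top_iff, ← hVT]
      refine sup_le le_sup_left fun v hv => ?_
      have : (⟨v, hv⟩ : V) ∈ (Rg).comap V.subtype ⊔ W' := by
        rw [hW'.sup_eq_top]; trivial
      obtain ⟨a, ha, b, hb, hab⟩ := Submodule.mem_sup.1 this
      rw [Submodule.mem_sup]
      exact ⟨a, ha, b, ⟨b, hb, rfl⟩, congrArg Subtype.val hab⟩
  have : FiniteDimensional ℂ W := Submodule.finiteDimensional_of_le hWV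
  have : CompleteSpace N' := hN'c.completeSpace_coe
  have : CompleteSpace W := FiniteDimensional.complete ℂ W
  have : LocallyCompactSpace W := have := FiniteDimensional.proper ℂ W; inferInstance
  have : LocallyCompactSpace N := have := FiniteDimensional.proper ℂ N; inferInstance
  let Φ₀ : (N' × W) →L[ℂ] E := (T.comp N'.subtypeL).coprod W.subtypeL
  have hΦ₀ : ∀ p : N' × W, Φ₀ p = T p.1 + p.2 := fun p => rfl
  have hinj : LinearMap.ker (Φ₀ : (N' × W) →ₗ[ℂ] E) = ⊥ := by
    rw [LinearMap.ker_eq_bot']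
    rintro ⟨x, w⟩ h
    have h' : T x + (w : E) = 0 := h
    have hw : (w : E) = 0 := by
      refine Submodule.disjoint_def.1 hW.disjoint _ ?_ w.2
      rw [eq_neg_of_add_eq_zero_right h']
      exact Rg.neg_mem ⟨x, rfl⟩
    have hx : (x : E) = 0 := by
      refine Submodule.disjoint_def.1 hNN'.disjoint _ ?_ x.2
      rw [hw, add_zero] at h'
      exact h'
    ext <;> simp [hw, hx]
  have hsurj : LinearMap.range (Φ₀ : (N' × W) →ₗ[ℂ] E) = ⊤ := by
    rw [eq_top_iff, ← hW.sup_eq_top]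
    refine sup_le ?_ fun w hw => ⟨(0, ⟨w, hw⟩), by
      show Φ₀ _ = _
      simp [hΦ₀]⟩
    rintro _ ⟨z, rfl⟩
    have : z ∈ N ⊔ N' := by rw [hNN'.sup_eq_top]; trivial
    obtain ⟨a, ha, b, hb, rfl⟩ := Submodule.mem_sup.1 this
    refine ⟨(⟨b, hb⟩, 0), ?_⟩
    show Φ₀ _ = T (a + b)
    have ha' : T a = 0 := ha
    simp [hΦ₀, ha']
  let Φ := ContinuousLinearEquiv.ofBijective Φ₀ hinj hsurj
  have hΦ : ∀ p, Φ p = T p.1 + p.2 := fun p => rfl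
  let R : E →L[ℂ] E := N'.subtypeL.comp ((ContinuousLinearMap.fst ℂ N' W).comp
    (Φ.symm : E →L[ℂ] N' × W))
  let P : E →L[ℂ] W := (ContinuousLinearMap.snd ℂ N' W).comp (Φ.symm : E →L[ℂ] N' × W)
  have hTR : ∀ y, T (R y) + P y = y := fun y => by
    have := Φ.apply_symm_apply y
    rwa [hΦ] at this
  have hPT : ∀ z, (P (T z) : E) = 0 := fun z => by
    refine Submodule.disjoint_def.1 hW.disjoint _ ?_ (P (T z)).2
    rw [eq_sub_of_add_eq' (hTR (T z)), ← map_sub]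
    exact ⟨_, rfl⟩
  have hK : ∀ z, z - R (T z) ∈ N := fun z => by
    show T (z - R (T z)) = 0
    have := hTR (T z)
    rw [hPT, add_zero] at this
    rw [map_sub, this, sub_self]
  have h1 : calkinMk E T * calkinMk E R = 1 := by
    rw [← map_mul, ← map_one (calkinMk E), eq_comm, calkinMk_eq_iff]
    have : (⇑((1 : E →L[ℂ] E) - T * R) : E → E) = fun y => W.subtypeL (P y) := by
      funext y
      show y - T (R y) = P y
      rw [sub_eq_iff_eq_add', hTR y]
    rw [this]
    exact (isCompactOperator_of_locallyCompactSpace_rng W.subtypeL).comp_clm P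
  have h2 : calkinMk E R * calkinMk E T = 1 := by
    rw [← map_mul, ← map_one (calkinMk E), eq_comm, calkinMk_eq_iff]
    let Q : E →L[ℂ] N := ((1 : E →L[ℂ] E) - R * T).codRestrict N hK
    have : (⇑((1 : E →L[ℂ] E) - R * T) : E → E) = fun y => N.subtypeL (Q y) := rfl
    rw [this]
    exact (isCompactOperator_of_locallyCompactSpace_rng N.subtypeL).comp_clm Q
  exact ⟨⟨calkinMk E T, calkinMk E R, h1, h2⟩, rfl⟩

lemma isUnit_calkinMk_one_sub {S : E →L[ℂ] E} (hS : hausdorffMNC S < 1) :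
    IsUnit (calkinMk E (1 - S)) := by
  obtain ⟨V, hV, hVS⟩ := exists_finiteDimensional_sup_range hS
  exact isUnit_calkinMk_of_finiteDimensional (finiteDimensional_ker_one_sub hS) hV hVS

/-- Nussbaum's estimate of the essential spectral radius by the measure of noncompactness. -/
lemma essentialSpectralRadius_le_growthRate (T : E →L[ℂ] E) :
    essentialSpectralRadius T ≤ growthRate hausdorffMNC {T} := by
  rw [essentialSpectralRadius_eq, growthRate_singleton]
  refine iSup₂_le fun c hc => ?_
  by_contra! hlt
  obtain ⟨p, hp, hp0⟩ :=
    ((eventually_lt_of_limsup_lt hlt).and (eventually_gt_atTop 0)).exists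
  have hp0' : (0 : ℝ) < p := by exact_mod_cast hp0
  have hc0 : c ≠ 0 := by
    rintro rfl
    simp at hlt
  have hlt' : hausdorffMNC (T ^ p) < (‖c‖₊ : ℝ≥0∞) ^ p := by
    rw [one_div, ENNReal.rpow_inv_lt_iff hp0', ENNReal.rpow_natCast] at hp
    exact hp
  have hγ : hausdorffMNC ((c⁻¹ • T) ^ p) < 1 := by
    rw [smul_pow]
    refine (hausdorffMNC_smul_le _ _).trans_lt ?_
    rw [enorm_eq_nnnorm, nnnorm_pow, nnnorm_inv, ENNReal.coe_pow,
      ENNReal.coe_inv (by simpa using hc0), ← ENNReal.inv_pow, mul_comm, ← div_eq_mul_inv]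
    exact (ENNReal.div_lt_iff (Or.inl (by simp [hc0])) (Or.inl (by finiteness))).2
      (by simpa using hlt')
  have hunit := isUnit_calkinMk_one_sub hγ
  set s := calkinMk E (c⁻¹ • T) with hs
  have hfac : calkinMk E (1 - (c⁻¹ • T) ^ p) = (1 - s) * ∑ i ∈ Finset.range p, s ^ i := by
    rw [mul_neg_geom_sum, map_sub, map_one, map_pow]
  have hcomm : Commute (1 - s) (∑ i ∈ Finset.range p, s ^ i) :=
    Commute.sum_right _ _ _ fun i _ =>
      (Commute.one_left _).sub_left ((Commute.refl s).pow_right i)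
  rw [hfac, hcomm.isUnit_mul_iff] at hunit
  refine hc ?_
  have : algebraMap ℂ (CalkinAlgebra E) c - calkinMk E T = c • (1 - s) := by
    rw [smul_sub, hs, calkinMk_smul, smul_smul, mul_inv_cancel₀ hc0, one_smul,
      Algebra.algebraMap_eq_smul_one]
  rw [spectrum.mem_resolventSet_iff, this]
  exact hunit.1.smul (Units.mk0 c hc0)

end Calkin

section CalkinNorm

variable {E : Type*} [NormedAddCommGroup E] [NormedSpace ℂ E]

/-- The compact operators as a submodule of the bounded operators. -/
abbrev compactSubmodule (E : Type*) [NormedAddCommGroup E] [NormedSpace ℂ E] :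
    Submodule ℂ (E →L[ℂ] E) :=
  compactOperator (RingHom.id ℂ) E E

/-- The Calkin algebra, as a vector space, is the quotient of the bounded operators by the subspace
of compact operators. -/
def calkinToQuotient (E : Type*) [NormedAddCommGroup E] [NormedSpace ℂ E] :
    CalkinAlgebra E →+ (E →L[ℂ] E) ⧸ compactSubmodule E where
  toFun := Quotient.lift (fun A => Submodule.Quotient.mk A) fun A B h => by
    rw [Submodule.Quotient.eq]
    exact calkinMk_eq_iff.1 (Quotient.sound h)
  map_zero' := rfl
  map_add' := by
    intro x y
    obtain ⟨A, rfl⟩ := calkinMk_surjective x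
    obtain ⟨B, rfl⟩ := calkinMk_surjective y
    rfl

lemma calkinToQuotient_mk (A : E →L[ℂ] E) :
    calkinToQuotient E (calkinMk E A) = Submodule.Quotient.mk A := rfl

lemma calkinToQuotient_injective : Function.Injective (calkinToQuotient E) := by
  intro x y h
  obtain ⟨A, rfl⟩ := calkinMk_surjective x
  obtain ⟨B, rfl⟩ := calkinMk_surjective y
  rw [calkinToQuotient_mk, calkinToQuotient_mk, Submodule.Quotient.eq] at h
  exact calkinMk_eq_iff.2 h

lemma calkinToQuotient_surjective : Function.Surjective (calkinToQuotient E) := by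
  intro q
  obtain ⟨A, rfl⟩ := Submodule.Quotient.mk_surjective _ q
  exact ⟨calkinMk E A, rfl⟩

variable [CompleteSpace E]

lemma isClosed_compactSubmodule : IsClosed (compactSubmodule E : Set (E →L[ℂ] E)) :=
  isClosed_setOfPred_isCompactOperator

instance : IsClosed (compactSubmodule E : Set (E →L[ℂ] E)) := isClosed_compactSubmodule

/-- The Calkin algebra with its quotient norm. -/
@[reducible]
noncomputable def calkinNormedAddCommGroup (E : Type*) [NormedAddCommGroup E] [NormedSpace ℂ E]
    [CompleteSpace E] : NormedAddCommGroup (CalkinAlgebra E) :=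
  NormedAddCommGroup.induced _ _ (calkinToQuotient E) calkinToQuotient_injective

/-- The Calkin algebra is a normed ring. -/
@[reducible]
noncomputable def calkinNormedRing (E : Type*) [NormedAddCommGroup E] [NormedSpace ℂ E]
    [CompleteSpace E] : NormedRing (CalkinAlgebra E) :=
  { calkinNormedAddCommGroup E, (inferInstance : Ring (CalkinAlgebra E)) with
    norm_mul_le := by
      intro x y
      refine le_of_forall_pos_le_add fun ε hε => ?_
      show ‖calkinToQuotient E (x * y)‖ ≤ ‖calkinToQuotient E x‖ * ‖calkinToQuotient E y‖ + ε
      have hlim : Tendsto (fun t : ℝ => (‖calkinToQuotient E x‖ + t) *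
          (‖calkinToQuotient E y‖ + t)) (𝓝[>] 0)
          (𝓝 ((‖calkinToQuotient E x‖ + 0) * (‖calkinToQuotient E y‖ + 0))) :=
        ((continuous_const.add continuous_id).mul
          (continuous_const.add continuous_id)).continuousAt.tendsto.mono_left nhdsWithin_le_nhds
      rw [add_zero, add_zero] at hlim
      obtain ⟨t, ht, ht0⟩ := ((hlim.eventually_lt_const
        (lt_add_of_pos_right _ hε)).and self_mem_nhdsWithin).exists
      obtain ⟨A, hA, hAn⟩ := Submodule.Quotient.norm_mk_lt (calkinToQuotient E x) ht0
      obtain ⟨B, hB, hBn⟩ := Submodule.Quotient.norm_mk_lt (calkinToQuotient E y) ht0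
      rw [← calkinToQuotient_mk] at hA hB
      obtain rfl := calkinToQuotient_injective hA
      obtain rfl := calkinToQuotient_injective hB
      rw [← map_mul, calkinToQuotient_mk]
      calc ‖(Submodule.Quotient.mk (A * B) : (E →L[ℂ] E) ⧸ compactSubmodule E)‖ ≤ ‖A * B‖ :=
            Submodule.Quotient.norm_mk_le _ _
        _ ≤ ‖A‖ * ‖B‖ := norm_mul_le _ _
        _ ≤ _ := mul_le_mul hAn.le hBn.le (norm_nonneg _) ((norm_nonneg _).trans hAn.le)
        _ ≤ _ := ht.le }

/-- The quotient norm of a class dominates `γ`, so Gelfand's formula in the Calkin algebra bounds the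
growth rate of `γ`. -/
lemma growthRate_hausdorffMNC_le_essentialSpectralRadius (A : E →L[ℂ] E) :
    growthRate hausdorffMNC {A} ≤ essentialSpectralRadius A := by
  let := calkinNormedRing E
  have hnorm : ∀ x : CalkinAlgebra E, ‖x‖ = ‖calkinToQuotient E x‖ := fun _ => rfl
  let : NormedAlgebra ℂ (CalkinAlgebra E) :=
    { (inferInstance : Algebra ℂ (CalkinAlgebra E)) with
      norm_smul_le := by
        intro c x
        obtain ⟨B, rfl⟩ := calkinMk_surjective x
        rw [hnorm, hnorm, ← calkinMk_smul, calkinToQuotient_mk, calkinToQuotient_mk,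
          Submodule.Quotient.mk_smul]
        exact norm_smul_le c (Submodule.Quotient.mk B : (E →L[ℂ] E) ⧸ compactSubmodule E) }
  have hiso : Isometry (calkinToQuotient E) :=
    Isometry.of_dist_eq fun _ _ => rfl
  have : CompleteSpace (CalkinAlgebra E) := by
    rw [completeSpace_congr (e := Equiv.ofBijective _
      ⟨calkinToQuotient_injective, calkinToQuotient_surjective⟩) hiso.isUniformEmbedding]
    infer_instance
  rw [growthRate_singleton, essentialSpectralRadius_eq]
  refine le_trans (limsup_le_limsup (Eventually.of_forall fun p => ?_))
    (spectrum.limsup_pow_nnnorm_pow_one_div_le_spectralRadius (calkinMk E A))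
  refine ENNReal.rpow_le_rpow ?_ (by positivity)
  -- `γ` only sees the class modulo compact operators
  rw [← map_pow]
  refine ENNReal.le_of_forall_pos_le_add fun ε hε _ => ?_
  obtain ⟨B, hB, hBn⟩ := Submodule.Quotient.norm_mk_lt (calkinToQuotient E (calkinMk E (A ^ p)))
    (NNReal.coe_pos.2 hε)
  rw [← calkinToQuotient_mk] at hB
  have hc := hausdorffMNC_eq_zero_of_isCompactOperator
    (calkinMk_eq_iff.1 (calkinToQuotient_injective hB).symm)
  calc hausdorffMNC (A ^ p) = hausdorffMNC ((A ^ p - B) + B) := by rw [sub_add_cancel]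
    _ ≤ 0 + ‖B‖ₑ := (hausdorffMNC_add_le _ _).trans
        (add_le_add hc.le (hausdorffMNC_le_enorm B))
    _ ≤ _ := by
      rw [zero_add, enorm_eq_nnnorm, ← ENNReal.coe_add]
      exact_mod_cast hBn.le

/-- Nussbaum's formula for the essential spectral radius. -/
lemma growthRate_hausdorffMNC_singleton (A : E →L[ℂ] E) :
    growthRate hausdorffMNC {A} = essentialSpectralRadius A :=
  le_antisymm (growthRate_hausdorffMNC_le_essentialSpectralRadius A)
    (essentialSpectralRadius_le_growthRate A)

/-- Gelfand's formula for the spectral radius. -/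
lemma growthRate_enorm_singleton (A : E →L[ℂ] E) :
    growthRate (fun A => ‖A‖ₑ) {A} = spectralRadius ℂ A := by
  rw [growthRate_singleton]
  exact (spectrum.pow_nnnorm_pow_one_div_tendsto_nhds_spectralRadius A).limsup_eq

end CalkinNorm

/-! ### Elementary lattice structure of a Banach function space -/

section Exhaustion

variable {X : Type*} [MeasurableSpace X]

/-- Exhaustion: a family of measurable sets that is closed under countable unions and meets every
set of positive measure in a set of positive measure contains a set of full measure. -/
lemma exists_mem_measure_compl_eq_zero (μ : Measure X) [SigmaFinite μ] (𝒮 : Set (Set X))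
    (hm : ∀ S ∈ 𝒮, MeasurableSet S) (h0 : ∅ ∈ 𝒮)
    (hU : ∀ s : ℕ → Set X, (∀ n, s n ∈ 𝒮) → (⋃ n, s n) ∈ 𝒮)
    (hpos : ∀ Y, MeasurableSet Y → μ Y ≠ 0 → ∃ S ∈ 𝒮, μ (S ∩ Y) ≠ 0) :
    ∃ S ∈ 𝒮, μ Sᶜ = 0 := by
  set ν := μ.toFinite with hν
  have hμν : μ ≪ ν := absolutelyContinuous_toFinite μ
  have hne : (ν '' 𝒮).Nonempty := ⟨_, ∅, h0, rfl⟩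
  obtain ⟨u, -, hu, huS⟩ := exists_seq_tendsto_sSup hne (OrderTop.bddAbove _)
  choose s hs hsu using huS
  set U := ⋃ n, s n with hUdef
  have hU' : U ∈ 𝒮 := hU s hs
  have hsup : sSup (ν '' 𝒮) ≤ ν U :=
    le_of_tendsto' hu fun n => (hsu n).symm.trans_le (measure_mono (Set.subset_iUnion s n))
  refine ⟨U, hU', ?_⟩
  by_contra hne0
  obtain ⟨S, hS, hSU⟩ := hpos Uᶜ (hm U hU').compl hne0
  have hun : U ∪ S ∈ 𝒮 := by
    have := hU (fun n => if n = 0 then U else S) (fun n => by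
      show (if n = 0 then U else S) ∈ 𝒮
      split_ifs <;> assumption)
    convert this using 1
    ext x
    simp only [Set.mem_union, Set.mem_iUnion]
    constructor
    · rintro (h | h)
      · exact ⟨0, by simpa using h⟩
      · exact ⟨1, by simpa using h⟩
    · rintro ⟨n, hn⟩
      split_ifs at hn
      · exact Or.inl hn
      · exact Or.inr hn
  have h1 : ν (U ∪ S) ≤ ν U := (le_sSup (Set.mem_image_of_mem _ hun)).trans hsup
  have h2 : ν (U ∪ S) = ν U + ν (S ∩ Uᶜ) := by
    rw [← Set.union_sdiff_self, measure_union Set.disjoint_sdiff_right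
      ((hm S hS).diff (hm U hU')), Set.sdiff_eq]
  have h3 : ν (S ∩ Uᶜ) ≠ 0 := fun h => hSU (hμν h)
  rw [h2] at h1
  exact absurd h1 (not_le.2 (ENNReal.lt_add_right (measure_ne_top ν U) h3))

end Exhaustion

namespace BanachFunctionSpace

variable {X : Type*} [MeasurableSpace X] {μ : Measure X} (L : BanachFunctionSpace μ)

variable {L}

lemma coeFn_stronglyMeasurable (f : L.Space) : StronglyMeasurable f :=
  AEEqFun.stronglyMeasurable _

lemma coeFn_measurable (f : L.Space) : Measurable f := (coeFn_stronglyMeasurable f).measurable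

lemma coeFn_add (f g : L.Space) : ∀ᵐ x ∂μ, (f + g : L.Space) x = f x + g x :=
  AEEqFun.coeFn_add (L.toAE f) (L.toAE g)

lemma coeFn_sub (f g : L.Space) : ∀ᵐ x ∂μ, (f - g : L.Space) x = f x - g x :=
  AEEqFun.coeFn_sub (L.toAE f) (L.toAE g)

lemma coeFn_neg (f : L.Space) : ∀ᵐ x ∂μ, (-f : L.Space) x = -f x :=
  AEEqFun.coeFn_neg (L.toAE f)

lemma coeFn_smul (c : ℂ) (f : L.Space) : ∀ᵐ x ∂μ, (c • f : L.Space) x = c * f x :=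
  AEEqFun.coeFn_smul c (L.toAE f)

lemma coeFn_zero : ∀ᵐ x ∂μ, (0 : L.Space) x = 0 := AEEqFun.coeFn_zero

lemma ext_ae {f g : L.Space} (h : ∀ᵐ x ∂μ, f x = g x) : f = g :=
  Subtype.ext (AEEqFun.ext h)

lemma norm_le_norm {f g : L.Space} (h : ∀ᵐ x ∂μ, ‖g x‖ ≤ ‖f x‖) : ‖g‖ ≤ ‖f‖ :=
  (L.solid f g.1 h).2

lemma exists_of_le (f : L.Space) (g : X → ℂ) (hg : AEStronglyMeasurable g μ)
    (h : ∀ᵐ x ∂μ, ‖g x‖ ≤ ‖f x‖) : ∃ g' : L.Space, ∀ᵐ x ∂μ, g' x = g x := by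
  have hmk := AEEqFun.coeFn_mk g hg
  obtain ⟨hmem, -⟩ := L.solid f (AEEqFun.mk g hg) (by
    filter_upwards [hmk, h] with x h1 h2
    rwa [h1])
  exact ⟨⟨AEEqFun.mk g hg, hmem⟩, hmk⟩

/-- The element of `L` represented by a measurable function `g` with `|g| ≤ |f|`, `f ∈ L`. -/
noncomputable def ofLe (f : L.Space) (g : X → ℂ) (hg : AEStronglyMeasurable g μ)
    (h : ∀ᵐ x ∂μ, ‖g x‖ ≤ ‖f x‖) : L.Space := (exists_of_le f g hg h).choose

lemma coeFn_ofLe (f : L.Space) (g : X → ℂ) (hg : AEStronglyMeasurable g μ)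
    (h : ∀ᵐ x ∂μ, ‖g x‖ ≤ ‖f x‖) : ∀ᵐ x ∂μ, ofLe f g hg h x = g x :=
  (exists_of_le f g hg h).choose_spec

lemma norm_ofLe_le (f : L.Space) (g : X → ℂ) (hg : AEStronglyMeasurable g μ)
    (h : ∀ᵐ x ∂μ, ‖g x‖ ≤ ‖f x‖) : ‖ofLe f g hg h‖ ≤ ‖f‖ :=
  norm_le_norm (by filter_upwards [coeFn_ofLe f g hg h, h] with x h1 h2; rwa [h1])

/-- The modulus `|f|` of `f ∈ L`. -/
noncomputable def modulus (f : L.Space) : L.Space :=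
  ofLe f (fun x => (‖f x‖ : ℂ))
    (Complex.measurable_ofReal.comp (coeFn_measurable f).norm).aestronglyMeasurable
    (Eventually.of_forall fun x => by simp)

lemma coeFn_modulus (f : L.Space) : ∀ᵐ x ∂μ, modulus f x = (‖f x‖ : ℂ) := coeFn_ofLe _ _ _ _

lemma norm_modulus (f : L.Space) : ‖modulus f‖ = ‖f‖ := by
  refine le_antisymm (norm_ofLe_le _ _ _ _) (norm_le_norm ?_)
  filter_upwards [coeFn_modulus f] with x hx
  simp [hx]

lemma modulus_mem_posCone (f : L.Space) : modulus f ∈ L.posCone := by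
  filter_upwards [coeFn_modulus f] with x hx
  simp [hx]

lemma mem_posCone_iff {f : L.Space} : f ∈ L.posCone ↔ ∀ᵐ x ∂μ, f x = (‖f x‖ : ℂ) := by
  refine ⟨fun h => ?_, fun h => ?_⟩
  · filter_upwards [h] with x hx
    have h1 : f x = ((f x).re : ℂ) := Complex.ext (by simp) (by simp [hx.2])
    rw [h1, Complex.norm_real, Real.norm_of_nonneg hx.1]
  · filter_upwards [h] with x hx
    rw [hx]
    simp

lemma modulus_eq_self {f : L.Space} (hf : f ∈ L.posCone) : modulus f = f :=
  ext_ae (by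
    filter_upwards [coeFn_modulus f, mem_posCone_iff.1 hf] with x h1 h2
    rw [h1, ← h2])

lemma zero_mem_posCone : (0 : L.Space) ∈ L.posCone := by
  filter_upwards [coeFn_zero (L := L)] with x hx
  simp [hx]

lemma add_mem_posCone {f g : L.Space} (hf : f ∈ L.posCone) (hg : g ∈ L.posCone) :
    f + g ∈ L.posCone := by
  filter_upwards [hf, hg, coeFn_add f g] with x h1 h2 h3
  rw [h3, Complex.add_re, Complex.add_im, h1.2, h2.2]
  exact ⟨add_nonneg h1.1 h2.1, add_zero 0⟩

lemma smul_mem_posCone {f : L.Space} (hf : f ∈ L.posCone) {c : ℝ} (hc : 0 ≤ c) :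
    (c : ℂ) • f ∈ L.posCone := by
  filter_upwards [hf, coeFn_smul (c : ℂ) f] with x h1 h2
  rw [h2, Complex.re_ofReal_mul, Complex.im_ofReal_mul, h1.2, mul_zero]
  exact ⟨mul_nonneg hc h1.1, rfl⟩

lemma sum_mem_posCone {ι : Type*} (s : Finset ι) {f : ι → L.Space}
    (hf : ∀ i ∈ s, f i ∈ L.posCone) : ∑ i ∈ s, f i ∈ L.posCone := by
  classical
  induction s using Finset.induction_on with
  | empty => simpa using zero_mem_posCone
  | insert i s hi ih =>
    rw [Finset.sum_insert hi]
    exact add_mem_posCone (hf i (by simp)) (ih fun j hj => hf j (by simp [hj]))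

/-- The cone `L₊` is closed: the negative part of a limit of elements of `L₊` is dominated by the
distances to these elements. -/
lemma isClosed_posCone : IsClosed L.posCone := by
  refine IsSeqClosed.isClosed fun u f hu hf => ?_
  have hnorm : Tendsto (fun n => ‖f - u n‖) atTop (𝓝 0) := by
    have := (tendsto_const_nhds (x := f)).sub hf
    simpa using this.norm
  have hsmall : ∀ k : ℂ → ℝ, Measurable k → (∀ z w : ℂ, 0 ≤ w.re → w.im = 0 → |k z| ≤ ‖z - w‖) →
      ∀ᵐ x ∂μ, k (f x) = 0 := by
    intro k hk hkz
    have hle : ∀ z, |k z| ≤ ‖z‖ := fun z => by simpa using hkz z 0 (by simp) (by simp)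
    let g : L.Space := ofLe f (fun x => (k (f x) : ℂ))
      (Complex.measurable_ofReal.comp (hk.comp (coeFn_measurable f))).aestronglyMeasurable
      (Eventually.of_forall fun x => by simpa using hle (f x))
    have hg : ∀ᵐ x ∂μ, g x = (k (f x) : ℂ) := coeFn_ofLe _ _ _ _
    have hgn : ∀ n, ‖g‖ ≤ ‖f - u n‖ := fun n => norm_le_norm (by
      filter_upwards [hg, coeFn_sub f (u n), hu n] with x h1 h2 h3
      rw [h1, h2, Complex.norm_real]
      exact hkz _ _ h3.1 h3.2)
    have hg0 : g = 0 := norm_le_zero_iff.1 (ge_of_tendsto' hnorm hgn)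
    filter_upwards [hg, coeFn_zero (L := L)] with x h1 h2
    rw [hg0, h2] at h1
    exact_mod_cast h1.symm
  have h1 := hsmall (fun z => min z.re 0) (Complex.measurable_re.min measurable_const)
    (fun z w h1 h2 => by
      refine le_trans ?_ (Complex.abs_re_le_norm (z - w))
      rw [Complex.sub_re]
      rcases le_total z.re 0 with h | h
      · rw [min_eq_left h, abs_of_nonpos h, abs_of_nonpos (by linarith)]
        linarith
      · simp [min_eq_right h])
  have h2 := hsmall (fun z => z.im) Complex.measurable_im (fun z w h1 h2 => by
      refine le_trans ?_ (Complex.abs_im_le_norm (z - w))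
      rw [Complex.sub_im, h2, sub_zero])
  filter_upwards [h1, h2] with x h1 h2
  exact ⟨min_eq_right_iff.1 h1, h2⟩

/-- A weak unit: if `μ` is `σ`-finite, then `L` contains a function that is positive almost
everywhere. -/
lemma exists_weakUnit [SigmaFinite μ] (L : BanachFunctionSpace μ) :
    ∃ w : L.Space, ∀ᵐ x ∂μ, 0 < (w x).re ∧ (w x).im = 0 := by
  obtain ⟨S, ⟨hS, f, hf⟩, hS0⟩ := exists_mem_measure_compl_eq_zero μ
    {S | MeasurableSet S ∧ ∃ f : L.Space, ∀ᵐ x ∂μ, x ∈ S → f x ≠ 0} (fun S hS => hS.1)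
    ⟨MeasurableSet.empty, 0, by simp⟩
    (by
      intro s hs
      refine ⟨MeasurableSet.iUnion fun n => (hs n).1, ?_⟩
      choose f hf using fun n => (hs n).2
      have hpos : ∀ n, 0 < 1 + ‖f n‖ := fun n => by positivity
      let h : ℕ → L.Space := fun n => (((1 / 2) ^ n / (1 + ‖f n‖) : ℝ) : ℂ) • modulus (f n)
      have hhpos : ∀ n, h n ∈ L.posCone := fun n =>
        smul_mem_posCone (modulus_mem_posCone _) (by positivity)
      have hsum : Summable h := by
        refine Summable.of_norm_bounded summable_geometric_two fun n => ?_
        rw [norm_smul, norm_modulus, Complex.norm_real, Real.norm_of_nonneg (by positivity),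
          div_mul_eq_mul_div, div_le_iff₀ (hpos n)]
        gcongr
        linarith
      have hge : ∀ n, (∑' n, h n) - h n ∈ L.posCone := by
        intro n
        refine isClosed_posCone.mem_of_tendsto (hsum.hasSum.tendsto_sum_nat.sub_const (h n)) ?_
        filter_upwards [eventually_gt_atTop n] with N hN
        rw [← Finset.sum_erase_eq_sub (Finset.mem_range.2 hN)]
        exact sum_mem_posCone _ fun i _ => hhpos i
      refine ⟨∑' n, h n, ?_⟩
      have h1 := fun n => coeFn_sub (∑' n, h n) (h n)
      have h2 := fun n => coeFn_smul (((1 / 2) ^ n / (1 + ‖f n‖) : ℝ) : ℂ) (modulus (f n))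
      have h3 := fun n => coeFn_modulus (f n)
      filter_upwards [ae_all_iff.2 h1, ae_all_iff.2 h2, ae_all_iff.2 h3, ae_all_iff.2 hf,
        ae_all_iff.2 hge] with x h1 h2 h3 h4 h5 hx h0
      obtain ⟨n, hn⟩ := Set.mem_iUnion.1 hx
      have h6 := (h5 n).1
      have h7 : h n x = (((1 / 2) ^ n / (1 + ‖f n‖) * ‖f n x‖ : ℝ) : ℂ) := by
        rw [h2 n, h3 n]; push_cast; ring
      rw [h1 n, h0, h7, zero_sub, Complex.neg_re, Complex.ofReal_re] at h6
      have h8 : 0 < ‖f n x‖ := norm_pos_iff.2 (h4 n hn)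
      have h9 : 0 < (1 / 2) ^ n / (1 + ‖f n‖) * ‖f n x‖ := by positivity
      linarith)
    (by
      intro Y hY hY0
      have := not_exists.1 L.full Y
      simp only [not_and, not_forall] at this
      obtain ⟨f, hf⟩ := this hY (pos_iff_ne_zero.2 hY0)
      let f' : L.Space := f
      have hfm : MeasurableSet {x | f' x ≠ 0} :=
        (measurableSet_eq_fun (coeFn_measurable f') measurable_const).compl
      refine ⟨{x | f' x ≠ 0}, ⟨hfm, f', Eventually.of_forall fun x hx => hx⟩, fun h0 => hf ?_⟩
      have h1 : ∀ᵐ x ∂μ, x ∉ {x | f' x ≠ 0} ∩ Y := measure_eq_zero_iff_ae_notMem.1 h0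
      filter_upwards [h1] with x hx hxY
      by_contra hne
      exact hx ⟨hne, hxY⟩)
  refine ⟨modulus f, ?_⟩
  have hS1 : ∀ᵐ x ∂μ, x ∈ S := by
    filter_upwards [measure_eq_zero_iff_ae_notMem.1 hS0] with x hx
    simpa using hx
  filter_upwards [hf, hS1, coeFn_modulus f] with x h1 h2 h3
  rw [h3]
  simpa using h1 h2

/-- In a space with order continuous norm, a decreasing sequence in `L₊` that tends to zero almost
everywhere tends to zero in norm. -/
lemma tendsto_norm_of_antitone (hoc : HasOrderContinuousNorm L.posCone) {f : ℕ → L.Space}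
    (hf : ∀ n, f n ∈ L.posCone) (hanti : ∀ n, f n - f (n + 1) ∈ L.posCone)
    (hlim : ∀ᵐ x ∂μ, Tendsto (fun n => f n x) atTop (𝓝 0)) :
    Tendsto (fun n => ‖f n‖) atTop (𝓝 0) := by
  refine hoc f hf hanti fun g hg => ?_
  have h1 := fun n => coeFn_sub (f n) g
  filter_upwards [hlim, ae_all_iff.2 hg, ae_all_iff.2 h1, coeFn_sub 0 g, coeFn_zero (L := L),
    ae_all_iff.2 hf] with x h1 h2 h3 h4 h5 h6
  have hre : Tendsto (fun n => (f n x).re) atTop (𝓝 0) :=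
    (Complex.continuous_re.tendsto 0).comp h1
  rw [h4, h5, zero_sub, Complex.neg_re, Complex.neg_im]
  constructor
  · refine neg_nonneg.2 (ge_of_tendsto' hre fun n => ?_)
    have := (h2 n).1
    rw [h3 n, Complex.sub_re] at this
    linarith
  · have := (h2 0).2
    rw [h3 0, Complex.sub_im, (h6 0).2] at this
    linarith

end BanachFunctionSpace

/-! ### Kernels: positivity and uniqueness -/

section Rectangles

variable {X Y : Type*} [MeasurableSpace X] [MeasurableSpace Y]

/-- The sets that are unions of cells of a grid given by countable measurable partitions of the two
factors. They form an algebra that contains the rectangles. -/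
def gridSets (X Y : Type*) [MeasurableSpace X] [MeasurableSpace Y] : Set (Set (X × Y)) :=
  {W | ∃ s : X → ℕ, ∃ t : Y → ℕ, ∃ P : Set (ℕ × ℕ), Measurable s ∧ Measurable t ∧
    W = Prod.map s t ⁻¹' P}

lemma isSetAlgebra_gridSets : IsSetAlgebra (gridSets X Y) where
  empty_mem := ⟨fun _ => 0, fun _ => 0, ∅, measurable_const, measurable_const, by simp⟩
  compl_mem := by
    rintro _ ⟨s, t, P, hs, ht, rfl⟩
    exact ⟨s, t, Pᶜ, hs, ht, rfl⟩
  union_mem := by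
    rintro _ _ ⟨s, t, P, hs, ht, rfl⟩ ⟨s', t', P', hs', ht', rfl⟩
    refine ⟨fun x => Nat.pair (s x) (s' x), fun y => Nat.pair (t y) (t' y),
      {p | (p.1.unpair.1, p.2.unpair.1) ∈ P ∨ (p.1.unpair.2, p.2.unpair.2) ∈ P'}, ?_, ?_, ?_⟩
    · exact (measurable_of_countable (fun p : ℕ × ℕ => Nat.pair p.1 p.2)).comp (hs.prodMk hs')
    · exact (measurable_of_countable (fun p : ℕ × ℕ => Nat.pair p.1 p.2)).comp (ht.prodMk ht')
    · ext p
      simp [Prod.map]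

lemma generateFrom_gridSets :
    (inferInstance : MeasurableSpace (X × Y)) = MeasurableSpace.generateFrom (gridSets X Y) := by
  classical
  refine le_antisymm ?_ (MeasurableSpace.generateFrom_le ?_)
  · rw [← generateFrom_prod]
    refine MeasurableSpace.generateFrom_mono ?_
    rintro _ ⟨F, hF, E, hE, rfl⟩
    refine ⟨fun x => if x ∈ F then 1 else 0, fun y => if y ∈ E then 1 else 0, {(1, 1)},
      Measurable.ite hF measurable_const measurable_const,
      Measurable.ite hE measurable_const measurable_const, ?_⟩
    ext p
    simp [Prod.ext_iff]
  · rintro _ ⟨s, t, P, hs, ht, rfl⟩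
    exact (hs.prodMap ht) P.to_countable.measurableSet

/-- For finite measures on a product, an inequality on the measurable rectangles implies the
inequality on all measurable sets. -/
lemma measure_le_of_rectangles {ν₁ ν₂ : Measure (X × Y)} [IsFiniteMeasure ν₁] [IsFiniteMeasure ν₂]
    (h : ∀ F E, MeasurableSet F → MeasurableSet E → ν₂ (F ×ˢ E) ≤ ν₁ (F ×ˢ E))
    {W : Set (X × Y)} (hW : MeasurableSet W) : ν₂ W ≤ ν₁ W := by
  have hgrid : ∀ V ∈ gridSets X Y, ν₂ V ≤ ν₁ V := by
    rintro _ ⟨s, t, P, hs, ht, rfl⟩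
    have hst := hs.prodMap ht
    have hle : ν₂.map (Prod.map s t) ≤ ν₁.map (Prod.map s t) := by
      refine Measure.le_iff.2 fun Q hQ => ?_
      rw [← Set.biUnion_of_singleton Q, measure_biUnion Q.to_countable
        (fun a _ b _ hab => by simpa using hab) (fun a _ => MeasurableSet.singleton a),
        measure_biUnion Q.to_countable
        (fun a _ b _ hab => by simpa using hab) (fun a _ => MeasurableSet.singleton a)]
      refine ENNReal.tsum_le_tsum fun p => ?_
      rw [Measure.map_apply hst (MeasurableSet.singleton _),
        Measure.map_apply hst (MeasurableSet.singleton _)]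
      have : Prod.map s t ⁻¹' {(p : ℕ × ℕ)} = (s ⁻¹' {p.1.1}) ×ˢ (t ⁻¹' {p.1.2}) := by
        ext q
        simp [Prod.ext_iff]
      rw [this]
      exact h _ _ (hs (MeasurableSet.singleton _)) (ht (MeasurableSet.singleton _))
    have := hle P
    rwa [Measure.map_apply hst P.to_countable.measurableSet,
      Measure.map_apply hst P.to_countable.measurableSet] at this
  have hdense := Measure.MeasureDense.of_generateFrom_isSetAlgebra_finite (μ := ν₁ + ν₂)
    isSetAlgebra_gridSets generateFrom_gridSets
  refine ENNReal.le_of_forall_pos_le_add fun ε hε _ => ?_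
  obtain ⟨V, hV, hVW⟩ := hdense.approx W hW (measure_ne_top _ _) (ε / 2) (by positivity)
  have hsd : ν₁ (symmDiff W V) + ν₂ (symmDiff W V) < ENNReal.ofReal (ε / 2) := by
    simpa using hVW
  have h1 : ν₁ (V \ W) ≤ ENNReal.ofReal (ε / 2) :=
    (measure_mono (by rw [Set.symmDiff_def]; exact Set.subset_union_right)).trans
      (le_self_add.trans hsd.le)
  have h2 : ν₂ (W \ V) ≤ ENNReal.ofReal (ε / 2) :=
    (measure_mono (by rw [Set.symmDiff_def]; exact Set.subset_union_left)).trans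
      (le_add_self.trans hsd.le)
  calc ν₂ W ≤ ν₂ V + ν₂ (W \ V) :=
        (measure_le_inter_add_sdiff ν₂ W V).trans
          (add_le_add (measure_mono Set.inter_subset_right) le_rfl)
    _ ≤ ν₁ V + ENNReal.ofReal (ε / 2) := add_le_add (hgrid V hV) h2
    _ ≤ (ν₁ W + ν₁ (V \ W)) + ENNReal.ofReal (ε / 2) := by
        gcongr
        exact (measure_le_inter_add_sdiff ν₁ V W).trans
          (add_le_add (measure_mono Set.inter_subset_right) le_rfl)
    _ ≤ (ν₁ W + ENNReal.ofReal (ε / 2)) + ENNReal.ofReal (ε / 2) := by gcongr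
    _ = ν₁ W + ε := by
        rw [add_assoc, ← ENNReal.ofReal_add (by positivity) (by positivity), add_halves,
          ENNReal.ofReal_coe_nnreal]

lemma ae_nonneg_of_setIntegral_prod_nonneg {ν : Measure (X × Y)} {c : X × Y → ℝ}
    (hc : Integrable c ν)
    (h : ∀ F E, MeasurableSet F → MeasurableSet E → 0 ≤ ∫ p in F ×ˢ E, c p ∂ν) :
    0 ≤ᵐ[ν] c := by
  have hpos := hc.lintegral_lt_top
  have hneg := hc.neg.lintegral_lt_top
  have hf1 : IsFiniteMeasure (ν.withDensity fun p => ENNReal.ofReal (c p)) :=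
    isFiniteMeasure_withDensity hpos.ne
  have hf2 : IsFiniteMeasure (ν.withDensity fun p => ENNReal.ofReal (-c p)) :=
    isFiniteMeasure_withDensity hneg.ne
  have hint : ∀ W, MeasurableSet W → ∫ p in W, c p ∂ν =
      ((ν.withDensity fun p => ENNReal.ofReal (c p)) W).toReal -
      ((ν.withDensity fun p => ENNReal.ofReal (-c p)) W).toReal := fun W hW => by
    rw [integral_eq_lintegral_pos_part_sub_lintegral_neg_part hc.integrableOn,
      withDensity_apply _ hW, withDensity_apply _ hW]
  refine ae_nonneg_of_forall_setIntegral_nonneg hc fun W hW _ => ?_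
  rw [hint W hW, sub_nonneg]
  refine ENNReal.toReal_mono (measure_ne_top _ _) (measure_le_of_rectangles (fun F E hF hE => ?_) hW)
  have := h F E hF hE
  rw [hint _ (hF.prod hE), sub_nonneg] at this
  exact (ENNReal.toReal_le_toReal (measure_ne_top _ _) (measure_ne_top _ _)).1 this

end Rectangles

namespace BanachFunctionSpace

variable {X : Type*} [MeasurableSpace X] {μ : Measure X} [SigmaFinite μ]
  {L : BanachFunctionSpace μ}

lemma HasKernel.congr {A : L.Op} {a a' : X × X → ℂ} (h : L.HasKernel A a)
    (haa : a =ᵐ[μ.prod μ] a') : L.HasKernel A a' := by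
  refine ⟨h.1.congr haa, fun f => ?_⟩
  filter_upwards [h.2 f, Measure.ae_ae_of_ae_prod haa] with x hx hxx
  have : (fun y => a (x, y) * f y) =ᵐ[μ] fun y => a' (x, y) * f y := by
    filter_upwards [hxx] with y hy
    rw [hy]
  exact ⟨hx.1.congr this, hx.2.trans (integral_congr_ae this)⟩

lemma HasKernel.sub {A B : L.Op} {a b : X × X → ℂ} (hA : L.HasKernel A a)
    (hB : L.HasKernel B b) : L.HasKernel (A - B) (fun p => a p - b p) := by
  refine ⟨hA.1.sub hB.1, fun f => ?_⟩
  filter_upwards [hA.2 f, hB.2 f, coeFn_sub (A f) (B f)] with x h1 h2 h3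
  have : (fun y => (a (x, y) - b (x, y)) * f y) =
      fun y => a (x, y) * f y - b (x, y) * f y := by
    funext y; ring
  rw [this]
  refine ⟨h1.1.sub h2.1, ?_⟩
  rw [integral_sub h1.1 h2.1, ← h1.2, ← h2.2, ← h3]
  rfl

lemma HasKernel.add {A B : L.Op} {a b : X × X → ℂ} (hA : L.HasKernel A a)
    (hB : L.HasKernel B b) : L.HasKernel (A + B) (fun p => a p + b p) := by
  refine ⟨hA.1.add hB.1, fun f => ?_⟩
  filter_upwards [hA.2 f, hB.2 f, coeFn_add (A f) (B f)] with x h1 h2 h3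
  have : (fun y => (a (x, y) + b (x, y)) * f y) =
      fun y => a (x, y) * f y + b (x, y) * f y := by
    funext y; ring
  rw [this]
  refine ⟨h1.1.add h2.1, ?_⟩
  rw [integral_add h1.1 h2.1, ← h1.2, ← h2.2, ← h3]
  rfl

lemma HasKernel.smul {A : L.Op} {a : X × X → ℂ} (hA : L.HasKernel A a) (c : ℂ) :
    L.HasKernel (c • A) (fun p => c * a p) := by
  refine ⟨hA.1.const_mul c, fun f => ?_⟩
  filter_upwards [hA.2 f, coeFn_smul c (A f)] with x h1 h3
  simp only [mul_assoc]
  refine ⟨h1.1.const_mul c, ?_⟩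
  rw [integral_const_mul, ← h1.2, ← h3]
  rfl

lemma hasKernel_zero : L.HasKernel 0 (fun _ => 0) := by
  refine ⟨aemeasurable_const, fun f => ?_⟩
  filter_upwards [coeFn_zero (L := L)] with x hx
  simpa using hx

/-- The kernel of a positive kernel operator is nonnegative almost everywhere. Multiplied by a
suitable strictly positive function `g(x) w(y)` it becomes integrable, and its integrals over
rectangles are nonnegative. -/
lemma HasKernel.ae_nonneg {A : L.Op} {a : X × X → ℂ} (h : L.HasKernel A a)
    (hA : ∀ f ∈ L.posCone, A f ∈ L.posCone) :
    ∀ᵐ p ∂(μ.prod μ), 0 ≤ (a p).re ∧ (a p).im = 0 := by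
  wlog ham : Measurable a generalizing a
  · have h1 := h.1.ae_eq_mk
    have h2 := this (h.congr h1) h.1.measurable_mk
    filter_upwards [h1, h2] with p h1 h2
    rwa [h1]
  obtain ⟨w, hw⟩ := exists_weakUnit L
  have hwm := coeFn_measurable w
  obtain ⟨v, hv0, hvm, hv⟩ := exists_pos_lintegral_lt_of_sigmaFinite μ (ε := 1) one_ne_zero
  -- `H` is the normalizing integral in the second variable
  set H : X → ℝ≥0∞ := fun x => ∫⁻ y, ‖a (x, y) * w y‖ₑ ∂μ with hH
  have hHm : Measurable H := by
    refine Measurable.lintegral_prod_right' (f := fun p : X × X => ‖a p * w p.2‖ₑ) ?_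
    exact (ham.mul (hwm.comp measurable_snd)).enorm
  have hHfin : ∀ᵐ x ∂μ, H x < ⊤ := by
    filter_upwards [h.2 w] with x hx
    exact hx.1.2
  set g : X → ℝ := fun x => v x / (1 + (H x).toReal) with hg
  have hgm : Measurable g := hvm.coe_nnreal_real.div (measurable_const.add hHm.ennreal_toReal)
  have hg0 : ∀ x, 0 < g x := fun x =>
    div_pos (hv0 x) (by positivity)
  set c : X × X → ℂ := fun p => (g p.1 : ℂ) * (a p * w p.2) with hc
  have hcm : Measurable c :=
    (Complex.measurable_ofReal.comp (hgm.comp measurable_fst)).mul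
      (ham.mul (hwm.comp measurable_snd))
  have hci : Integrable c (μ.prod μ) := by
    refine ⟨hcm.aestronglyMeasurable, ?_⟩
    rw [hasFiniteIntegral_iff_enorm, lintegral_prod _ hcm.enorm.aemeasurable]
    refine lt_of_le_of_lt (lintegral_mono_ae ?_) (hv.trans ENNReal.one_lt_top)
    filter_upwards [hHfin] with x hx
    have h1 : ∀ y, ‖c (x, y)‖ₑ = ENNReal.ofReal (g x) * ‖a (x, y) * w y‖ₑ := fun y => by
      simp only [hc, enorm_mul]
      congr 1
      rw [← ofReal_norm, Complex.norm_real, Real.norm_of_nonneg (hg0 x).le]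
    simp_rw [h1]
    rw [lintegral_const_mul' _ _ ENNReal.ofReal_ne_top]
    change ENNReal.ofReal (g x) * H x ≤ v x
    rw [← ENNReal.ofReal_toReal hx.ne, ← ENNReal.ofReal_mul (hg0 x).le,
      ← ENNReal.ofReal_coe_nnreal]
    refine ENNReal.ofReal_le_ofReal ?_
    rw [hg, div_mul_eq_mul_div, div_le_iff₀ (by positivity)]
    have := (v x).coe_nonneg
    nlinarith [ENNReal.toReal_nonneg (a := H x)]
  have hrect : ∀ F E, MeasurableSet F → MeasurableSet E → ∃ u : X → ℂ,
      (∀ᵐ x ∂μ, 0 ≤ (u x).re ∧ (u x).im = 0) ∧ IntegrableOn u F μ ∧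
      ∫ p in F ×ˢ E, c p ∂(μ.prod μ) = ∫ x in F, u x ∂μ := by
    intro F E hF hE
    let wE : L.Space := ofLe w (E.indicator w) (hwm.indicator hE).aestronglyMeasurable
      (Eventually.of_forall fun x => norm_indicator_le_norm_self _ _)
    have hwE : ∀ᵐ x ∂μ, wE x = E.indicator w x := coeFn_ofLe _ _ _ _
    have hwEpos : wE ∈ L.posCone := by
      filter_upwards [hwE, hw] with x h1 h2
      rw [h1]
      by_cases hx : x ∈ E
      · rw [Set.indicator_of_mem hx]; exact ⟨h2.1.le, h2.2⟩
      · rw [Set.indicator_of_notMem hx]; simp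
    have hint : ∀ᵐ x ∂μ, ∫ y in E, c (x, y) ∂μ = g x * A wE x := by
      filter_upwards [h.2 wE] with x hx
      rw [hx.2, ← integral_const_mul, ← integral_indicator hE]
      refine integral_congr_ae ?_
      filter_upwards [hwE] with y hy
      rw [hy]
      by_cases hyE : y ∈ E <;> simp [hyE, hc]
    have hci' : Integrable c ((μ.restrict F).prod (μ.restrict E)) := by
      rw [Measure.prod_restrict]
      exact hci.integrableOn
    refine ⟨fun x => g x * A wE x, ?_, ?_, ?_⟩
    · filter_upwards [hA wE hwEpos] with x hx
      rw [Complex.re_ofReal_mul, Complex.im_ofReal_mul, hx.2, mul_zero]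
      exact ⟨mul_nonneg (hg0 x).le hx.1, rfl⟩
    · refine hci'.integral_prod_left.congr ?_
      exact ae_restrict_of_ae hint
    · rw [← Measure.prod_restrict, integral_prod _ hci']
      exact integral_congr_ae (ae_restrict_of_ae hint)
  have hφ : ∀ φ : ℂ →L[ℝ] ℝ, (∀ z : ℂ, 0 ≤ z.re → z.im = 0 → 0 ≤ φ z) →
      ∀ᵐ p ∂(μ.prod μ), 0 ≤ φ (c p) := by
    intro φ hφ
    refine ae_nonneg_of_setIntegral_prod_nonneg (φ.integrable_comp hci) fun F E hF hE => ?_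
    obtain ⟨u, hu, hui, hcu⟩ := hrect F E hF hE
    rw [φ.integral_comp_comm hci.integrableOn, hcu, ← φ.integral_comp_comm hui]
    refine integral_nonneg_of_ae (ae_restrict_of_ae ?_)
    filter_upwards [hu] with x hx
    exact hφ _ hx.1 hx.2
  have hwp : ∀ᵐ p ∂(μ.prod μ), 0 < (w p.2).re ∧ (w p.2).im = 0 :=
    Measure.quasiMeasurePreserving_snd.ae hw
  filter_upwards [hφ Complex.reCLM (fun z h _ => h), hφ Complex.imCLM (fun z _ h => h.ge),
    hφ (-Complex.imCLM) (fun z _ h => by simp [h]), hwp] with p h1 h2 h3 h4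
  have hcp : c p = ((g p.1 * (w p.2).re : ℝ) : ℂ) * a p := by
    have : w p.2 = ((w p.2).re : ℂ) := Complex.ext (by simp) (by simp [h4.2])
    simp only [hc]
    rw [this]
    push_cast
    ring_nf
    simp
  have hpos : 0 < g p.1 * (w p.2).re := mul_pos (hg0 _) h4.1
  simp only [neg_apply, Complex.reCLM_apply, Complex.imCLM_apply, hcp,
    Complex.re_ofReal_mul, Complex.im_ofReal_mul] at h1 h2 h3
  refine ⟨nonneg_of_mul_nonneg_right h1 hpos, le_antisymm ?_ (nonneg_of_mul_nonneg_right h2 hpos)⟩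
  have : 0 ≤ (g p.1 * (w p.2).re) * (-(a p).im) := by rw [mul_neg]; exact h3
  have := nonneg_of_mul_nonneg_right this hpos
  linarith

/-- The kernel of an operator is unique almost everywhere. -/
lemma HasKernel.ae_unique {A : L.Op} {a a' : X × X → ℂ} (h : L.HasKernel A a)
    (h' : L.HasKernel A a') : a =ᵐ[μ.prod μ] a' := by
  have hzero : ∀ f ∈ L.posCone, (A - A) f ∈ L.posCone := fun f _ => by
    rw [sub_self]
    exact zero_mem_posCone
  filter_upwards [(h.sub h').ae_nonneg hzero, (h'.sub h).ae_nonneg hzero] with p h1 h2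
  simp only [Complex.sub_re, Complex.sub_im] at h1 h2
  exact Complex.ext (by linarith [h1.1, h2.1]) (by linarith [h1.2])

lemma HasNonnegKernel.aemeasurable {A : L.Op} {a : X × X → ℝ≥0} (h : L.HasNonnegKernel A a) :
    AEMeasurable a (μ.prod μ) := by
  have := (Complex.measurable_re.comp_aemeasurable h.1).real_toNNReal
  simpa [Function.comp_def] using this

lemma hasNonnegKernel_iff {A : L.Op} {a : X × X → ℝ≥0} :
    L.HasNonnegKernel A a ↔ L.HasKernel A (fun p => ((a p : ℝ) : ℂ)) := Iff.rfl

lemma HasNonnegKernel.congr {A : L.Op} {a a' : X × X → ℝ≥0} (h : L.HasNonnegKernel A a)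
    (haa : a =ᵐ[μ.prod μ] a') : L.HasNonnegKernel A a' :=
  HasKernel.congr h (by filter_upwards [haa] with p hp; rw [hp])

lemma HasNonnegKernel.ae_unique {A : L.Op} {a a' : X × X → ℝ≥0} (h : L.HasNonnegKernel A a)
    (h' : L.HasNonnegKernel A a') : a =ᵐ[μ.prod μ] a' := by
  filter_upwards [HasKernel.ae_unique h h'] with p hp
  exact_mod_cast hp

lemma HasNonnegKernel.op_unique {A B : L.Op} {a : X × X → ℝ≥0} (hA : L.HasNonnegKernel A a)
    (hB : L.HasNonnegKernel B a) : A = B := by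
  ext f
  refine ext_ae ?_
  filter_upwards [hA.2 f, hB.2 f] with x h1 h2
  rw [h1.2, h2.2]

lemma HasNonnegKernel.exists_measurable {A : L.Op} {a : X × X → ℝ≥0}
    (h : L.HasNonnegKernel A a) :
    ∃ a' : X × X → ℝ≥0, Measurable a' ∧ a =ᵐ[μ.prod μ] a' ∧ L.HasNonnegKernel A a' :=
  ⟨_, h.aemeasurable.measurable_mk, h.aemeasurable.ae_eq_mk, h.congr h.aemeasurable.ae_eq_mk⟩

lemma IsPositiveKernelOperator.exists_hasNonnegKernel {A : L.Op}
    (h : L.IsPositiveKernelOperator A) : ∃ a : X × X → ℝ≥0, L.HasNonnegKernel A a := by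
  obtain ⟨hA, a, ha⟩ := h
  refine ⟨fun p => ‖a p‖₊, ha.congr ?_⟩
  filter_upwards [ha.ae_nonneg hA] with p hp
  have : a p = ((a p).re : ℂ) := Complex.ext (by simp) (by simp [hp.2])
  rw [this, coe_nnnorm, Complex.norm_real, Real.norm_of_nonneg hp.1]

end BanachFunctionSpace

/-! ### Nonnegative kernels: domination and composition -/

namespace BanachFunctionSpace

variable {X : Type*} [MeasurableSpace X] {μ : Measure X} [SigmaFinite μ]
  {L : BanachFunctionSpace μ}

lemma HasNonnegKernel.add {A B : L.Op} {a b : X × X → ℝ≥0} (hA : L.HasNonnegKernel A a)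
    (hB : L.HasNonnegKernel B b) : L.HasNonnegKernel (A + B) (fun p => a p + b p) := by
  have := HasKernel.add hA hB
  rw [hasNonnegKernel_iff]
  simpa using this

lemma HasNonnegKernel.smul {A : L.Op} {a : X × X → ℝ≥0} (hA : L.HasNonnegKernel A a)
    (c : ℝ≥0) : L.HasNonnegKernel (((c : ℝ) : ℂ) • A) (fun p => c * a p) := by
  have := HasKernel.smul hA ((c : ℝ) : ℂ)
  rw [hasNonnegKernel_iff]
  simpa using this

lemma HasNonnegKernel.sum {ι : Type*} (s : Finset ι) {A : ι → L.Op} {a : ι → X × X → ℝ≥0}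
    (hA : ∀ i ∈ s, L.HasNonnegKernel (A i) (a i)) :
    L.HasNonnegKernel (∑ i ∈ s, A i) (fun p => ∑ i ∈ s, a i p) := by
  classical
  induction s using Finset.induction_on with
  | empty =>
    have := hasKernel_zero (L := L)
    rw [hasNonnegKernel_iff]
    simpa using this
  | insert i s hi ih =>
    simp_rw [Finset.sum_insert hi]
    exact (hA i (by simp)).add (ih fun j hj => hA j (by simp [hj]))

/-- `(A |f|)(x)` is the Lebesgue integral of `a(x, ·) |f|`. -/
lemma HasNonnegKernel.lintegral_eq {A : L.Op} {a : X × X → ℝ≥0} (hA : L.HasNonnegKernel A a)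
    (f : L.Space) :
    ∀ᵐ x ∂μ, Integrable (fun y => ((a (x, y) : ℝ) : ℂ) * f y) μ ∧
      A (modulus f) x = ((∫⁻ y, a (x, y) * ‖f y‖ₑ ∂μ).toReal : ℂ) ∧
      ∫⁻ y, a (x, y) * ‖f y‖ₑ ∂μ < ⊤ := by
  filter_upwards [hA.2 f, hA.2 (modulus f)] with x h1 h2
  have hn : ∀ y, ‖((a (x, y) : ℝ) : ℂ) * f y‖ₑ = a (x, y) * ‖f y‖ₑ := fun y => by
    rw [enorm_mul]
    congr 1
    rw [← ofReal_norm, Complex.norm_real, NNReal.norm_eq, ENNReal.ofReal_coe_nnreal]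
  have hlt : ∫⁻ y, a (x, y) * ‖f y‖ₑ ∂μ < ⊤ := by
    have := h1.1.2
    rw [hasFiniteIntegral_iff_enorm] at this
    simpa only [hn] using this
  refine ⟨h1.1, ?_, hlt⟩
  rw [h2.2]
  have h3 : ∫ y, ((a (x, y) : ℝ) : ℂ) * modulus f y ∂μ =
      ∫ y, ((‖((a (x, y) : ℝ) : ℂ) * f y‖ : ℝ) : ℂ) ∂μ := by
    refine integral_congr_ae ?_
    filter_upwards [coeFn_modulus f] with y hy
    rw [hy, norm_mul, Complex.norm_real, NNReal.norm_eq]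
    push_cast
    rfl
  rw [h3, integral_complex_ofReal, integral_norm_eq_lintegral_enorm h1.1.1]
  simp_rw [hn]

/-- Kernel domination `b ≤ a` gives `|B f| ≤ A |f|`. -/
lemma HasNonnegKernel.norm_apply_le {A B : L.Op} {a b : X × X → ℝ≥0}
    (hA : L.HasNonnegKernel A a) (hB : L.HasNonnegKernel B b) (hba : b ≤ᵐ[μ.prod μ] a)
    (f : L.Space) : ∀ᵐ x ∂μ, ‖B f x‖ ≤ ‖A (modulus f) x‖ := by
  filter_upwards [hA.lintegral_eq f, hB.2 f, Measure.ae_ae_of_ae_prod hba] with x h1 h2 h3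
  rw [h2.2, h1.2.1, Complex.norm_real, Real.norm_of_nonneg ENNReal.toReal_nonneg]
  refine (norm_integral_le_lintegral_norm _).trans (ENNReal.toReal_mono h1.2.2.ne ?_)
  refine lintegral_mono_ae ?_
  filter_upwards [h3] with y hy
  rw [ofReal_norm, enorm_mul]
  gcongr
  rw [← ofReal_norm, Complex.norm_real, NNReal.norm_eq, ENNReal.ofReal_coe_nnreal]
  exact_mod_cast hy

lemma HasNonnegKernel.map_posCone {A : L.Op} {a : X × X → ℝ≥0} (hA : L.HasNonnegKernel A a)
    {f : L.Space} (hf : f ∈ L.posCone) : A f ∈ L.posCone := by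
  filter_upwards [hA.lintegral_eq f] with x hx
  rw [modulus_eq_self hf] at hx
  rw [hx.2.1]
  simp

lemma HasNonnegKernel.norm_le {A B : L.Op} {a b : X × X → ℝ≥0}
    (hA : L.HasNonnegKernel A a) (hB : L.HasNonnegKernel B b) (hba : b ≤ᵐ[μ.prod μ] a) :
    ‖B‖ ≤ ‖A‖ := by
  refine B.opNorm_le_bound (norm_nonneg _) fun f => ?_
  calc ‖B f‖ ≤ ‖A (modulus f)‖ := norm_le_norm (hA.norm_apply_le hB hba f)
    _ ≤ ‖A‖ * ‖f‖ := by rw [← norm_modulus f]; exact A.le_opNorm _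

/-- Every measurable kernel dominated by the kernel of an operator on `L` is the kernel of an
operator on `L`. -/
lemma HasNonnegKernel.exists_of_le {A : L.Op} {a b : X × X → ℝ≥0} (hA : L.HasNonnegKernel A a)
    (hb : AEMeasurable b (μ.prod μ)) (hba : b ≤ᵐ[μ.prod μ] a) :
    ∃ B : L.Op, L.HasNonnegKernel B b := by
  wlog hbm : Measurable b generalizing b
  · obtain ⟨B, hB⟩ := this hb.measurable_mk.aemeasurable
      (by filter_upwards [hba, hb.ae_eq_mk] with p h1 h2; rwa [← h2]) hb.measurable_mk
    exact ⟨B, hB.congr hb.ae_eq_mk.symm⟩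
  have hbc : Measurable (fun p : X × X => ((b p : ℝ) : ℂ)) :=
    Complex.measurable_ofReal.comp hbm.coe_nnreal_real
  have hint : ∀ f : L.Space, ∀ᵐ x ∂μ, Integrable (fun y => ((b (x, y) : ℝ) : ℂ) * f y) μ ∧
      ‖∫ y, ((b (x, y) : ℝ) : ℂ) * f y ∂μ‖ ≤ ‖A (modulus f) x‖ := by
    intro f
    filter_upwards [hA.lintegral_eq f, Measure.ae_ae_of_ae_prod hba] with x h1 h3
    have hle : ∀ᵐ y ∂μ, ‖((b (x, y) : ℝ) : ℂ) * f y‖ₑ ≤ a (x, y) * ‖f y‖ₑ := by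
      filter_upwards [h3] with y hy
      rw [enorm_mul]
      gcongr
      rw [← ofReal_norm, Complex.norm_real, NNReal.norm_eq, ENNReal.ofReal_coe_nnreal]
      exact_mod_cast hy
    refine ⟨⟨((hbc.comp measurable_prodMk_left).mul (coeFn_measurable f)).aestronglyMeasurable,
      ?_⟩, ?_⟩
    · rw [hasFiniteIntegral_iff_enorm]
      exact (lintegral_mono_ae hle).trans_lt h1.2.2
    · rw [h1.2.1, Complex.norm_real, Real.norm_of_nonneg ENNReal.toReal_nonneg]
      refine (norm_integral_le_lintegral_norm _).trans (ENNReal.toReal_mono h1.2.2.ne ?_)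
      refine lintegral_mono_ae ?_
      filter_upwards [hle] with y hy
      rwa [ofReal_norm]
  have hmeas : ∀ f : L.Space,
      AEStronglyMeasurable (fun x => ∫ y, ((b (x, y) : ℝ) : ℂ) * f y ∂μ) μ := fun f =>
    AEStronglyMeasurable.integral_prod_right' (f := fun p : X × X => ((b p : ℝ) : ℂ) * f p.2)
      (hbc.mul ((coeFn_measurable f).comp measurable_snd)).aestronglyMeasurable
  let T : L.Space → L.Space := fun f => ofLe (A (modulus f)) _ (hmeas f)
    (by filter_upwards [hint f] with x hx; exact hx.2)
  have hT : ∀ f, ∀ᵐ x ∂μ, T f x = ∫ y, ((b (x, y) : ℝ) : ℂ) * f y ∂μ := fun f =>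
    coeFn_ofLe _ _ _ _
  let B₀ : L.Space →ₗ[ℂ] L.Space :=
    { toFun := T
      map_add' := fun f g => ext_ae (by
        filter_upwards [hT (f + g), hT f, hT g, coeFn_add (T f) (T g), hint f, hint g]
          with x h1 h2 h3 h4 h5 h6
        rw [h4, h1, h2, h3, ← integral_add h5.1 h6.1]
        refine integral_congr_ae ?_
        filter_upwards [coeFn_add f g] with y hy
        rw [hy, mul_add])
      map_smul' := fun c f => ext_ae (by
        filter_upwards [hT (c • f), hT f, coeFn_smul c (T f)] with x h1 h2 h3
        rw [RingHom.id_apply, h3, h1, h2, ← integral_const_mul]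
        refine integral_congr_ae ?_
        filter_upwards [coeFn_smul c f] with y hy
        rw [hy]
        ring) }
  refine ⟨B₀.mkContinuous ‖A‖ fun f => ?_, hbc.aemeasurable, fun f => ?_⟩
  · calc ‖T f‖ ≤ ‖A (modulus f)‖ := norm_ofLe_le _ _ _ _
      _ ≤ ‖A‖ * ‖f‖ := by rw [← norm_modulus f]; exact A.le_opNorm _
  · filter_upwards [hint f, hT f] with x h1 h2
    exact ⟨h1.1, h2⟩

/-- The composition of operators with nonnegative kernels `a` and `b` has the kernel
`∫ a(x, z) b(z, y) dz`, which is finite almost everywhere. -/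
lemma HasNonnegKernel.mul {A B : L.Op} {a b : X × X → ℝ≥0} (hA : L.HasNonnegKernel A a)
    (hB : L.HasNonnegKernel B b) (ham : Measurable a) (hbm : Measurable b) :
    ∃ c : X × X → ℝ≥0, Measurable c ∧ L.HasNonnegKernel (A * B) c ∧
      ∀ᵐ p ∂(μ.prod μ), (c p : ℝ≥0∞) = ∫⁻ z, a (p.1, z) * b (z, p.2) ∂μ := by
  set k : X × X → ℝ≥0∞ := fun p => ∫⁻ z, a (p.1, z) * b (z, p.2) ∂μ with hk
  have hkm : Measurable k := by
    refine Measurable.lintegral_prod_right'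
      (f := fun q : (X × X) × X => (a (q.1.1, q.2) : ℝ≥0∞) * b (q.2, q.1.2)) ?_
    exact ((ham.comp (by fun_prop)).coe_nnreal_ennreal).mul
      ((hbm.comp (by fun_prop)).coe_nnreal_ennreal)
  have hacm : Measurable (fun p : X × X => ((a p : ℝ) : ℂ)) :=
    Complex.measurable_ofReal.comp ham.coe_nnreal_real
  have hbcm : Measurable (fun p : X × X => ((b p : ℝ) : ℂ)) :=
    Complex.measurable_ofReal.comp hbm.coe_nnreal_real
  have henorm : ∀ r : ℝ≥0, ‖((r : ℝ) : ℂ)‖ₑ = r := fun r => by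
    rw [← ofReal_norm, Complex.norm_real, NNReal.norm_eq, ENNReal.ofReal_coe_nnreal]
  -- integrability of the kernel of the double integral
  have hF : ∀ f : L.Space, ∀ᵐ x ∂μ, Integrable (fun q : X × X =>
      ((a (x, q.1) : ℝ) : ℂ) * (((b q : ℝ) : ℂ) * f q.2)) (μ.prod μ) := by
    intro f
    filter_upwards [hA.lintegral_eq (B (modulus f))] with x hx
    have hFm : Measurable (fun q : X × X =>
        ((a (x, q.1) : ℝ) : ℂ) * (((b q : ℝ) : ℂ) * f q.2)) :=
      (hacm.comp (by fun_prop)).mul (hbcm.mul ((coeFn_measurable f).comp measurable_snd))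
    refine ⟨hFm.aestronglyMeasurable, ?_⟩
    rw [hasFiniteIntegral_iff_enorm, lintegral_prod _ hFm.enorm.aemeasurable]
    refine lt_of_le_of_lt (lintegral_mono_ae ?_) hx.2.2
    filter_upwards [hB.lintegral_eq f] with z hz
    simp only [enorm_mul, henorm]
    rw [lintegral_const_mul' _ _ ENNReal.coe_ne_top, hz.2.1, ← ofReal_norm, Complex.norm_real,
      Real.norm_of_nonneg ENNReal.toReal_nonneg, ENNReal.ofReal_toReal hz.2.2.ne]
  have hinner : ∀ (f : L.Space) x y, ∫ z, ((a (x, z) : ℝ) : ℂ) * (((b (z, y) : ℝ) : ℂ) * f y) ∂μ =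
      (((k (x, y)).toNNReal : ℝ) : ℂ) * f y := by
    intro f x y
    simp_rw [← mul_assoc]
    rw [integral_mul_const]
    congr 1
    have h1 : ∀ z, ((a (x, z) : ℝ) : ℂ) * ((b (z, y) : ℝ) : ℂ) =
        (((a (x, z) : ℝ≥0∞) * b (z, y)).toReal : ℂ) := fun z => by
      simp [ENNReal.toReal_mul]
    simp_rw [h1]
    rw [integral_complex_ofReal, integral_toReal]
    · rfl
    · exact (((ham.comp measurable_prodMk_left).coe_nnreal_ennreal).mul
        ((hbm.comp measurable_prodMk_right).coe_nnreal_ennreal)).aemeasurable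
    · exact Eventually.of_forall fun z => by finiteness
  have hkfin : ∀ᵐ p ∂(μ.prod μ), k p < ⊤ := by
    rw [Measure.ae_prod_iff_ae_ae (measurableSet_lt hkm measurable_const)]
    obtain ⟨w, hw⟩ := exists_weakUnit L
    filter_upwards [hF w] with x hx
    have hx' := hx.swap
    have h2 : ∫⁻ y, k (x, y) * ‖w y‖ₑ ∂μ < ⊤ := by
      have h3 := hx'.2
      rw [hasFiniteIntegral_iff_enorm, lintegral_prod _ hx'.1.enorm] at h3
      refine lt_of_eq_of_lt (lintegral_congr fun y => ?_) h3
      simp only [Function.comp_apply, Prod.swap, enorm_mul, henorm, ← mul_assoc]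
      rw [lintegral_mul_const]
      exact ((ham.comp measurable_prodMk_left).coe_nnreal_ennreal).mul
        ((hbm.comp measurable_prodMk_right).coe_nnreal_ennreal)
    have h4 := ae_lt_top ((hkm.comp measurable_prodMk_left).mul (coeFn_measurable w).enorm) h2.ne
    filter_upwards [h4, hw] with y h5 h6
    by_contra h7
    rw [not_lt_top_iff] at h7
    simp only [Function.comp_apply, Pi.mul_apply, h7] at h5
    rw [ENNReal.top_mul] at h5
    · exact lt_irrefl _ h5
    · rw [enorm_ne_zero]
      intro h8
      rw [h8] at h6
      simp at h6
  refine ⟨fun p => (k p).toNNReal, hkm.ennreal_toNNReal, ⟨?_, fun f => ?_⟩, ?_⟩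
  · exact (Complex.measurable_ofReal.comp hkm.ennreal_toNNReal.coe_nnreal_real).aemeasurable
  · filter_upwards [hF f, hA.2 (B f)] with x h1 h2
    constructor
    · refine h1.integral_prod_right.congr (Eventually.of_forall fun y => ?_)
      exact hinner f x y
    · rw [mul_apply_eq_comp, h2.2]
      have h3 : ∫ z, ((a (x, z) : ℝ) : ℂ) * (B f) z ∂μ =
          ∫ z, ∫ y, ((a (x, z) : ℝ) : ℂ) * (((b (z, y) : ℝ) : ℂ) * f y) ∂μ ∂μ := by
        refine integral_congr_ae ?_
        filter_upwards [hB.2 f] with z hz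
        rw [hz.2, integral_const_mul]
      rw [h3, integral_integral_swap h1]
      simp_rw [hinner]
  · filter_upwards [hkfin] with p hp
    exact ENNReal.coe_toNNReal hp.ne

end BanachFunctionSpace

/-! ### Weighted geometric means of kernels -/

section Means

variable {X : Type*} [MeasurableSpace X]

/-- The generalized Hölder inequality with exponents `α` holds for `μ`. -/
def HolderInequality (μ : Measure X) {m : ℕ} (α : Fin m → ℝ) : Prop :=
  ∀ f : Fin m → X → ℝ≥0∞, (∀ j, Measurable (f j)) →
    ∫⁻ x, ∏ j, f j x ^ α j ∂μ ≤ ∏ j, (∫⁻ x, f j x ∂μ) ^ α j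

lemma holderInequality_of_sum_eq_one (μ : Measure X) {m : ℕ} {α : Fin m → ℝ} (hα : ∀ j, 0 ≤ α j)
    (hsum : ∑ j, α j = 1) : HolderInequality μ α := fun _ hf =>
  ENNReal.lintegral_prod_norm_pow_le Finset.univ (fun j _ => (hf j).aemeasurable) hsum
    fun j _ => hα j

/-- The weighted arithmetic-geometric mean inequality, rescaled so that the right-hand side equals
`∏ d_j ^ α_j` at `z = d`. -/
lemma prod_rpow_le_sum_scaled {m : ℕ} {α : Fin m → ℝ} (hα : ∀ j, 0 ≤ α j) (hsum : ∑ j, α j = 1)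
    {d : Fin m → ℝ≥0} (hd : ∀ j, 0 < d j) (z : Fin m → ℝ≥0) :
    ∏ j, z j ^ α j ≤ ∑ j, (α j).toNNReal * ((∏ i, d i ^ α i) / d j) * z j := by
  set Δ := ∏ i, d i ^ α i with hΔ
  have hΔ0 : 0 < Δ := Finset.prod_pos fun i _ => NNReal.rpow_pos (hd i)
  have h1 : ∏ j, (Δ / d j) ^ α j = 1 := by
    simp_rw [NNReal.div_rpow]
    have h0 : ∏ j, Δ ^ α j = Δ := by
      refine NNReal.eq ?_
      rw [NNReal.coe_prod]
      simp_rw [NNReal.coe_rpow]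
      rw [← Real.rpow_sum_of_pos (by exact_mod_cast hΔ0), hsum, Real.rpow_one]
    rw [Finset.prod_div_distrib, h0, ← hΔ, div_self hΔ0.ne']
  have h2 : ∏ j, z j ^ α j = ∏ j, ((Δ / d j) * z j) ^ α j := by
    simp_rw [NNReal.mul_rpow]
    rw [Finset.prod_mul_distrib, h1, one_mul]
  have hsum' : ∑ j, (α j).toNNReal = 1 := by
    rw [← Real.toNNReal_sum_of_nonneg fun j _ => hα j, hsum, Real.toNNReal_one]
  have h3 := NNReal.geom_mean_le_arith_mean_weighted Finset.univ (fun j => (α j).toNNReal)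
    (fun j => (Δ / d j) * z j) hsum'
  simp only [Real.coe_toNNReal _ (hα _)] at h3
  rw [h2]
  refine h3.trans_eq (Finset.sum_congr rfl fun j _ => by ring)

end Means

namespace BanachFunctionSpace

variable {X : Type*} [MeasurableSpace X] {μ : Measure X} [SigmaFinite μ]
  {L : BanachFunctionSpace μ} {m : ℕ} {α : Fin m → ℝ}

/-- `T` is dominated by the weighted geometric mean of the `A j`: its kernel is at most
`∏ a_j ^ α_j`, where the `a_j` are the kernels of the `A j`. Whether or not `∏ a_j ^ α_j` is the
kernel of an operator plays no role. For `m = 1` and `α = 1` this is the order of operators. -/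
def Dominated (L : BanachFunctionSpace μ) (α : Fin m → ℝ) (T : L.Op) (A : Fin m → L.Op) : Prop :=
  ∃ (t : X × X → ℝ≥0) (a : Fin m → X × X → ℝ≥0), L.HasNonnegKernel T t ∧
    (∀ j, L.HasNonnegKernel (A j) (a j)) ∧ ∀ᵐ p ∂(μ.prod μ), t p ≤ ∏ j, a j p ^ α j

/-- The order of operators with nonnegative kernels. -/
abbrev KernelLE (L : BanachFunctionSpace μ) (T B : L.Op) : Prop :=
  L.Dominated (fun _ : Fin 1 => 1) T (fun _ => B)

lemma IsHadamardMean.dominated {A : Fin m → L.Op} {B : L.Op} (h : L.IsHadamardMean α A B) :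
    L.Dominated α B A := by
  obtain ⟨a, ha, hB⟩ := h
  exact ⟨_, a, hB, ha, Eventually.of_forall fun p => le_rfl⟩

/-- Domination is compatible with products of operators, by the Hölder inequality for the kernels
`∫ a(x, z) b(z, y) dz` of the products. -/
lemma Dominated.mul (hα : ∀ j, 0 ≤ α j) (hH : HolderInequality μ α) {T₁ T₂ : L.Op}
    {A₁ A₂ : Fin m → L.Op} (h₁ : L.Dominated α T₁ A₁) (h₂ : L.Dominated α T₂ A₂) :
    L.Dominated α (T₁ * T₂) (fun j => A₁ j * A₂ j) := by
  obtain ⟨t₁', a₁', ht₁', ha₁', hle₁'⟩ := h₁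
  obtain ⟨t₂', a₂', ht₂', ha₂', hle₂'⟩ := h₂
  obtain ⟨t₁, ht₁m, ht₁e, ht₁⟩ := ht₁'.exists_measurable
  obtain ⟨t₂, ht₂m, ht₂e, ht₂⟩ := ht₂'.exists_measurable
  choose a₁ ha₁m ha₁e ha₁ using fun j => (ha₁' j).exists_measurable
  choose a₂ ha₂m ha₂e ha₂ using fun j => (ha₂' j).exists_measurable
  have hle₁ : ∀ᵐ p ∂(μ.prod μ), t₁ p ≤ ∏ j, a₁ j p ^ α j := by
    filter_upwards [hle₁', ht₁e, ae_all_iff.2 ha₁e] with p h1 h2 h3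
    simpa only [h2, h3] using h1
  have hle₂ : ∀ᵐ p ∂(μ.prod μ), t₂ p ≤ ∏ j, a₂ j p ^ α j := by
    filter_upwards [hle₂', ht₂e, ae_all_iff.2 ha₂e] with p h1 h2 h3
    simpa only [h2, h3] using h1
  obtain ⟨t, -, ht, hte⟩ := ht₁.mul ht₂ ht₁m ht₂m
  choose a ham ha hae using fun j => (ha₁ j).mul (ha₂ j) (ha₁m j) (ha₂m j)
  refine ⟨t, a, ht, ha, ?_⟩
  have hx : ∀ᵐ p ∂(μ.prod μ), ∀ᵐ z ∂μ, t₁ (p.1, z) ≤ ∏ j, a₁ j (p.1, z) ^ α j :=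
    Measure.quasiMeasurePreserving_fst.ae (Measure.ae_ae_of_ae_prod hle₁)
  have hy : ∀ᵐ p ∂(μ.prod μ), ∀ᵐ z ∂μ, t₂ (z, p.2) ≤ ∏ j, a₂ j (z, p.2) ^ α j :=
    Measure.quasiMeasurePreserving_snd.ae (Measure.ae_ae_of_ae_prod
      (Measure.measurePreserving_swap.quasiMeasurePreserving.ae hle₂))
  filter_upwards [hx, hy, hte, ae_all_iff.2 hae] with p h1 h2 h3 h4
  rw [← ENNReal.coe_le_coe, h3, ENNReal.ofNNReal_finsetProd]
  simp_rw [ENNReal.coe_rpow_of_nonneg _ (hα _), h4]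
  refine le_trans (lintegral_mono_ae ?_) (hH (fun j z => a₁ j (p.1, z) * a₂ j (z, p.2)) fun j =>
    (((ha₁m j).comp measurable_prodMk_left).coe_nnreal_ennreal).mul
        (((ha₂m j).comp measurable_prodMk_right).coe_nnreal_ennreal))
  filter_upwards [h1, h2] with z h5 h6
  calc (t₁ (p.1, z) : ℝ≥0∞) * t₂ (z, p.2)
      ≤ ((∏ j, a₁ j (p.1, z) ^ α j : ℝ≥0) : ℝ≥0∞) * ((∏ j, a₂ j (z, p.2) ^ α j : ℝ≥0) : ℝ≥0∞) :=
        mul_le_mul' (by exact_mod_cast h5) (by exact_mod_cast h6)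
    _ = _ := by
      rw [← ENNReal.coe_mul, ← Finset.prod_mul_distrib, ENNReal.ofNNReal_finsetProd]
      refine Finset.prod_congr rfl fun j _ => ?_
      rw [← NNReal.mul_rpow, ENNReal.coe_rpow_of_nonneg _ (hα j), ENNReal.coe_mul]

lemma Dominated.kernelLE {T B : L.Op} {A : Fin m → L.Op} {a : Fin m → X × X → ℝ≥0}
    (h : L.Dominated α T A) (ha : ∀ j, L.HasNonnegKernel (A j) (a j))
    (hB : L.HasNonnegKernel B (fun p => ∏ j, a j p ^ α j)) : L.KernelLE T B := by
  obtain ⟨t, a', ht, ha', hle⟩ := h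
  refine ⟨t, fun _ => _, ht, fun _ => hB, ?_⟩
  have := fun j => (ha j).ae_unique (ha' j)
  filter_upwards [hle, ae_all_iff.2 this] with p h1 h2
  simpa [h2] using h1

lemma kernelLE_iff {T B : L.Op} : L.KernelLE T B ↔ ∃ t b : X × X → ℝ≥0,
    L.HasNonnegKernel T t ∧ L.HasNonnegKernel B b ∧ t ≤ᵐ[μ.prod μ] b := by
  constructor
  · rintro ⟨t, b, ht, hb, hle⟩
    refine ⟨t, b 0, ht, hb 0, ?_⟩
    filter_upwards [hle] with p hp
    simpa using hp
  · rintro ⟨t, b, ht, hb, hle⟩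
    refine ⟨t, fun _ => b, ht, fun _ => hb, ?_⟩
    filter_upwards [hle] with p hp
    simpa using hp

/-- A finite monotone seminorm `φ` on the operators with nonnegative kernels is logarithmically
convex: if the kernel of `T` is at most `C ∏ a_j ^ α_j`, then `φ(T) ≤ C ∏ φ(A_j) ^ α_j`. The
kernel `∏ a_j ^ α_j` is estimated by a weighted sum of the `a_j`, with weights adapted to the
values `φ(A_j)`. -/
lemma le_mul_prod_rpow_of_monotone {φ : L.Op → ℝ≥0∞} (hfin : ∀ A, φ A ≠ ⊤)
    (hadd : ∀ A B, φ (A + B) ≤ φ A + φ B)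
    (hsmul : ∀ (c : ℝ≥0) (A : L.Op), φ (((c : ℝ) : ℂ) • A) ≤ c * φ A)
    (hmono : ∀ T B : L.Op, L.KernelLE T B → φ T ≤ φ B)
    (hα : ∀ j, 0 < α j) (hsum : ∑ j, α j = 1) {T : L.Op} {A : Fin m → L.Op}
    {t : X × X → ℝ≥0} {a : Fin m → X × X → ℝ≥0} (ht : L.HasNonnegKernel T t)
    (ha : ∀ j, L.HasNonnegKernel (A j) (a j)) (C : ℝ≥0)
    (hle : ∀ᵐ p ∂(μ.prod μ), t p ≤ C * ∏ j, a j p ^ α j) :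
    φ T ≤ C * ∏ j, φ (A j) ^ α j := by
  have hzero : φ 0 = 0 := by
    have := hsmul 0 0
    simpa using this
  have hsumφ : ∀ (s : Finset (Fin m)) (B : Fin m → L.Op), φ (∑ j ∈ s, B j) ≤ ∑ j ∈ s, φ (B j) :=
    fun s B => Finset.le_sum_of_subadditive φ hzero.le hadd s B
  have hε : ∀ ε : ℝ≥0, 0 < ε → φ T ≤ C * ∏ j, (φ (A j) + ε) ^ α j := by
    intro ε hε
    set d : Fin m → ℝ≥0 := fun j => (φ (A j)).toNNReal + ε with hd
    have hd0 : ∀ j, 0 < d j := fun j => by positivity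
    have hdφ : ∀ j, (d j : ℝ≥0∞) = φ (A j) + ε := fun j => by
      rw [hd, ENNReal.coe_add, ENNReal.coe_toNNReal (hfin _)]
    set Δ := ∏ i, d i ^ α i with hΔ
    let c : Fin m → ℝ≥0 := fun j => C * ((α j).toNNReal * (Δ / d j))
    have hS : L.HasNonnegKernel (∑ j, ((c j : ℝ) : ℂ) • A j) (fun p => ∑ j, c j * a j p) :=
      HasNonnegKernel.sum Finset.univ fun j _ => (ha j).smul (c j)
    have hTS : L.KernelLE T (∑ j, ((c j : ℝ) : ℂ) • A j) := by
      refine kernelLE_iff.2 ⟨t, _, ht, hS, ?_⟩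
      filter_upwards [hle] with p hp
      refine hp.trans ?_
      have := prod_rpow_le_sum_scaled (fun j => (hα j).le) hsum hd0 (fun j => a j p)
      calc C * ∏ j, a j p ^ α j ≤ C * ∑ j, (α j).toNNReal * (Δ / d j) * a j p := by gcongr
        _ = ∑ j, c j * a j p := by
          rw [Finset.mul_sum]
          exact Finset.sum_congr rfl fun j _ => by simp only [c]; ring
    have hsum' : ∑ j, (α j).toNNReal = 1 := by
      rw [← Real.toNNReal_sum_of_nonneg fun j _ => (hα j).le, hsum, Real.toNNReal_one]
    calc φ T ≤ φ (∑ j, ((c j : ℝ) : ℂ) • A j) := hmono _ _ hTS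
      _ ≤ ∑ j, φ (((c j : ℝ) : ℂ) • A j) := hsumφ _ _
      _ ≤ ∑ j, (c j : ℝ≥0∞) * d j := Finset.sum_le_sum fun j _ => by
          refine (hsmul _ _).trans ?_
          rw [hdφ]
          gcongr
          exact le_self_add
      _ = ((∑ j, c j * d j : ℝ≥0) : ℝ≥0∞) := by push_cast; rfl
      _ = ((C * Δ : ℝ≥0) : ℝ≥0∞) := by
          congr 1
          calc ∑ j, c j * d j = ∑ j, (C * Δ) * (α j).toNNReal := by
                refine Finset.sum_congr rfl fun j _ => ?_
                simp only [c]
                rw [mul_assoc, mul_assoc, div_mul_cancel₀ _ (hd0 j).ne']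
                ring
            _ = C * Δ := by rw [← Finset.mul_sum, hsum', mul_one]
      _ = _ := by
          rw [ENNReal.coe_mul, hΔ, ENNReal.ofNNReal_finsetProd]
          congr 1
          refine Finset.prod_congr rfl fun j _ => ?_
          rw [ENNReal.coe_rpow_of_nonneg _ (hα j).le, hdφ]
  have hlim : Tendsto (fun ε : ℝ≥0 => (C : ℝ≥0∞) * ∏ j, (φ (A j) + ε) ^ α j) (𝓝[>] 0)
      (𝓝 (C * ∏ j, (φ (A j) + (0 : ℝ≥0)) ^ α j)) := by
    refine ENNReal.Tendsto.const_mul ?_ (Or.inr ENNReal.coe_ne_top)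
    refine ENNReal.tendsto_finsetProd_of_ne_top _ (fun j _ => ?_) (fun j _ => ?_)
    · refine (ENNReal.continuous_rpow_const.tendsto _).comp ?_
      exact ((tendsto_const_nhds.add (ENNReal.tendsto_coe.2 tendsto_id))).mono_left
        nhdsWithin_le_nhds
    · exact ENNReal.rpow_ne_top_of_nonneg (hα j).le (by simpa using hfin (A j))
  simp only [ENNReal.coe_zero, add_zero] at hlim
  refine ge_of_tendsto hlim ?_
  filter_upwards [self_mem_nhdsWithin] with ε hε0
  exact hε ε hε0

lemma Dominated.le_prod_rpow_of_monotone {φ : L.Op → ℝ≥0∞} (hfin : ∀ A, φ A ≠ ⊤)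
    (hadd : ∀ A B, φ (A + B) ≤ φ A + φ B)
    (hsmul : ∀ (c : ℝ≥0) (A : L.Op), φ (((c : ℝ) : ℂ) • A) ≤ c * φ A)
    (hmono : ∀ T B : L.Op, L.KernelLE T B → φ T ≤ φ B)
    (hα : ∀ j, 0 < α j) (hsum : ∑ j, α j = 1) {T : L.Op} {A : Fin m → L.Op}
    (h : L.Dominated α T A) : φ T ≤ ∏ j, φ (A j) ^ α j := by
  obtain ⟨t, a, ht, ha, hle⟩ := h
  simpa using le_mul_prod_rpow_of_monotone hfin hadd hsmul hmono hα hsum ht ha 1 (by simpa using hle)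

lemma KernelLE.enorm_le {T B : L.Op} (h : L.KernelLE T B) : ‖T‖ₑ ≤ ‖B‖ₑ := by
  obtain ⟨t, b, ht, hb, hle⟩ := kernelLE_iff.1 h
  rw [← ofReal_norm, ← ofReal_norm]
  exact ENNReal.ofReal_le_ofReal (hb.norm_le ht hle)

lemma enorm_op_add_le (A B : L.Op) : ‖A + B‖ₑ ≤ ‖A‖ₑ + ‖B‖ₑ := by
  rw [← ofReal_norm, ← ofReal_norm, ← ofReal_norm,
    ← ENNReal.ofReal_add (norm_nonneg _) (norm_nonneg _)]
  exact ENNReal.ofReal_le_ofReal (norm_add_le _ _)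

lemma enorm_smul_le_coe (c : ℝ≥0) (A : L.Op) : ‖((c : ℝ) : ℂ) • A‖ₑ ≤ c * ‖A‖ₑ := by
  rw [enorm_smul]
  refine mul_le_mul_left (le_of_eq ?_) _
  rw [← ofReal_norm, Complex.norm_real, NNReal.norm_eq, ENNReal.ofReal_coe_nnreal]

/-- The case `φ = ‖·‖` of logarithmic convexity. -/
lemma enorm_le_mul_prod_rpow (hα : ∀ j, 0 < α j) (hsum : ∑ j, α j = 1) {T : L.Op}
    {A : Fin m → L.Op} {t : X × X → ℝ≥0} {a : Fin m → X × X → ℝ≥0} (ht : L.HasNonnegKernel T t)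
    (ha : ∀ j, L.HasNonnegKernel (A j) (a j)) (C : ℝ≥0)
    (hle : ∀ᵐ p ∂(μ.prod μ), t p ≤ C * ∏ j, a j p ^ α j) :
    ‖T‖ₑ ≤ C * ∏ j, ‖A j‖ₑ ^ α j :=
  le_mul_prod_rpow_of_monotone (φ := fun A : L.Op => ‖A‖ₑ) (fun _ => enorm_ne_top)
    enorm_op_add_le enorm_smul_le_coe (fun _ _ h => h.enorm_le) hα hsum ht ha C hle

/-- Kernels `C ∏ a_j ^ α_j` with `∑ α_j = 1` define operators, being dominated by weighted sums of
the `a_j`. -/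
lemma exists_hasNonnegKernel_of_le_mul_prod (hα : ∀ j, 0 < α j) (hsum : ∑ j, α j = 1)
    {A : Fin m → L.Op} {a : Fin m → X × X → ℝ≥0} (ha : ∀ j, L.HasNonnegKernel (A j) (a j))
    {b : X × X → ℝ≥0} (hb : AEMeasurable b (μ.prod μ)) (C : ℝ≥0)
    (hle : ∀ᵐ p ∂(μ.prod μ), b p ≤ C * ∏ j, a j p ^ α j) :
    ∃ B : L.Op, L.HasNonnegKernel B b := by
  have hS : L.HasNonnegKernel (∑ j, (((C * (α j).toNNReal : ℝ≥0) : ℝ) : ℂ) • A j)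
      (fun p => ∑ j, (C * (α j).toNNReal) * a j p) :=
    HasNonnegKernel.sum Finset.univ fun j _ => (ha j).smul _
  refine hS.exists_of_le hb ?_
  filter_upwards [hle] with p hp
  refine hp.trans ?_
  have := prod_rpow_le_sum_scaled (fun j => (hα j).le) hsum (d := fun _ => 1)
    (fun _ => one_pos) (fun j => a j p)
  simp only [NNReal.one_rpow, Finset.prod_const_one, div_one, mul_one] at this
  calc C * ∏ j, a j p ^ α j ≤ C * ∑ j, (α j).toNNReal * a j p := by gcongr
    _ = _ := by rw [Finset.mul_sum]; exact Finset.sum_congr rfl fun j _ => by ring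

lemma aemeasurable_prod_rpow {A : Fin m → L.Op} {a : Fin m → X × X → ℝ≥0}
    (ha : ∀ j, L.HasNonnegKernel (A j) (a j)) :
    AEMeasurable (fun p => ∏ j, a j p ^ α j) (μ.prod μ) :=
  Finset.aemeasurable_fun_prod _ fun j _ => (ha j).aemeasurable.pow_const _

/-- The weighted geometric means of operators with nonnegative kernels exist in `L`. -/
def HasHadamardMeans (L : BanachFunctionSpace μ) (α : Fin m → ℝ) : Prop :=
  ∀ (A : Fin m → L.Op) (a : Fin m → X × X → ℝ≥0), (∀ j, L.HasNonnegKernel (A j) (a j)) →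
    ∃ B : L.Op, L.HasNonnegKernel B (fun p => ∏ j, a j p ^ α j)

lemma hasHadamardMeans_of_sum_eq_one (hα : ∀ j, 0 < α j) (hsum : ∑ j, α j = 1) :
    L.HasHadamardMeans α := fun _ a ha =>
  exists_hasNonnegKernel_of_le_mul_prod hα hsum ha (aemeasurable_prod_rpow ha) 1
    (Eventually.of_forall fun p => by simp)

/-- The geometric mean does not depend on the choice of the kernels. -/
lemma HasHadamardMeans.existsUnique (h : L.HasHadamardMeans α) {A : Fin m → L.Op}
    (hA : ∀ j, ∃ a : X × X → ℝ≥0, L.HasNonnegKernel (A j) a) : ∃! B : L.Op, L.IsHadamardMean α A B := by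
  choose a ha using hA
  obtain ⟨B, hB⟩ := h A a ha
  refine ⟨B, ⟨a, ha, hB⟩, ?_⟩
  rintro B' ⟨a', ha', hB'⟩
  refine hB'.op_unique (hB.congr ?_)
  have := fun j => (ha j).ae_unique (ha' j)
  filter_upwards [ae_all_iff.2 this] with p hp
  simp only [hp]

end BanachFunctionSpace

/-! ### Strictly positive functionals on spaces with order continuous norm -/

namespace BanachFunctionSpace

variable {X : Type*} [MeasurableSpace X] {μ : Measure X} {L : BanachFunctionSpace μ}

/-- The positive part of the real part of `f ∈ L`. -/
noncomputable def rePos (f : L.Space) : L.Space :=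
  ofLe f (fun x => ((max (f x).re 0 : ℝ) : ℂ))
    (Complex.measurable_ofReal.comp ((Complex.measurable_re.comp (coeFn_measurable f)).max
      measurable_const)).aestronglyMeasurable
    (Eventually.of_forall fun x => by
      rw [Complex.norm_real, Real.norm_of_nonneg (le_max_right _ _)]
      exact max_le (Complex.re_le_norm _) (norm_nonneg _))

lemma coeFn_rePos (f : L.Space) : ∀ᵐ x ∂μ, rePos f x = ((max (f x).re 0 : ℝ) : ℂ) :=
  coeFn_ofLe _ _ _ _

lemma norm_rePos_le (f : L.Space) : ‖rePos f‖ ≤ ‖f‖ := norm_ofLe_le _ _ _ _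

/-- Hahn-Banach for the sublinear functional `f ↦ ‖(Re f)⁺‖`: a nonzero element of `L₊` is
detected by a positive functional. -/
lemma exists_positive_functional {g : L.Space} (hg : g ∈ L.posCone) (hg0 : g ≠ 0) :
    ∃ F : L.Space →ₗ[ℝ] ℝ, (∀ f ∈ L.posCone, 0 ≤ F f) ∧ (∀ f, F f ≤ ‖f‖) ∧ 0 < F g := by
  have hsmul : ∀ c : ℝ, 0 < c → ∀ f : L.Space, ‖rePos (c • f)‖ = c * ‖rePos f‖ := by
    intro c hc f
    have : rePos (c • f) = (c : ℂ) • rePos f := by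
      refine ext_ae ?_
      filter_upwards [coeFn_rePos (c • f), coeFn_rePos f, coeFn_smul (c : ℂ) f,
        coeFn_smul (c : ℂ) (rePos f)] with x h1 h2 h3 h4
      have h5 : (c • f : L.Space) x = (c : ℂ) * f x := h3
      rw [h1, h4, h2, h5, Complex.re_ofReal_mul, ← Complex.ofReal_mul,
        mul_max_of_nonneg _ _ hc.le, mul_zero]
    rw [this, norm_smul, Complex.norm_real, Real.norm_of_nonneg hc.le]
  have hadd : ∀ f f' : L.Space, ‖rePos (f + f')‖ ≤ ‖rePos f‖ + ‖rePos f'‖ := by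
    intro f f'
    refine le_trans (norm_le_norm ?_) (norm_add_le _ _)
    filter_upwards [coeFn_rePos (f + f'), coeFn_rePos f, coeFn_rePos f', coeFn_add f f',
      coeFn_add (rePos f) (rePos f')] with x h1 h2 h3 h4 h5
    rw [h1, h5, h2, h3, h4, ← Complex.ofReal_add, Complex.norm_real, Complex.norm_real,
      Real.norm_of_nonneg (le_max_right _ _),
      Real.norm_of_nonneg (add_nonneg (le_max_right _ _) (le_max_right _ _)), Complex.add_re]
    exact max_le (add_le_add (le_max_left _ _) (le_max_left _ _))
      (add_nonneg (le_max_right _ _) (le_max_right _ _))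
  have hgp : rePos g = g := ext_ae (by
    filter_upwards [coeFn_rePos g, hg] with x h1 h2
    rw [h1, max_eq_left h2.1]
    exact Complex.ext (by simp) (by simp [h2.2]))
  obtain ⟨F, hF1, hF2⟩ := exists_extension_of_le_sublinear
    (LinearPMap.mkSpanSingleton (K := ℝ) g ‖g‖ hg0) (fun f => ‖rePos f‖) hsmul hadd (by
      rintro ⟨f, hf⟩
      obtain ⟨c, rfl⟩ := Submodule.mem_span_singleton.1 hf
      rw [LinearPMap.mkSpanSingleton'_apply, RingHom.id_apply, smul_eq_mul]
      rcases le_or_gt c 0 with hc | hc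
      · exact (mul_nonpos_of_nonpos_of_nonneg hc (norm_nonneg _)).trans (norm_nonneg _)
      · show c * ‖g‖ ≤ ‖rePos (c • g)‖
        rw [hsmul c hc, hgp])
  refine ⟨F, fun f hf => ?_, fun f => (hF2 f).trans (norm_rePos_le f), ?_⟩
  · have h0 : rePos (-f) = 0 := ext_ae (by
      filter_upwards [coeFn_rePos (-f), hf, coeFn_neg f, coeFn_zero (L := L)] with x h1 h2 h3 h4
      rw [h1, h3, h4, max_eq_right (by simpa using h2.1), Complex.ofReal_zero])
    have := hF2 (-f)
    rw [h0, norm_zero, map_neg] at this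
    linarith
  · have := hF1 ⟨g, Submodule.mem_span_singleton_self g⟩
    rw [LinearPMap.mkSpanSingleton_apply ℝ ℝ hg0 ‖g‖] at this
    rw [show F g = ‖g‖ from this]
    exact norm_pos_iff.2 hg0

/-- The restriction of `f ∈ L` to a measurable set. -/
noncomputable def restr (f : L.Space) {S : Set X} (hS : MeasurableSet S) : L.Space :=
  ofLe f (S.indicator f) ((coeFn_measurable f).indicator hS).aestronglyMeasurable
    (Eventually.of_forall fun _ => norm_indicator_le_norm_self _ _)

lemma coeFn_restr (f : L.Space) {S : Set X} (hS : MeasurableSet S) :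
    ∀ᵐ x ∂μ, restr f hS x = S.indicator f x := coeFn_ofLe _ _ _ _

lemma restr_mem_posCone {f : L.Space} (hf : f ∈ L.posCone) {S : Set X} (hS : MeasurableSet S) :
    restr f hS ∈ L.posCone := by
  show ∀ᵐ x ∂μ, 0 ≤ (restr f hS x).re ∧ (restr f hS x).im = 0
  filter_upwards [coeFn_restr f hS, hf] with x h1 h2
  rw [h1]
  by_cases hx : x ∈ S
  · rwa [Set.indicator_of_mem hx]
  · simp [Set.indicator_of_notMem hx]

lemma coeFn_sum {ι : Type*} (s : Finset ι) (f : ι → L.Space) :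
    ∀ᵐ x ∂μ, (∑ i ∈ s, f i : L.Space) x = ∑ i ∈ s, f i x := by
  classical
  induction s using Finset.induction_on with
  | empty => simpa using coeFn_zero (L := L)
  | insert i s hi ih =>
    rw [Finset.sum_insert hi]
    filter_upwards [ih, coeFn_add (f i) (∑ i ∈ s, f i)] with x h1 h2
    rw [h2, h1, Finset.sum_insert hi]

/-- If the norm is order continuous, a positive functional `F` induces the measure
`S ↦ F(w χ_S)`. -/
lemma exists_measure_of_functional (hoc : HasOrderContinuousNorm L.posCone)
    {F : L.Space →ₗ[ℝ] ℝ} (hF0 : ∀ f ∈ L.posCone, 0 ≤ F f) (hF : ∀ f, F f ≤ ‖f‖)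
    {w : L.Space} (hw : w ∈ L.posCone) :
    ∃ ν : Measure X, ∀ S (hS : MeasurableSet S), ν S = ENNReal.ofReal (F (restr w hS)) := by
  have hFabs : ∀ f, |F f| ≤ ‖f‖ := fun f => abs_le.2 ⟨by
    have := hF (-f)
    rw [map_neg, norm_neg] at this
    linarith, hF f⟩
  refine ⟨Measure.ofMeasurable (fun S hS => ENNReal.ofReal (F (restr w hS))) ?_ ?_,
    fun S hS => Measure.ofMeasurable_apply _ hS⟩
  · have : restr w MeasurableSet.empty = 0 := ext_ae (by
      filter_upwards [coeFn_restr w MeasurableSet.empty, coeFn_zero (L := L)] with x h1 h2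
      rw [h1, h2, Set.indicator_empty])
    simp [this]
  · intro s hs hd
    have hU : ∀ N, MeasurableSet (⋃ i ≥ N, s i) := fun N =>
      MeasurableSet.iUnion fun i => MeasurableSet.iUnion fun _ => hs i
    -- the tails of the union
    let r : ℕ → L.Space := fun N => restr w (hU N)
    have hr : Tendsto (fun N => ‖r N‖) atTop (𝓝 0) := by
      refine tendsto_norm_of_antitone hoc (fun N => restr_mem_posCone hw _) (fun N => ?_) ?_
      · show ∀ᵐ x ∂μ, 0 ≤ ((r N - r (N + 1) : L.Space) x).re ∧
          ((r N - r (N + 1) : L.Space) x).im = 0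
        filter_upwards [coeFn_sub (r N) (r (N + 1)), coeFn_restr w (hU N),
          coeFn_restr w (hU (N + 1)), hw] with x h1 h2 h3 h4
        rw [h1, h2, h3]
        have hsub : (⋃ i ≥ N + 1, s i) ⊆ ⋃ i ≥ N, s i :=
          Set.biUnion_subset_biUnion_left fun i hi => (Nat.le_succ N).trans hi
        by_cases hx : x ∈ ⋃ i ≥ N + 1, s i
        · rw [Set.indicator_of_mem hx, Set.indicator_of_mem (hsub hx)]
          simp
        · rw [Set.indicator_of_notMem hx, sub_zero]
          by_cases hx' : x ∈ ⋃ i ≥ N, s i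
          · rwa [Set.indicator_of_mem hx']
          · simp [Set.indicator_of_notMem hx']
      · filter_upwards [ae_all_iff.2 fun N => coeFn_restr w (hU N)] with x hx
        refine tendsto_const_nhds.congr' ?_
        -- a point lies in at most one of the sets
        by_cases h : ∃ i, x ∈ s i
        · obtain ⟨i, hi⟩ := h
          filter_upwards [eventually_gt_atTop i] with N hN
          show (0 : ℂ) = restr w (hU N) x
          rw [hx N, Set.indicator_of_notMem]
          simp only [Set.mem_iUnion, not_exists]
          intro j hj hxj
          exact Set.disjoint_left.1 (hd (by omega : i ≠ j)) hi hxj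
        · refine Eventually.of_forall fun N => ?_
          show (0 : ℂ) = restr w (hU N) x
          rw [hx N, Set.indicator_of_notMem]
          simp only [Set.mem_iUnion, not_exists]
          exact fun j _ hxj => h ⟨j, hxj⟩
    have hsum : ∀ N, F (restr w (MeasurableSet.iUnion hs)) -
        ∑ i ∈ Finset.range N, F (restr w (hs i)) = F (r N) := by
      intro N
      rw [← map_sum, ← map_sub]
      congr 1
      refine ext_ae ?_
      filter_upwards [coeFn_sub (restr w (MeasurableSet.iUnion hs))
        (∑ i ∈ Finset.range N, restr w (hs i)), coeFn_restr w (MeasurableSet.iUnion hs),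
        coeFn_sum (Finset.range N) (fun i => restr w (hs i)),
        ae_all_iff.2 fun i => coeFn_restr w (hs i), coeFn_restr w (hU N)] with x h1 h2 h3 h4 h5
      rw [h1, h2, h3, h5]
      simp_rw [h4]
      by_cases h : ∃ i, x ∈ s i
      · obtain ⟨i, hi⟩ := h
        have hne : ∀ j, j ≠ i → x ∉ s j := fun j hj hxj =>
          Set.disjoint_left.1 (hd hj) hxj hi
        rw [Set.indicator_of_mem (Set.mem_iUnion.2 ⟨i, hi⟩)]
        by_cases hiN : i < N
        · rw [Finset.sum_eq_single i (fun j _ hj => Set.indicator_of_notMem (hne j hj) _)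
            (fun h => absurd (Finset.mem_range.2 hiN) h), Set.indicator_of_mem hi, sub_self,
            Set.indicator_of_notMem]
          simp only [Set.mem_iUnion, not_exists]
          exact fun j hj => hne j (by omega)
        · rw [Finset.sum_eq_zero fun j hj => Set.indicator_of_notMem
            (hne j (by have := Finset.mem_range.1 hj; omega)) _, sub_zero, Set.indicator_of_mem]
          simp only [Set.mem_iUnion]
          exact ⟨i, by omega, hi⟩
      · push Not at h
        rw [Set.indicator_of_notMem (by simpa using h), Finset.sum_eq_zero fun j _ =>
          Set.indicator_of_notMem (h j) _, sub_zero, Set.indicator_of_notMem]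
        simp only [Set.mem_iUnion, not_exists]
        exact fun j _ => h j
    have hpos : ∀ i, 0 ≤ F (restr w (hs i)) := fun i => hF0 _ (restr_mem_posCone hw _)
    have hhs : HasSum (fun i => F (restr w (hs i))) (F (restr w (MeasurableSet.iUnion hs))) := by
      rw [hasSum_iff_tendsto_nat_of_nonneg hpos]
      have h1 : Tendsto (fun N => F (r N)) atTop (𝓝 0) :=
        squeeze_zero_norm (fun N => hFabs (r N)) hr
      have h2 := (tendsto_const_nhds (x := F (restr w (MeasurableSet.iUnion hs)))).sub h1
      rw [sub_zero] at h2
      refine h2.congr fun N => ?_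
      rw [← hsum N]
      ring
    show ENNReal.ofReal _ = ∑' i, ENNReal.ofReal _
    rw [← ENNReal.ofReal_tsum_of_nonneg hpos hhs.summable, hhs.tsum_eq]

/-- The density of the measure `S ↦ F(w χ_S)`, divided by `w`, represents a function in the
associate space of `L`. It does not vanish identically on a set `Y` with `F(w χ_Y) > 0`. -/
lemma exists_density [SigmaFinite μ] (hoc : HasOrderContinuousNorm L.posCone)
    {w : L.Space} (hw : ∀ᵐ x ∂μ, 0 < (w x).re ∧ (w x).im = 0)
    {Y : Set X} (hY : MeasurableSet Y) (hμY : μ Y ≠ 0) :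
    ∃ φ : X → ℝ≥0∞, Measurable φ ∧ (∀ f : L.Space, ∫⁻ x, φ x * ‖f x‖ₑ ∂μ ≤ ‖f‖ₑ) ∧
      μ ({x | φ x ≠ 0} ∩ Y) ≠ 0 := by
  have hwpos : w ∈ L.posCone := by
    filter_upwards [hw] with x hx
    exact ⟨hx.1.le, hx.2⟩
  have hw0 : ∀ᵐ x ∂μ, ‖w x‖ₑ ≠ 0 := by
    filter_upwards [hw] with x hx
    rw [enorm_ne_zero]
    intro h
    rw [h] at hx
    simp at hx
  have hY0 : restr w hY ≠ 0 := by
    intro h0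
    refine hμY (measure_eq_zero_iff_ae_notMem.2 ?_)
    filter_upwards [coeFn_restr w hY, hw0, coeFn_zero (L := L)] with x h1 h2 h3 hx
    rw [h0, h3, Set.indicator_of_mem hx] at h1
    exact h2 (by rw [← h1, enorm_zero])
  obtain ⟨F, hF0, hF, hFY⟩ := exists_positive_functional (restr_mem_posCone hwpos hY) hY0
  obtain ⟨ν, hν⟩ := exists_measure_of_functional hoc hF0 hF hwpos
  have hνfin : IsFiniteMeasure ν := ⟨by
    rw [hν _ MeasurableSet.univ]
    exact ENNReal.ofReal_lt_top⟩
  have hac : ν ≪ μ := by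
    refine Measure.AbsolutelyContinuous.mk fun S hS h0 => ?_
    have : restr w hS = 0 := ext_ae (by
      filter_upwards [coeFn_restr w hS, coeFn_zero (L := L),
        measure_eq_zero_iff_ae_notMem.1 h0] with x h1 h2 h3
      rw [h1, h2, Set.indicator_of_notMem h3])
    rw [hν S hS, this, map_zero, ENNReal.ofReal_zero]
  set ψ := ν.rnDeriv μ with hψ
  have hψm : Measurable ψ := Measure.measurable_rnDeriv _ _
  have hνψ : μ.withDensity ψ = ν := Measure.withDensity_rnDeriv_eq _ _ hac
  have hwm : Measurable (fun x => ‖w x‖ₑ) := (coeFn_measurable w).enorm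
  refine ⟨fun x => ψ x * ‖w x‖ₑ⁻¹, hψm.mul hwm.inv, fun f => ?_, ?_⟩
  · have hfm : Measurable (fun x => ‖w x‖ₑ⁻¹ * ‖f x‖ₑ) :=
      hwm.inv.mul (coeFn_measurable f).enorm
    calc ∫⁻ x, ψ x * ‖w x‖ₑ⁻¹ * ‖f x‖ₑ ∂μ = ∫⁻ x, (ψ * fun x => ‖w x‖ₑ⁻¹ * ‖f x‖ₑ) x ∂μ := by
          refine lintegral_congr fun x => ?_
          rw [Pi.mul_apply, mul_assoc]
      _ = ∫⁻ x, ‖w x‖ₑ⁻¹ * ‖f x‖ₑ ∂ν := by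
          rw [← lintegral_withDensity_eq_lintegral_mul _ hψm hfm, hνψ]
      _ ≤ ‖f‖ₑ := by
          rw [lintegral_eq_nnreal]
          refine iSup₂_le fun s hs => ?_
          rw [SimpleFunc.map_lintegral]
          have hsm : ∀ c : ℝ≥0, MeasurableSet (s ⁻¹' {c}) := fun c => s.measurableSet_fiber c
          let g : L.Space := ∑ c ∈ s.range, (c : ℝ) • restr w (hsm c)
          have h1 : ∑ c ∈ s.range, (c : ℝ≥0∞) * ν (s ⁻¹' {c}) = ENNReal.ofReal (F g) := by
            rw [map_sum, ENNReal.ofReal_sum_of_nonneg]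
            · refine Finset.sum_congr rfl fun c _ => ?_
              rw [hν _ (hsm c), map_smul, smul_eq_mul, ENNReal.ofReal_mul c.coe_nonneg,
                ENNReal.ofReal_coe_nnreal]
            · intro c _
              rw [map_smul, smul_eq_mul]
              exact mul_nonneg c.coe_nonneg (hF0 _ (restr_mem_posCone hwpos _))
          rw [h1, ← ofReal_norm]
          refine ENNReal.ofReal_le_ofReal ((hF g).trans (norm_le_norm ?_))
          filter_upwards [coeFn_sum s.range (fun c : ℝ≥0 => (c : ℝ) • restr w (hsm c)),
            (Finset.eventually_all s.range).2 fun c _ =>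
              (coeFn_smul (c : ℂ) (restr w (hsm c))).and (coeFn_restr w (hsm c)),
            hw0] with x h2 h3 h4
          have h5 : g x = (s x : ℂ) * w x := by
            rw [h2, Finset.sum_eq_single (s x)]
            · have h6 := h3 (s x) (s.mem_range_self x)
              exact h6.1.trans (by rw [h6.2, Set.indicator_of_mem (show x ∈ s ⁻¹' {s x} from rfl)])
            · intro c hc hne
              have h6 := h3 c hc
              exact h6.1.trans (by rw [h6.2, Set.indicator_of_notMem (fun h => hne h.symm),
                mul_zero])
            · exact fun h => absurd (s.mem_range_self x) h
          have h6 : (s x : ℝ≥0∞) * ‖w x‖ₑ ≤ ‖f x‖ₑ := by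
            calc (s x : ℝ≥0∞) * ‖w x‖ₑ ≤ ‖w x‖ₑ⁻¹ * ‖f x‖ₑ * ‖w x‖ₑ := by gcongr; exact hs x
              _ = ‖f x‖ₑ := by
                rw [mul_right_comm, ENNReal.inv_mul_cancel h4 enorm_ne_top, one_mul]
          rw [h5, norm_mul]
          have h7 : ‖((s x : ℝ) : ℂ)‖ = s x := by
            rw [Complex.norm_real, Real.norm_of_nonneg (s x).coe_nonneg]
          rw [h7]
          have h8 : s x * ‖w x‖₊ ≤ ‖f x‖₊ := by
            rw [enorm_eq_nnnorm, enorm_eq_nnnorm] at h6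
            exact_mod_cast h6
          exact_mod_cast h8
  · intro h0
    have hae : ∀ᵐ x ∂μ, x ∈ Y → ψ x = 0 := by
      filter_upwards [measure_eq_zero_iff_ae_notMem.1 h0] with x h1 h2
      by_contra h3
      exact h1 ⟨mul_ne_zero h3 (ENNReal.inv_ne_zero.2 enorm_ne_top), h2⟩
    have hνY : ν Y = 0 := by
      rw [← hνψ, withDensity_apply _ hY, setLIntegral_congr_fun_ae hY hae, lintegral_zero]
    rw [hν Y hY, ENNReal.ofReal_eq_zero] at hνY
    exact absurd hFY (not_lt.2 hνY)

end BanachFunctionSpace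

namespace BanachFunctionSpace

variable {X : Type*} [MeasurableSpace X] {μ : Measure X} {L : BanachFunctionSpace μ}

/-- If the norm of `L` is order continuous, then the associate space of `L` contains an almost
everywhere strictly positive function. -/
lemma exists_strictlyPositive_density [SigmaFinite μ] (hoc : HasOrderContinuousNorm L.posCone) :
    ∃ φ : X → ℝ≥0, Measurable φ ∧ (∀ᵐ x ∂μ, φ x ≠ 0) ∧
      ∀ f : L.Space, ∫⁻ x, φ x * ‖f x‖ₑ ∂μ ≤ ‖f‖ₑ := by
  obtain ⟨w, hw⟩ := exists_weakUnit L
  obtain ⟨S, ⟨hS, φ, hφ, hφ0, hφL⟩, hSc⟩ := exists_mem_measure_compl_eq_zero μ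
    {S | MeasurableSet S ∧ ∃ φ : X → ℝ≥0∞, Measurable φ ∧ (∀ x ∈ S, φ x ≠ 0) ∧
      ∀ f : L.Space, ∫⁻ x, φ x * ‖f x‖ₑ ∂μ ≤ ‖f‖ₑ} (fun S hS => hS.1)
    ⟨MeasurableSet.empty, 0, measurable_zero, by simp, by simp⟩
    (by
      intro s hs
      refine ⟨MeasurableSet.iUnion fun n => (hs n).1, ?_⟩
      choose φ hφ hφ0 hφL using fun n => (hs n).2
      refine ⟨fun x => ∑' n, 2⁻¹ ^ (n + 1) * φ n x,
        Measurable.tsum fun n => (hφ n).const_mul _, fun x hx => ?_, fun f => ?_⟩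
      · obtain ⟨n, hn⟩ := Set.mem_iUnion.1 hx
        rw [Ne, ENNReal.tsum_eq_zero]
        exact fun h => mul_ne_zero (pow_ne_zero _ (by simp)) (hφ0 n x hn) (h n)
      · have hm : ∀ n, Measurable fun x => φ n x * ‖f x‖ₑ := fun n =>
          (hφ n).mul (coeFn_measurable f).enorm
        calc ∫⁻ x, (∑' n, 2⁻¹ ^ (n + 1) * φ n x) * ‖f x‖ₑ ∂μ
            = ∫⁻ x, ∑' n, 2⁻¹ ^ (n + 1) * (φ n x * ‖f x‖ₑ) ∂μ := by
              simp_rw [← ENNReal.tsum_mul_right, mul_assoc]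
          _ = ∑' n, 2⁻¹ ^ (n + 1) * ∫⁻ x, φ n x * ‖f x‖ₑ ∂μ := by
              rw [lintegral_tsum fun n => ((hm n).const_mul _).aemeasurable]
              simp_rw [lintegral_const_mul _ (hm _)]
          _ ≤ ∑' n, 2⁻¹ ^ (n + 1) * ‖f‖ₑ :=
              ENNReal.tsum_le_tsum fun n => by gcongr; exact hφL n f
          _ = ‖f‖ₑ := by
              rw [ENNReal.tsum_mul_right, ENNReal.tsum_geometric_add_one]
              simp [ENNReal.inv_mul_cancel])
    (by
      intro Y hY hμY
      obtain ⟨φ, hφ, hφL, h0⟩ := exists_density hoc hw hY hμY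
      exact ⟨{x | φ x ≠ 0}, ⟨hφ (measurableSet_singleton 0).compl, φ, hφ, fun x hx => hx, hφL⟩,
        h0⟩)
  have hfin : ∀ᵐ x ∂μ, φ x < ∞ := by
    have hm : Measurable fun x => φ x * ‖w x‖ₑ := hφ.mul (coeFn_measurable w).enorm
    filter_upwards [ae_lt_top hm ((hφL w).trans_lt enorm_lt_top).ne, hw] with x h1 h2
    by_contra h3
    rw [not_lt_top_iff.1 h3, ENNReal.top_mul] at h1
    · exact lt_irrefl _ h1
    · rw [enorm_ne_zero]
      intro h
      rw [h] at h2
      simp at h2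
  -- `φ` is finite almost everywhere, so that no mass is lost in `toNNReal`
  refine ⟨fun x => (φ x).toNNReal, hφ.ennreal_toNNReal, ?_, fun f => ?_⟩
  · filter_upwards [hfin, measure_eq_zero_iff_ae_notMem.1 hSc] with x h1 h2
    rw [Ne, ENNReal.toNNReal_eq_zero_iff, not_or]
    exact ⟨hφ0 x (not_not.1 h2), h1.ne⟩
  · refine le_trans (lintegral_mono fun x => ?_) (hφL f)
    gcongr
    exact ENNReal.coe_toNNReal_le_self

/-- On an order interval, the norm is controlled by the `L¹` norm with weight `φ`. -/
lemma exists_norm_le_of_lintegral_le (hoc : HasOrderContinuousNorm L.posCone) {φ : X → ℝ≥0}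
    (hφ : Measurable φ) (hφ0 : ∀ᵐ x ∂μ, φ x ≠ 0) (u : L.Space) {ε : ℝ} (hε : 0 < ε) :
    ∃ η : ℝ≥0∞, 0 < η ∧ ∀ g : L.Space, (∀ᵐ x ∂μ, ‖g x‖ ≤ ‖u x‖) →
      ∫⁻ x, φ x * ‖g x‖ₑ ∂μ ≤ η → ‖g‖ ≤ ε := by
  -- otherwise there are `g n` in the order interval with summable `L¹` norms and norms above `ε`
  by_contra! hcon
  choose g hgu hgφ hgε using fun n : ℕ => hcon (2⁻¹ ^ n) (by
    exact pos_iff_ne_zero.2 (pow_ne_zero _ (by simp)))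
  have hgm : ∀ n, Measurable fun x => ‖g n x‖ₑ := fun n => (coeFn_measurable (g n)).enorm
  -- the suprema of the tails decrease to `0`
  let V : ℕ → X → ℝ≥0∞ := fun n x => ⨆ j, ‖g (n + j) x‖ₑ
  have hVm : ∀ n, Measurable (V n) := fun n => Measurable.iSup fun j => hgm (n + j)
  have hVu : ∀ᵐ x ∂μ, ∀ n, V n x ≤ ‖u x‖ₑ := by
    filter_upwards [ae_all_iff.2 hgu] with x hx n
    exact iSup_le fun j => enorm_le_iff_norm_le.2 (hx (n + j))
  have hVr : ∀ᵐ x ∂μ, ∀ n, ‖(((V n x).toReal : ℝ) : ℂ)‖ ≤ ‖u x‖ := by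
    filter_upwards [hVu] with x hx n
    rw [Complex.norm_real, Real.norm_of_nonneg ENNReal.toReal_nonneg, ← toReal_enorm (u x)]
    exact ENNReal.toReal_mono enorm_ne_top (hx n)
  let v : ℕ → L.Space := fun n => ofLe u (fun x => (((V n x).toReal : ℝ) : ℂ))
    (Complex.measurable_ofReal.comp (hVm n).ennreal_toReal).aestronglyMeasurable
    (hVr.mono fun x hx => hx n)
  have hv : ∀ᵐ x ∂μ, ∀ n, v n x = (((V n x).toReal : ℝ) : ℂ) :=
    ae_all_iff.2 fun n => coeFn_ofLe _ _ _ _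
  have hanti : ∀ x n, V (n + 1) x ≤ V n x := fun x n => iSup_le fun j => by
    rw [show n + 1 + j = n + (j + 1) by ring]
    exact le_iSup (fun j => ‖g (n + j) x‖ₑ) (j + 1)
  have hsum : ∀ᵐ x ∂μ, ∑' n, φ x * ‖g n x‖ₑ < ∞ := by
    have hm : ∀ n, Measurable fun x => (φ x : ℝ≥0∞) * ‖g n x‖ₑ := fun n =>
      hφ.coe_nnreal_ennreal.mul (hgm n)
    refine ae_lt_top (Measurable.tsum hm) ?_
    rw [lintegral_tsum fun n => (hm n).aemeasurable]
    refine ne_top_of_le_ne_top ?_ (ENNReal.tsum_le_tsum hgφ)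
    rw [ENNReal.tsum_geometric]
    simp
  have hlim : ∀ᵐ x ∂μ, Tendsto (fun n => V n x) atTop (𝓝 0) := by
    filter_upwards [hsum, hφ0] with x h1 h2
    have h3 : Tendsto (fun n => ‖g n x‖ₑ) atTop (𝓝 0) := by
      have h4 := ENNReal.Tendsto.const_mul (a := (φ x : ℝ≥0∞)⁻¹)
        (ENNReal.tendsto_atTop_zero_of_tsum_ne_top h1.ne)
        (Or.inr (ENNReal.inv_ne_top.2 (ENNReal.coe_ne_zero.2 h2)))
      rw [mul_zero] at h4
      refine h4.congr fun n => ?_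
      rw [← mul_assoc, ENNReal.inv_mul_cancel (ENNReal.coe_ne_zero.2 h2) ENNReal.coe_ne_top,
        one_mul]
    rw [ENNReal.tendsto_atTop_zero] at h3 ⊢
    intro e he
    obtain ⟨N, hN⟩ := h3 e he
    exact ⟨N, fun n hn => iSup_le fun j => hN _ (by omega)⟩
  have hnorm : Tendsto (fun n => ‖v n‖) atTop (𝓝 0) := by
    refine tendsto_norm_of_antitone hoc (fun n => ?_) (fun n => ?_) ?_
    · show ∀ᵐ x ∂μ, 0 ≤ (v n x).re ∧ (v n x).im = 0
      filter_upwards [hv] with x hx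
      rw [hx]
      exact ⟨by simp, Complex.ofReal_im _⟩
    · show ∀ᵐ x ∂μ, 0 ≤ ((v n - v (n + 1) : L.Space) x).re ∧
        ((v n - v (n + 1) : L.Space) x).im = 0
      filter_upwards [hv, hVu, coeFn_sub (v n) (v (n + 1))] with x h1 h2 h3
      rw [h3, h1, h1, ← Complex.ofReal_sub]
      refine ⟨?_, Complex.ofReal_im _⟩
      rw [Complex.ofReal_re, sub_nonneg]
      exact ENNReal.toReal_mono (ne_top_of_le_ne_top enorm_ne_top (h2 n)) (hanti x n)
    · filter_upwards [hv, hlim] with x h1 h2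
      simp_rw [h1]
      rw [← Complex.ofReal_zero]
      refine (Complex.continuous_ofReal.tendsto 0).comp ?_
      have h3 := (ENNReal.tendsto_toReal ENNReal.zero_ne_top).comp h2
      rwa [ENNReal.toReal_zero] at h3
  obtain ⟨n, hn⟩ := (hnorm.eventually (gt_mem_nhds hε)).exists
  refine absurd ((norm_le_norm ?_).trans_lt hn) (not_lt.2 (hgε n).le)
  filter_upwards [hv, hVu] with x h1 h2
  rw [h1, Complex.norm_real, Real.norm_of_nonneg ENNReal.toReal_nonneg, ← toReal_enorm (g n x)]
  refine ENNReal.toReal_mono (ne_top_of_le_ne_top enorm_ne_top (h2 n)) ?_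
  exact le_iSup (fun j => ‖g (n + j) x‖ₑ) 0

lemma integrable_density_mul {φ : X → ℝ≥0} (hφ : Measurable φ)
    (hφL : ∀ f : L.Space, ∫⁻ x, φ x * ‖f x‖ₑ ∂μ ≤ ‖f‖ₑ) (f : L.Space) :
    Integrable (fun x => ((φ x : ℝ) : ℂ) * f x) μ := by
  refine ⟨(Complex.measurable_ofReal.comp hφ.coe_nnreal_real).aestronglyMeasurable.mul
    (coeFn_measurable f).aestronglyMeasurable, ?_⟩
  refine lt_of_eq_of_lt (lintegral_congr fun x => ?_) ((hφL f).trans_lt enorm_lt_top)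
  rw [enorm_mul]
  congr 1
  rw [enorm_eq_nnnorm, Complex.nnnorm_real, Real.nnnorm_of_nonneg (φ x).coe_nonneg]
  rfl

/-- The functional on `L` defined by an element `φ` of the associate space. -/
noncomputable def assocFunctional {φ : X → ℝ≥0} (hφ : Measurable φ)
    (hφL : ∀ f : L.Space, ∫⁻ x, φ x * ‖f x‖ₑ ∂μ ≤ ‖f‖ₑ) : L.Space →L[ℂ] ℂ :=
  LinearMap.mkContinuous
    { toFun := fun f => ∫ x, ((φ x : ℝ) : ℂ) * f x ∂μ
      map_add' := fun f g => by
        rw [← integral_add (integrable_density_mul hφ hφL f) (integrable_density_mul hφ hφL g)]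
        refine integral_congr_ae ?_
        filter_upwards [coeFn_add f g] with x hx
        rw [hx, mul_add]
      map_smul' := fun c f => by
        rw [RingHom.id_apply, smul_eq_mul, ← integral_const_mul]
        refine integral_congr_ae ?_
        filter_upwards [coeFn_smul c f] with x hx
        rw [hx, mul_left_comm] } 1 (fun f => by
    rw [one_mul, ← enorm_le_iff_norm_le]
    refine (enorm_integral_le_lintegral_enorm _).trans (le_trans (le_of_eq ?_) (hφL f))
    refine lintegral_congr fun x => ?_
    rw [enorm_mul]
    congr 1
    rw [enorm_eq_nnnorm, Complex.nnnorm_real, Real.nnnorm_of_nonneg (φ x).coe_nonneg]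
    rfl)

lemma assocFunctional_apply {φ : X → ℝ≥0} (hφ : Measurable φ)
    (hφL : ∀ f : L.Space, ∫⁻ x, φ x * ‖f x‖ₑ ∂μ ≤ ‖f‖ₑ) (f : L.Space) :
    assocFunctional hφ hφL f = ∫ x, ((φ x : ℝ) : ℂ) * f x ∂μ := rfl

/-- On `L₊`, the functional `f ↦ ∫ φ f` is the weighted `L¹` norm. -/
lemma lintegral_density_mul_eq {φ : X → ℝ≥0} (hφ : Measurable φ)
    (hφL : ∀ f : L.Space, ∫⁻ x, φ x * ‖f x‖ₑ ∂μ ≤ ‖f‖ₑ) {f : L.Space} (hf : f ∈ L.posCone) :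
    0 ≤ (assocFunctional hφ hφL f).re ∧ (assocFunctional hφ hφL f).im = 0 ∧
      ∫⁻ x, φ x * ‖f x‖ₑ ∂μ = ‖assocFunctional hφ hφL f‖ₑ := by
  have h1 : assocFunctional hφ hφL f = ((∫ x, (φ x : ℝ) * ‖f x‖ ∂μ : ℝ) : ℂ) := by
    rw [assocFunctional_apply, ← integral_complex_ofReal]
    refine integral_congr_ae ?_
    filter_upwards [hf] with x hx
    rw [Complex.ofReal_mul]
    congr 1
    have h2 : f x = (((f x).re : ℝ) : ℂ) := Complex.ext (by simp) (by simp [hx.2])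
    rw [h2, Complex.norm_real, Real.norm_of_nonneg (by simpa using hx.1)]
  have h2 : 0 ≤ ∫ x, (φ x : ℝ) * ‖f x‖ ∂μ :=
    integral_nonneg fun x => mul_nonneg (φ x).coe_nonneg (norm_nonneg _)
  refine ⟨by rw [h1, Complex.ofReal_re]; exact h2, by rw [h1, Complex.ofReal_im], ?_⟩
  rw [h1, enorm_eq_nnnorm, Complex.nnnorm_real, ← enorm_eq_nnnorm, Real.enorm_of_nonneg h2,
    ofReal_integral_eq_lintegral_ofReal]
  · refine lintegral_congr fun x => ?_
    rw [ENNReal.ofReal_mul (φ x).coe_nonneg, ENNReal.ofReal_coe_nnreal, ofReal_norm]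
  · refine (integrable_density_mul hφ hφL f).norm.congr (Eventually.of_forall fun x => ?_)
    simp only [norm_mul, Complex.norm_real, Real.norm_of_nonneg (φ x).coe_nonneg]
  · exact Eventually.of_forall fun x => mul_nonneg (φ x).coe_nonneg (norm_nonneg _)

end BanachFunctionSpace

/-! ### Precompactness in a weighted `L¹` norm -/

namespace BanachFunctionSpace

variable {X : Type*} [MeasurableSpace X] {μ : Measure X} {L : BanachFunctionSpace μ}

lemma HasNonnegKernel.sub [SigmaFinite μ] {A B : L.Op} {a b : X × X → ℝ≥0}
    (hA : L.HasNonnegKernel A a) (hB : L.HasNonnegKernel B b) (hba : b ≤ᵐ[μ.prod μ] a) :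
    L.HasNonnegKernel (A - B) (fun p => a p - b p) := by
  refine (HasKernel.sub hA hB).congr ?_
  filter_upwards [hba] with p hp
  rw [NNReal.coe_sub hp, Complex.ofReal_sub]

/-- The rank one operator `f ↦ (∫ φ f) w` has the kernel `w ⊗ φ`. -/
lemma hasNonnegKernel_rankOne [SigmaFinite μ] {φ : X → ℝ≥0} (hφ : Measurable φ)
    (hφL : ∀ f : L.Space, ∫⁻ x, φ x * ‖f x‖ₑ ∂μ ≤ ‖f‖ₑ) {w : L.Space} (hw : w ∈ L.posCone) :
    L.HasNonnegKernel ((assocFunctional hφ hφL).smulRight w) (fun p => ‖w p.1‖₊ * φ p.2) := by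
  refine ⟨(Complex.measurable_ofReal.comp (((coeFn_measurable w).nnnorm.comp measurable_fst).mul
    (hφ.comp measurable_snd)).coe_nnreal_real).aemeasurable, fun f => ?_⟩
  filter_upwards [coeFn_smul (assocFunctional hφ hφL f) w, mem_posCone_iff.1 hw] with x h1 h2
  have h3 : (fun y => (((‖w x‖₊ * φ y : ℝ≥0) : ℝ) : ℂ) * f y) =
      fun y => (‖w x‖ : ℂ) * (((φ y : ℝ) : ℂ) * f y) := by
    ext y
    rw [NNReal.coe_mul, Complex.ofReal_mul, coe_nnnorm, mul_assoc]
  simp only [h3]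
  refine ⟨(integrable_density_mul hφ hφL f).const_mul _, ?_⟩
  rw [integral_const_mul, ← assocFunctional_apply hφ hφL, ← h2, mul_comm]
  exact h1

/-- `B` maps the unit ball to a set that is totally bounded for the `L¹` norm with
weight `φ`. -/
def IsPrecompactLOne (φ : X → ℝ≥0) (B : L.Op) : Prop :=
  ∀ ε : ℝ≥0, 0 < ε → ∃ M : Set L.Space, M.Finite ∧ ∀ f : L.Space, ‖f‖ ≤ 1 →
    ∃ m ∈ M, ∫⁻ x, φ x * ‖(B f - m : L.Space) x‖ₑ ∂μ ≤ ε

variable {φ : X → ℝ≥0}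

lemma measurable_weight_mul_enorm (hφ : Measurable φ) (f : L.Space) :
    Measurable fun x => (φ x : ℝ≥0∞) * ‖f x‖ₑ :=
  hφ.coe_nnreal_ennreal.mul (coeFn_measurable f).enorm

/-- The triangle inequality for the weighted `L¹` norm, for functions with `|h| ≤ |f| + |g|`. -/
lemma lintegral_weight_add_le (hφ : Measurable φ) {f g h : L.Space}
    (hh : ∀ᵐ x ∂μ, ‖h x‖ₑ ≤ ‖f x‖ₑ + ‖g x‖ₑ) :
    ∫⁻ x, φ x * ‖h x‖ₑ ∂μ ≤ ∫⁻ x, φ x * ‖f x‖ₑ ∂μ + ∫⁻ x, φ x * ‖g x‖ₑ ∂μ := by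
  rw [← lintegral_add_left (measurable_weight_mul_enorm hφ f)]
  refine lintegral_mono_ae ?_
  filter_upwards [hh] with x hx
  rw [← mul_add]
  gcongr

lemma IsPrecompactLOne.add (hφ : Measurable φ) {A B : L.Op} (hA : IsPrecompactLOne φ A)
    (hB : IsPrecompactLOne φ B) : IsPrecompactLOne φ (A + B) := by
  intro ε hε
  obtain ⟨M, hM, hAM⟩ := hA (ε / 2) (half_pos hε)
  obtain ⟨N, hN, hBN⟩ := hB (ε / 2) (half_pos hε)
  refine ⟨Set.image2 (· + ·) M N, hM.image2 _ hN, fun f hf => ?_⟩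
  obtain ⟨m, hm, h1⟩ := hAM f hf
  obtain ⟨n, hn, h2⟩ := hBN f hf
  refine ⟨m + n, Set.mem_image2_of_mem hm hn,
    (lintegral_weight_add_le hφ (f := A f - m) (g := B f - n) ?_).trans
      ((add_le_add h1 h2).trans_eq ?_)⟩
  · have h3 : (A + B) f - (m + n) = (A f - m) + (B f - n) := by
      rw [add_apply]
      abel
    rw [h3]
    filter_upwards [coeFn_add (A f - m) (B f - n)] with x hx
    rw [hx]
    exact enorm_add_le _ _
  · rw [← ENNReal.coe_add, add_halves]

lemma IsPrecompactLOne.smul {A : L.Op} (hA : IsPrecompactLOne φ A) (c : ℂ) :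
    IsPrecompactLOne φ (c • A) := by
  intro ε hε
  obtain ⟨M, hM, hAM⟩ := hA (ε / (‖c‖₊ + 1)) (by positivity)
  refine ⟨(c • ·) '' M, hM.image _, fun f hf => ?_⟩
  obtain ⟨m, hm, h1⟩ := hAM f hf
  refine ⟨c • m, Set.mem_image_of_mem _ hm, ?_⟩
  have h2 : (c • A) f - c • m = c • (A f - m) := by
    rw [smul_apply, smul_sub]
  rw [h2]
  calc ∫⁻ x, φ x * ‖(c • (A f - m) : L.Space) x‖ₑ ∂μ
      = ∫⁻ x, ‖c‖ₑ * (φ x * ‖(A f - m : L.Space) x‖ₑ) ∂μ := by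
        refine lintegral_congr_ae ?_
        filter_upwards [coeFn_smul c (A f - m)] with x hx
        rw [hx, enorm_mul, mul_left_comm]
    _ = ‖c‖ₑ * ∫⁻ x, φ x * ‖(A f - m : L.Space) x‖ₑ ∂μ :=
        lintegral_const_mul' _ _ enorm_ne_top
    _ ≤ ‖c‖ₑ * (ε / (‖c‖₊ + 1) : ℝ≥0) := by gcongr
    _ ≤ ε := by
        rw [enorm_eq_nnnorm, ← ENNReal.coe_mul, ENNReal.coe_le_coe, mul_div_assoc',
          div_le_iff₀ (by positivity), mul_comm]
        gcongr
        exact le_self_add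

lemma IsPrecompactLOne.sub (hφ : Measurable φ) {A B : L.Op} (hA : IsPrecompactLOne φ A)
    (hB : IsPrecompactLOne φ B) : IsPrecompactLOne φ (A - B) := by
  have := hA.add hφ (hB.smul (-1))
  rwa [neg_one_smul, ← sub_eq_add_neg] at this

lemma IsPrecompactLOne.of_isCompactOperator
    (hφL : ∀ f : L.Space, ∫⁻ x, φ x * ‖f x‖ₑ ∂μ ≤ ‖f‖ₑ) {A : L.Op} (hA : IsCompactOperator A) :
    IsPrecompactLOne φ A := by
  intro ε hε
  obtain ⟨M, hM, hAM⟩ := hasFiniteNet_of_lt (A := A) (δ := ε) (by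
    rw [hausdorffMNC_eq_zero_of_isCompactOperator hA]
    exact ENNReal.coe_pos.2 hε)
  refine ⟨M, hM, fun f hf => ?_⟩
  obtain ⟨m, hm, h⟩ := hAM f hf
  refine ⟨m, hm, (hφL _).trans ?_⟩
  rw [← ofReal_norm]
  exact (ENNReal.ofReal_le_ofReal h).trans_eq (ENNReal.ofReal_coe_nnreal)

lemma isPrecompactLOne_zero : IsPrecompactLOne φ (0 : L.Op) := fun ε _ =>
  ⟨{0}, Set.finite_singleton 0, fun f _ => ⟨0, rfl, by
    rw [zero_apply, sub_zero]
    refine le_trans (le_of_eq ?_) (zero_le (a := (ε : ℝ≥0∞)))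
    rw [← lintegral_zero (μ := μ)]
    refine lintegral_congr_ae ?_
    filter_upwards [coeFn_zero (L := L)] with x hx
    rw [hx, enorm_zero, mul_zero]⟩⟩

lemma IsPrecompactLOne.sum (hφ : Measurable φ) {ι : Type*} (s : Finset ι) {A : ι → L.Op}
    (hA : ∀ i ∈ s, IsPrecompactLOne φ (A i)) : IsPrecompactLOne φ (∑ i ∈ s, A i) :=
  Finset.sum_induction _ _ (fun _ _ hx hy => hx.add hφ hy) isPrecompactLOne_zero hA

lemma isCompactOperator_smulRight (F : L.Space →L[ℂ] ℂ) (w : L.Space) :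
    IsCompactOperator (F.smulRight w) := by
  have h : (F.smulRight w : L.Space → L.Space) =
      ((1 : ℂ →L[ℂ] ℂ).smulRight w) ∘ F := by
    ext1 f
    simp
  rw [h]
  have hF : IsCompactOperator F := by
    refine ⟨Metric.closedBall 0 1, isCompact_closedBall 0 1, ?_⟩
    exact F.continuous.continuousAt.preimage_mem_nhds (by
      rw [map_zero]
      exact Metric.closedBall_mem_nhds 0 one_pos)
  exact hF.clm_comp _

/-- The weighted `L¹` norm of `A |f|` is an integral over `X × X`, by Tonelli's theorem. -/
lemma lintegral_weight_apply_modulus [SigmaFinite μ] (hφ : Measurable φ) {A : L.Op}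
    {a : X × X → ℝ≥0} (hA : L.HasNonnegKernel A a) (f : L.Space) :
    ∫⁻ x, φ x * ‖A (modulus f) x‖ₑ ∂μ =
      ∫⁻ p, φ p.1 * (a p * ‖f p.2‖ₑ) ∂(μ.prod μ) := by
  rw [lintegral_prod]
  · refine lintegral_congr_ae ?_
    filter_upwards [hA.lintegral_eq f] with x hx
    rw [lintegral_const_mul' _ _ ENNReal.coe_ne_top, hx.2.1, enorm_eq_nnnorm,
      Complex.nnnorm_real, ← enorm_eq_nnnorm, Real.enorm_of_nonneg ENNReal.toReal_nonneg,
      ENNReal.ofReal_toReal hx.2.2.ne]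
  · exact (hφ.coe_nnreal_ennreal.comp measurable_fst).aemeasurable.mul
      (hA.aemeasurable.coe_nnreal_ennreal.mul
        ((coeFn_measurable f).enorm.comp measurable_snd).aemeasurable)

/-- If the norm of `L*` is order continuous, then precompactness in the weighted `L¹` norm passes
to operators whose kernels are limits of increasing sequences: the functionals `f ↦ ∫ φ (B - Bₙ) f`
decrease to `0`. -/
lemma IsPrecompactLOne.of_tendsto [SigmaFinite μ] (hod : HasOrderContinuousNorm L.dualPosCone)
    (hφ : Measurable φ) (hφL : ∀ f : L.Space, ∫⁻ x, φ x * ‖f x‖ₑ ∂μ ≤ ‖f‖ₑ)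
    {B : L.Op} {b : X × X → ℝ≥0} (hB : L.HasNonnegKernel B b) {C : ℕ → L.Op}
    {c : ℕ → X × X → ℝ≥0} (hC : ∀ n, L.HasNonnegKernel (C n) (c n))
    (hpre : ∀ n, IsPrecompactLOne φ (C n)) (hmono : ∀ n, c n ≤ᵐ[μ.prod μ] c (n + 1))
    (hle : ∀ n, c n ≤ᵐ[μ.prod μ] b)
    (hlim : ∀ᵐ p ∂(μ.prod μ), Tendsto (fun n => c n p) atTop (𝓝 (b p))) :
    IsPrecompactLOne φ B := by
  have hD : ∀ n, L.HasNonnegKernel (B - C n) (fun p => b p - c n p) := fun n =>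
    hB.sub (hC n) (hle n)
  let F := assocFunctional hφ hφL
  let ψ : ℕ → L.Space →L[ℂ] ℂ := fun n => F.comp (B - C n)
  -- the weighted integrals tend to `0` by dominated convergence on `X × X`
  have hint : ∀ f : L.Space,
      Tendsto (fun n => ∫⁻ x, φ x * ‖(B - C n) (modulus f) x‖ₑ ∂μ) atTop (𝓝 0) := by
    intro f
    simp_rw [fun n => lintegral_weight_apply_modulus hφ (hD n) f]
    have hfin : ∫⁻ p, φ p.1 * (b p * ‖f p.2‖ₑ) ∂(μ.prod μ) ≠ ⊤ := by
      rw [← lintegral_weight_apply_modulus hφ hB f]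
      exact ((hφL _).trans_lt enorm_lt_top).ne
    have h0 : ∫⁻ p : X × X, (0 : ℝ≥0∞) ∂(μ.prod μ) = 0 := lintegral_zero
    rw [← h0]
    refine tendsto_lintegral_of_dominated_convergence' _ (fun n => ?_) (fun n => ?_) hfin ?_
    · exact (hφ.coe_nnreal_ennreal.comp measurable_fst).aemeasurable.mul
        ((hD n).aemeasurable.coe_nnreal_ennreal.mul
          ((coeFn_measurable f).enorm.comp measurable_snd).aemeasurable)
    · refine Eventually.of_forall fun p => ?_
      exact mul_le_mul_right (mul_le_mul_left (ENNReal.coe_le_coe.2 tsub_le_self) _) _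
    · filter_upwards [hlim] with p hp
      have h1 : Tendsto (fun n => ((b p - c n p : ℝ≥0) : ℝ≥0∞)) atTop (𝓝 0) := by
        rw [← ENNReal.coe_zero, ENNReal.tendsto_coe, ← tsub_self (b p)]
        exact tendsto_const_nhds.sub hp
      have h2 := ENNReal.Tendsto.const_mul (a := (φ p.1 : ℝ≥0∞))
        (ENNReal.Tendsto.mul_const (b := ‖f p.2‖ₑ) h1 (Or.inr enorm_ne_top))
        (Or.inr ENNReal.coe_ne_top)
      rwa [zero_mul, mul_zero] at h2
  have hψ : Tendsto (fun n => ‖ψ n‖) atTop (𝓝 0) := by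
    refine hod ψ (fun n f hf => ?_) (fun n f hf => ?_) (fun θ hθ f hf => ?_)
    · have := lintegral_density_mul_eq hφ hφL ((hD n).map_posCone hf)
      exact ⟨this.1, this.2.1⟩
    · have h1 : (ψ n - ψ (n + 1)) f = F ((C (n + 1) - C n) f) := by
        show F ((B - C n) f) - F ((B - C (n + 1)) f) = _
        rw [← map_sub]
        congr 1
        simp only [sub_apply]
        abel
      rw [h1]
      have := lintegral_density_mul_eq hφ hφL
        (((hC (n + 1)).sub (hC n) (hmono n)).map_posCone hf)
      exact ⟨this.1, this.2.1⟩
    · have h1 : Tendsto (fun n => ψ n f) atTop (𝓝 0) := by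
        rw [tendsto_zero_iff_norm_tendsto_zero]
        have h2 := (ENNReal.tendsto_toReal ENNReal.zero_ne_top).comp (hint f)
        rw [ENNReal.toReal_zero] at h2
        refine h2.congr fun n => ?_
        have h3 := (lintegral_density_mul_eq hφ hφL ((hD n).map_posCone hf)).2.2
        rw [Function.comp_apply, modulus_eq_self hf, h3, toReal_enorm]
        rfl
      have h2 : ∀ n, 0 ≤ (ψ n f - θ f).re ∧ (ψ n f - θ f).im = 0 := fun n => hθ n f hf
      have h3 : Tendsto (fun n => ψ n f - θ f) atTop (𝓝 (0 - θ f)) := h1.sub tendsto_const_nhds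
      constructor
      · exact ge_of_tendsto' ((Complex.continuous_re.tendsto _).comp h3) fun n => (h2 n).1
      · refine tendsto_nhds_unique ((Complex.continuous_im.tendsto _).comp h3) ?_
        exact tendsto_const_nhds.congr fun n => (h2 n).2.symm
  intro ε hε
  obtain ⟨n, hn⟩ := (hψ.eventually (gt_mem_nhds (NNReal.coe_pos.2 (half_pos hε)))).exists
  obtain ⟨M, hM, hCM⟩ := hpre n (ε / 2) (half_pos hε)
  refine ⟨M, hM, fun f hf => ?_⟩
  obtain ⟨m, hm, h1⟩ := hCM f hf
  have h2 : ∫⁻ x, φ x * ‖(B - C n) (modulus f) x‖ₑ ∂μ ≤ (ε / 2 : ℝ≥0) := by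
    rw [(lintegral_density_mul_eq hφ hφL ((hD n).map_posCone (modulus_mem_posCone f))).2.2]
    have h3 : ‖ψ n (modulus f)‖ ≤ (ε / 2 : ℝ≥0) := by
      refine ((ψ n).le_opNorm _).trans ?_
      rw [norm_modulus]
      exact (mul_le_of_le_one_right (norm_nonneg _) hf).trans hn.le
    rw [← ofReal_norm]
    exact (ENNReal.ofReal_le_ofReal h3).trans_eq ENNReal.ofReal_coe_nnreal
  have h3 : ∀ᵐ x ∂μ, ‖(B f - m : L.Space) x‖ₑ ≤
      ‖(B - C n) (modulus f) x‖ₑ + ‖(C n f - m : L.Space) x‖ₑ := by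
    have h4 : B f - m = (B - C n) f + (C n f - m) := by
      rw [sub_apply]
      abel
    rw [h4]
    filter_upwards [coeFn_add ((B - C n) f) (C n f - m),
      (hD n).norm_apply_le (hD n) (EventuallyLE.refl _ _) f] with x h5 h6
    rw [h5]
    refine (enorm_add_le _ _).trans ?_
    gcongr
    exact enorm_le_iff_norm_le.2 h6
  refine ⟨m, hm, (lintegral_weight_add_le hφ h3).trans ((add_le_add h2 h1).trans_eq ?_)⟩
  rw [← ENNReal.coe_add, add_halves]

end BanachFunctionSpace

namespace BanachFunctionSpace

variable {X : Type*} [MeasurableSpace X] {μ : Measure X} {L : BanachFunctionSpace μ}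
  {φ : X → ℝ≥0}

/-- The restrictions of the rank one kernel `w ⊗ φ` to measurable sets are precompact: for
rectangles the operator has rank one, and the general case follows by Dynkin's theorem. -/
lemma isPrecompactLOne_of_indicator [SigmaFinite μ] (hod : HasOrderContinuousNorm L.dualPosCone)
    (hφ : Measurable φ) (hφL : ∀ f : L.Space, ∫⁻ x, φ x * ‖f x‖ₑ ∂μ ≤ ‖f‖ₑ)
    {w : L.Space} (hw : w ∈ L.posCone) {W : Set (X × X)} (hW : MeasurableSet W) :
    ∀ A : L.Op, L.HasNonnegKernel A (W.indicator fun p => ‖w p.1‖₊ * φ p.2) →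
      IsPrecompactLOne φ A := by
  set k : X × X → ℝ≥0 := fun p => ‖w p.1‖₊ * φ p.2 with hk
  have hkm : Measurable k :=
    ((coeFn_measurable w).nnnorm.comp measurable_fst).mul (hφ.comp measurable_snd)
  have hK := hasNonnegKernel_rankOne hφ hφL hw
  have hind : ∀ V : Set (X × X), MeasurableSet V →
      ∃ A : L.Op, L.HasNonnegKernel A (V.indicator k) := fun V hV =>
    hK.exists_of_le (hkm.indicator hV).aemeasurable
      (Eventually.of_forall fun p => Set.indicator_le_self _ _ _)
  induction W, hW using MeasurableSpace.induction_on_inter generateFrom_prod.symm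
    isPiSystem_prod with
  | empty =>
    intro A hA
    have h0 : L.HasNonnegKernel 0 (Set.indicator (∅ : Set (X × X)) k) := by
      refine hasKernel_zero.congr (Eventually.of_forall fun p => ?_)
      simp
    rw [hA.op_unique h0]
    exact isPrecompactLOne_zero
  | basic V hV =>
    intro A hA
    obtain ⟨S, hS, E, hE, rfl⟩ := hV
    have hφE : Measurable (E.indicator φ) := hφ.indicator hE
    have hφEL : ∀ f : L.Space, ∫⁻ x, E.indicator φ x * ‖f x‖ₑ ∂μ ≤ ‖f‖ₑ := fun f => by
      refine le_trans (lintegral_mono fun x => ?_) (hφL f)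
      gcongr
      exact Set.indicator_le_self _ _ _
    have hR := hasNonnegKernel_rankOne hφE hφEL (restr_mem_posCone hw hS)
    have hR' : L.HasNonnegKernel ((assocFunctional hφE hφEL).smulRight (restr w hS))
        ((S ×ˢ E).indicator k) := by
      refine hR.congr ?_
      filter_upwards [Measure.quasiMeasurePreserving_fst.ae (coeFn_restr w hS)] with p hp
      rw [hp]
      by_cases h1 : p.1 ∈ S
      · by_cases h2 : p.2 ∈ E
        · rw [Set.indicator_of_mem h1, Set.indicator_of_mem h2,
            Set.indicator_of_mem (Set.mk_mem_prod h1 h2)]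
        · rw [Set.indicator_of_notMem h2, mul_zero, Set.indicator_of_notMem fun h => h2 h.2]
      · rw [Set.indicator_of_notMem h1, nnnorm_zero, zero_mul,
          Set.indicator_of_notMem fun h => h1 h.1]
    rw [hA.op_unique hR']
    exact IsPrecompactLOne.of_isCompactOperator hφL (isCompactOperator_smulRight _ _)
  | compl V hV ih =>
    intro A hA
    obtain ⟨B, hB⟩ := hind V hV
    have h1 : L.HasNonnegKernel ((assocFunctional hφ hφL).smulRight w - B) (Vᶜ.indicator k) := by
      refine (hK.sub hB (Eventually.of_forall fun p => Set.indicator_le_self _ _ _)).congr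
        (Eventually.of_forall fun p => ?_)
      show k p - V.indicator k p = Vᶜ.indicator k p
      by_cases hp : p ∈ V
      · rw [Set.indicator_of_mem hp, Set.indicator_of_notMem (fun h : p ∈ Vᶜ => h hp), tsub_self]
      · rw [Set.indicator_of_notMem hp, Set.indicator_of_mem hp, tsub_zero]
    rw [hA.op_unique h1]
    exact (IsPrecompactLOne.of_isCompactOperator hφL (isCompactOperator_smulRight _ _)).sub hφ
      (ih B hB)
  | iUnion V hd hV ih =>
    intro A hA
    choose B hB using fun i => hind (V i) (hV i)
    have hdis : ∀ p i, p ∈ V i → ∀ j, j ≠ i → p ∉ V j := fun p i hi j hj hp =>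
      Set.disjoint_left.1 (hd hj) hp hi
    refine IsPrecompactLOne.of_tendsto hod hφ hφL hA
      (fun n => HasNonnegKernel.sum (Finset.range n) fun i _ => hB i)
      (fun n => IsPrecompactLOne.sum hφ _ fun i _ => ih i (B i) (hB i))
      (fun n => Eventually.of_forall fun p => ?_) (fun n => Eventually.of_forall fun p => ?_)
      (Eventually.of_forall fun p => ?_)
    · simp only [Finset.sum_range_succ]
      exact le_self_add
    · by_cases hp : ∃ i, p ∈ V i
      · obtain ⟨i, hi⟩ := hp
        rw [Set.indicator_of_mem (Set.mem_iUnion.2 ⟨i, hi⟩)]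
        calc ∑ j ∈ Finset.range n, (V j).indicator k p
            ≤ ∑ j ∈ Finset.range n, if j = i then k p else 0 := by
              refine Finset.sum_le_sum fun j _ => ?_
              split_ifs with h
              · exact Set.indicator_le_self _ _ _
              · rw [Set.indicator_of_notMem (hdis p i hi j h)]
          _ ≤ k p := by
              rw [Finset.sum_ite_eq']
              split_ifs
              · exact le_rfl
              · exact zero_le
      · push Not at hp
        exact (Finset.sum_eq_zero fun j _ => Set.indicator_of_notMem (hp j) _).trans_le zero_le
    · by_cases hp : ∃ i, p ∈ V i
      · obtain ⟨i, hi⟩ := hp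
        rw [Set.indicator_of_mem (Set.mem_iUnion.2 ⟨i, hi⟩)]
        refine tendsto_const_nhds.congr' ?_
        filter_upwards [eventually_gt_atTop i] with n hn
        rw [Finset.sum_eq_single i (fun j _ hj => Set.indicator_of_notMem (hdis p i hi j hj) _)
          (fun h => absurd (Finset.mem_range.2 hn) h), Set.indicator_of_mem hi]
      · push Not at hp
        rw [Set.indicator_of_notMem (by simpa using hp)]
        refine tendsto_const_nhds.congr fun n => ?_
        rw [Finset.sum_eq_zero fun j _ => Set.indicator_of_notMem (hp j) _]

/-- If `L*` has order continuous norm, every positive kernel operator is precompact for the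
weighted `L¹` norm: its kernel is the limit of an increasing sequence of simple multiples of the
rank one kernel `w ⊗ φ`. -/
lemma HasNonnegKernel.isPrecompactLOne [SigmaFinite μ]
    (hod : HasOrderContinuousNorm L.dualPosCone) (hφ : Measurable φ) (hφ0 : ∀ᵐ x ∂μ, φ x ≠ 0)
    (hφL : ∀ f : L.Space, ∫⁻ x, φ x * ‖f x‖ₑ ∂μ ≤ ‖f‖ₑ) {T : L.Op} {t : X × X → ℝ≥0}
    (hT : L.HasNonnegKernel T t) : IsPrecompactLOne φ T := by
  obtain ⟨t, htm, -, hT⟩ := hT.exists_measurable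
  obtain ⟨w, hw⟩ := exists_weakUnit L
  have hwpos : w ∈ L.posCone := by
    filter_upwards [hw] with x hx
    exact ⟨hx.1.le, hx.2⟩
  set k : X × X → ℝ≥0 := fun p => ‖w p.1‖₊ * φ p.2 with hk
  have hkm : Measurable k :=
    ((coeFn_measurable w).nnnorm.comp measurable_fst).mul (hφ.comp measurable_snd)
  have hK := hasNonnegKernel_rankOne hφ hφL hwpos
  have hk0 : ∀ᵐ p ∂(μ.prod μ), k p ≠ 0 := by
    filter_upwards [Measure.quasiMeasurePreserving_fst.ae hw,
      Measure.quasiMeasurePreserving_snd.ae hφ0] with p h1 h2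
    refine mul_ne_zero (nnnorm_ne_zero_iff.2 fun h => ?_) h2
    rw [h] at h1
    simp at h1
  let q : X × X → ℝ≥0∞ := fun p => ((t p / k p : ℝ≥0) : ℝ≥0∞)
  have hqm : Measurable q := (htm.div hkm).coe_nnreal_ennreal
  let e := SimpleFunc.eapprox q
  let s : ℕ → X × X → ℝ≥0 := fun n p => (e n p).toNNReal
  have hetop : ∀ n p, e n p ≠ ⊤ := fun n p => (SimpleFunc.eapprox_lt_top q n p).ne
  have hes : ∀ n p, ((s n p : ℝ≥0) : ℝ≥0∞) = e n p := fun n p => ENNReal.coe_toNNReal (hetop n p)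
  have hsm : ∀ n, Measurable (s n) := fun n => (e n).measurable.ennreal_toNNReal
  have hsmono : ∀ n p, s n p ≤ s (n + 1) p := fun n p =>
    ENNReal.toNNReal_mono (hetop _ _) (SimpleFunc.monotone_eapprox q n.le_succ p)
  have hslim : ∀ p, Tendsto (fun n => s n p) atTop (𝓝 (t p / k p)) := fun p => by
    rw [← ENNReal.tendsto_coe]
    simp_rw [hes]
    exact SimpleFunc.tendsto_eapprox hqm p
  have hsle : ∀ n p, s n p ≤ t p / k p := fun n p =>
    Monotone.ge_of_tendsto (monotone_nat_of_le_succ fun n => hsmono n p) (hslim p) n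
  let c : ℕ → X × X → ℝ≥0 := fun n p => k p * s n p
  have hcle : ∀ n, c n ≤ᵐ[μ.prod μ] t := fun n => by
    filter_upwards [hk0] with p hp
    calc k p * s n p ≤ k p * (t p / k p) := by gcongr; exact hsle n p
      _ = t p := mul_div_cancel₀ _ hp
  -- the simple functions `s n` increase to the quotient `t / k`
  choose C hC using fun n => hT.exists_of_le (hkm.mul (hsm n)).aemeasurable (hcle n)
  refine IsPrecompactLOne.of_tendsto hod hφ hφL hT hC (fun n => ?_)
    (fun n => Eventually.of_forall fun p => ?_) hcle ?_
  -- each approximating kernel is a finite sum of multiples of restrictions of `w ⊗ φ`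
  · have hfib : ∀ v, MeasurableSet (e n ⁻¹' {v}) := fun v => (e n).measurableSet_fiber v
    choose A hA using fun v => hK.exists_of_le (hkm.indicator (hfib v)).aemeasurable
      (Eventually.of_forall fun p => Set.indicator_le_self _ _ _)
    have hS := HasNonnegKernel.sum (e n).range fun v _ => (hA v).smul v.toNNReal
    have hS' : L.HasNonnegKernel
        (∑ v ∈ (e n).range, ((v.toNNReal : ℝ) : ℂ) • A v) (c n) := by
      refine hS.congr (Eventually.of_forall fun p => ?_)
      show ∑ v ∈ (e n).range, v.toNNReal * (e n ⁻¹' {v}).indicator k p = k p * s n p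
      rw [Finset.sum_eq_single (e n p)]
      · rw [Set.indicator_of_mem (show p ∈ e n ⁻¹' {e n p} from rfl), mul_comm]
      · intro v _ hv
        rw [Set.indicator_of_notMem (show p ∉ e n ⁻¹' {v} from fun h => hv h.symm), mul_zero]
      · exact fun h => absurd ((e n).mem_range_self p) h
    rw [(hC n).op_unique hS']
    exact IsPrecompactLOne.sum hφ _ fun v _ =>
      (isPrecompactLOne_of_indicator hod hφ hφL hwpos (hfib v) _ (hA v)).smul _
  · show k p * s n p ≤ k p * s (n + 1) p
    gcongr
    exact hsmono n p
  · filter_upwards [hk0] with p hp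
    have := (hslim p).const_mul (k p)
    rwa [mul_div_cancel₀ _ hp] at this

/-! ### Monotonicity of the measure of noncompactness -/

/-- The radial truncation of complex numbers to modulus at most `r`. -/
noncomputable def radialTrunc (r : ℝ) (z : ℂ) : ℂ := if ‖z‖ ≤ r then z else ((r / ‖z‖ : ℝ) : ℂ) * z

lemma norm_radialTrunc_le {r : ℝ} (hr : 0 ≤ r) (z : ℂ) : ‖radialTrunc r z‖ ≤ r := by
  unfold radialTrunc
  split_ifs with h
  · exact h
  · have hz : 0 < ‖z‖ := hr.trans_lt (not_le.1 h)
    rw [norm_mul, Complex.norm_real, Real.norm_of_nonneg (by positivity), div_mul_cancel₀ _ hz.ne']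

/-- A point `z` with `|z| ≤ r + s` is approximated by the truncation of `v` up to `s` and an error that
is small with `|z - v|` and bounded by `2 r`. -/
lemma norm_sub_radialTrunc_le {r s : ℝ} (hr : 0 ≤ r) (hs : 0 ≤ s) {z : ℂ} (hz : ‖z‖ ≤ r + s)
    (v : ℂ) : ‖z - radialTrunc r v‖ ≤ s + min (2 * r) (2 * ‖z - v‖) := by
  rw [← min_add_add_left]
  refine le_min ?_ ?_
  · linarith [norm_sub_le z (radialTrunc r v), norm_radialTrunc_le hr v]
  · by_cases h : ‖v‖ ≤ r
    · rw [radialTrunc, if_pos h]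
      linarith [norm_nonneg (z - v)]
    · have hv : 0 < ‖v‖ := hr.trans_lt (not_le.1 h)
      have h1 : ‖v - radialTrunc r v‖ = ‖v‖ - r := by
        have h2 : v - radialTrunc r v = ((1 - r / ‖v‖ : ℝ) : ℂ) * v := by
          rw [radialTrunc, if_neg h, Complex.ofReal_sub, Complex.ofReal_one]
          ring
        rw [h2, norm_mul, Complex.norm_real, Real.norm_of_nonneg, sub_mul, one_mul,
          div_mul_cancel₀ _ hv.ne']
        rw [sub_nonneg, div_le_one hv]
        exact (not_le.1 h).le
      have h3 : ‖v‖ ≤ ‖z‖ + ‖z - v‖ := by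
        have := norm_sub_le z (z - v)
        rwa [sub_sub_cancel] at this
      linarith [norm_sub_le_norm_sub_add_norm_sub z v (radialTrunc r v)]

lemma measurable_radialTrunc {r : X → ℝ} {f : X → ℂ} (hr : Measurable r) (hf : Measurable f) :
    Measurable fun x => radialTrunc (r x) (f x) :=
  Measurable.ite (measurableSet_le hf.norm hr) hf
    ((Complex.measurable_ofReal.comp (hr.div hf.norm)).mul hf)

/-- `T` maps the unit ball to a subset of the sum of an order interval and the ball of
radius `δ`. -/
def AlmostOrderBounded (T : L.Op) (δ : ℝ) : Prop :=
  ∃ u : L.Space, ∀ f : L.Space, ‖f‖ ≤ 1 → ∃ h : L.Space, ‖h‖ ≤ δ ∧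
    ∀ᵐ x ∂μ, ‖T f x‖ ≤ ‖u x‖ + ‖h x‖

lemma almostOrderBounded_of_hasFiniteNet {T : L.Op} {δ : ℝ} (h : HasFiniteNet T δ) :
    AlmostOrderBounded T δ := by
  obtain ⟨M, hM, hTM⟩ := h
  refine ⟨∑ m ∈ hM.toFinset, modulus m, fun f hf => ?_⟩
  obtain ⟨m, hm, hfm⟩ := hTM f hf
  refine ⟨T f - m, hfm, ?_⟩
  filter_upwards [coeFn_sum hM.toFinset (fun m : L.Space => modulus m),
    (eventually_all_finset hM.toFinset).2 fun m _ => coeFn_modulus m,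
    coeFn_sub (T f) m] with x h1 h2 h3
  have h4 : ‖m x‖ ≤ ‖(∑ m ∈ hM.toFinset, modulus m : L.Space) x‖ := by
    rw [h1, Finset.sum_congr rfl h2, ← Complex.ofReal_sum, Complex.norm_real,
      Real.norm_of_nonneg (Finset.sum_nonneg fun _ _ => norm_nonneg _)]
    exact Finset.single_le_sum (f := fun m : L.Space => ‖m x‖) (fun _ _ => norm_nonneg _)
      (hM.mem_toFinset.2 hm)
  rw [h3]
  have h5 : ‖T f x‖ ≤ ‖m x‖ + ‖T f x - m x‖ := by
    have := norm_add_le (m x) (T f x - m x)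
    rwa [add_sub_cancel] at this
  linarith

lemma AlmostOrderBounded.of_kernelLE [SigmaFinite μ] {T B : L.Op} {δ : ℝ}
    (hB : AlmostOrderBounded B δ) (hTB : L.KernelLE T B) : AlmostOrderBounded T δ := by
  obtain ⟨u, hu⟩ := hB
  obtain ⟨t, b, ht, hb, htb⟩ := kernelLE_iff.1 hTB
  refine ⟨u, fun f hf => ?_⟩
  obtain ⟨h, hδ, hh⟩ := hu (modulus f) (by rwa [norm_modulus])
  refine ⟨h, hδ, ?_⟩
  filter_upwards [hh, hb.norm_apply_le ht htb f] with x h1 h2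
  exact h2.trans h1

/-- Truncating a finite net for the weighted `L¹` norm to the order interval given by `u` makes it
a finite net for the norm, up to the distance to the order interval. -/
lemma AlmostOrderBounded.hasFiniteNet [SigmaFinite μ] (hoc : HasOrderContinuousNorm L.posCone)
    (hφ : Measurable φ) (hφ0 : ∀ᵐ x ∂μ, φ x ≠ 0) {T : L.Op} {δ ε : ℝ} (hε : 0 < ε)
    (hT : AlmostOrderBounded T δ) (hpre : IsPrecompactLOne φ T) : HasFiniteNet T (δ + ε) := by
  obtain ⟨u, hu⟩ := hT
  obtain ⟨η, hη, hnorm⟩ := exists_norm_le_of_lintegral_le hoc hφ hφ0 ((2 : ℂ) • u) hε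
  obtain ⟨ε', hε', hε'η⟩ := ENNReal.lt_iff_exists_nnreal_btwn.1 (ENNReal.half_pos hη.ne')
  obtain ⟨M, hM, hTM⟩ := hpre ε' (ENNReal.coe_pos.1 hε')
  let τ : L.Space → L.Space := fun m => ofLe u (fun x => radialTrunc ‖u x‖ (m x))
    (measurable_radialTrunc (coeFn_measurable u).norm
      (coeFn_measurable m)).aestronglyMeasurable
    (Eventually.of_forall fun x => norm_radialTrunc_le (norm_nonneg _) _)
  refine ⟨τ '' M, hM.image _, fun f hf => ?_⟩
  obtain ⟨m, hm, hfm⟩ := hTM f hf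
  obtain ⟨h, hδ, hh⟩ := hu f hf
  refine ⟨τ m, Set.mem_image_of_mem _ hm, ?_⟩
  -- `|T f - τ m| ≤ |h| + d`, where `d` lies in an order interval and is small in the `L¹` norm
  let d : X → ℝ := fun x => min (2 * ‖u x‖) (2 * ‖(T f - m : L.Space) x‖)
  have hd0 : ∀ x, 0 ≤ d x := fun x => le_min (by positivity) (by positivity)
  have hdm : Measurable d := ((coeFn_measurable u).norm.const_mul 2).min
    ((coeFn_measurable (T f - m)).norm.const_mul 2)
  have hdu : ∀ᵐ x ∂μ, ‖((d x : ℝ) : ℂ)‖ ≤ ‖((2 : ℂ) • u : L.Space) x‖ := by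
    filter_upwards [coeFn_smul 2 u] with x hx
    rw [hx, Complex.norm_real, Real.norm_of_nonneg (hd0 x), norm_mul, Complex.norm_ofNat]
    exact min_le_left _ _
  let g : L.Space := ofLe ((2 : ℂ) • u) (fun x => ((d x : ℝ) : ℂ))
    (Complex.measurable_ofReal.comp hdm).aestronglyMeasurable hdu
  have hg : ∀ᵐ x ∂μ, g x = ((d x : ℝ) : ℂ) := coeFn_ofLe _ _ _ _
  have hgε : ‖g‖ ≤ ε := by
    refine hnorm g ?_ ?_
    · filter_upwards [hg, hdu] with x h1 h2
      rwa [h1]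
    · calc ∫⁻ x, φ x * ‖g x‖ₑ ∂μ ≤ ∫⁻ x, 2 * (φ x * ‖(T f - m : L.Space) x‖ₑ) ∂μ := by
            refine lintegral_mono_ae ?_
            filter_upwards [hg] with x hx
            rw [mul_left_comm]
            gcongr
            rw [hx, enorm_eq_nnnorm, Complex.nnnorm_real, ← enorm_eq_nnnorm,
              Real.enorm_of_nonneg (hd0 x), ← ofReal_norm (E := ℂ)]
            refine (ENNReal.ofReal_le_ofReal (min_le_right _ _)).trans_eq ?_
            rw [ENNReal.ofReal_mul zero_le_two, ENNReal.ofReal_ofNat]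
        _ = 2 * ∫⁻ x, φ x * ‖(T f - m : L.Space) x‖ₑ ∂μ :=
            lintegral_const_mul' _ _ ENNReal.ofNat_ne_top
        _ ≤ 2 * (η / 2) := by gcongr; exact hfm.trans hε'η.le
        _ = η := ENNReal.mul_div_cancel two_ne_zero ENNReal.ofNat_ne_top
  calc ‖T f - τ m‖ ≤ ‖modulus h + g‖ := by
        refine norm_le_norm ?_
        have h0 : ∀ᵐ x ∂μ, τ m x = radialTrunc ‖u x‖ (m x) := coeFn_ofLe _ _ _ _
        filter_upwards [coeFn_sub (T f) (τ m), coeFn_add (modulus h) g, coeFn_modulus h, hg, h0,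
          coeFn_sub (T f) m, hh] with x h1 h2 h3 h4 h5 h6 h7
        rw [h1, h2, h3, h4, h5, ← Complex.ofReal_add, Complex.norm_real,
          Real.norm_of_nonneg (add_nonneg (norm_nonneg _) (hd0 x))]
        have := norm_sub_radialTrunc_le (norm_nonneg (u x)) (norm_nonneg (h x)) h7 (m x)
        rwa [← h6] at this
    _ ≤ ‖modulus h‖ + ‖g‖ := norm_add_le _ _
    _ ≤ δ + ε := by
        rw [norm_modulus]
        exact add_le_add hδ hgε

/-- If `L` and `L*` have order continuous norms, the measure of noncompactness of positive kernel
operators is monotone. -/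
theorem KernelLE.hausdorffMNC_le [SigmaFinite μ] (hoc : HasOrderContinuousNorm L.posCone)
    (hod : HasOrderContinuousNorm L.dualPosCone) {T B : L.Op} (hTB : L.KernelLE T B) :
    hausdorffMNC T ≤ hausdorffMNC B := by
  obtain ⟨φ, hφ, hφ0, hφL⟩ := exists_strictlyPositive_density hoc
  obtain ⟨t, b, ht, hb, htb⟩ := kernelLE_iff.1 hTB
  refine le_of_forall_gt fun c hc => ?_
  obtain ⟨δ, hδ, hδc, hnet⟩ := exists_hasFiniteNet hc
  refine lt_of_le_of_lt (_root_.hausdorffMNC_le fun ε hε => ?_) hδc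
  exact ((almostOrderBounded_of_hasFiniteNet hnet).of_kernelLE hTB).hasFiniteNet hoc hφ hφ0
    (NNReal.coe_pos.2 hε) (ht.isPrecompactLOne hod hφ hφ0 hφL)

end BanachFunctionSpace

/-! ### The chain of inequalities -/

section Bounded

variable {E : Type*} [NormedAddCommGroup E] [NormedSpace ℂ E]

lemma enorm_op_mul_le (A B : E →L[ℂ] E) : ‖A * B‖ₑ ≤ ‖A‖ₑ * ‖B‖ₑ := by
  rw [enorm_eq_nnnorm, enorm_eq_nnnorm, enorm_eq_nnnorm, ← ENNReal.coe_mul, ENNReal.coe_le_coe]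
  exact nnnorm_mul_le A B

lemma exists_enorm_le_of_isBounded {S : Set (E →L[ℂ] E)} (hS : Bornology.IsBounded S) :
    ∃ C : ℝ≥0, ∀ A ∈ S, ‖A‖ₑ ≤ C := by
  obtain ⟨C, hC⟩ := hS.exists_norm_le
  refine ⟨C.toNNReal, fun A hA => ?_⟩
  rw [← ofReal_norm]
  exact ENNReal.ofReal_le_ofReal (hC A hA)

lemma exists_enorm_le_mul {S Q : Set (E →L[ℂ] E)} (hS : ∃ C : ℝ≥0, ∀ A ∈ S, ‖A‖ₑ ≤ C)
    (hQ : ∃ C : ℝ≥0, ∀ A ∈ Q, ‖A‖ₑ ≤ C) : ∃ C : ℝ≥0, ∀ A ∈ S * Q, ‖A‖ₑ ≤ C := by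
  obtain ⟨C, hC⟩ := hS
  obtain ⟨D, hD⟩ := hQ
  refine ⟨C * D, ?_⟩
  rintro _ ⟨A, hA, B, hB, rfl⟩
  rw [ENNReal.coe_mul]
  exact (enorm_op_mul_le A B).trans (mul_le_mul' (hC A hA) (hD B hB))

lemma exists_enorm_le_pow {S : Set (E →L[ℂ] E)} (hS : ∃ C : ℝ≥0, ∀ A ∈ S, ‖A‖ₑ ≤ C) {n : ℕ}
    (hn : 0 < n) : ∃ C : ℝ≥0, ∀ A ∈ S ^ n, ‖A‖ₑ ≤ C := by
  induction n, hn using Nat.le_induction with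
  | base => rwa [Nat.succ_eq_add_one, zero_add, pow_one]
  | succ n _ ih =>
    rw [pow_succ]
    exact exists_enorm_le_mul ih hS

lemma setProduct_succ {k : ℕ} (Ψ : Fin (k + 1) → Set (E →L[ℂ] E)) :
    setProduct Ψ = Ψ 0 * setProduct fun i => Ψ i.succ := by
  rw [setProduct, List.ofFn_succ, List.prod_cons]
  rfl

lemma setProduct_one (Ψ : Fin 1 → Set (E →L[ℂ] E)) : setProduct Ψ = Ψ 0 := by
  rw [setProduct_succ, setProduct, List.ofFn_zero, List.prod_nil, mul_one]

lemma exists_enorm_le_setProduct {k : ℕ} (hk : 0 < k) {Ψ : Fin k → Set (E →L[ℂ] E)}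
    (hΨ : ∀ i, ∃ C : ℝ≥0, ∀ A ∈ Ψ i, ‖A‖ₑ ≤ C) :
    ∃ C : ℝ≥0, ∀ A ∈ setProduct Ψ, ‖A‖ₑ ≤ C := by
  induction k, hk using Nat.le_induction with
  | base =>
    rw [setProduct_one]
    exact hΨ 0
  | succ k _ ih =>
    rw [setProduct_succ]
    exact exists_enorm_le_mul (hΨ 0) (ih fun i => hΨ i.succ)

end Bounded

namespace BanachFunctionSpace

variable {X : Type*} [MeasurableSpace X] {μ : Measure X} [SigmaFinite μ]
  {L : BanachFunctionSpace μ} {m : ℕ} {α : Fin m → ℝ}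

/-- Every element of `S` is dominated by the weighted geometric mean of elements of the `Φ j`. -/
def SetDominated (L : BanachFunctionSpace μ) (α : Fin m → ℝ) (S : Set L.Op)
    (Φ : Fin m → Set L.Op) : Prop :=
  ∀ T ∈ S, ∃ A : Fin m → L.Op, (∀ j, A j ∈ Φ j) ∧ L.Dominated α T A

lemma setDominated_hadamardMean (Φ : Fin m → Set L.Op) :
    L.SetDominated α (L.hadamardMean α Φ) Φ := by
  rintro T ⟨A, hA, hT⟩
  exact ⟨A, hA, hT.dominated⟩

lemma SetDominated.mul (hα : ∀ j, 0 ≤ α j) (hH : HolderInequality μ α) {S Q : Set L.Op}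
    {Φ Θ : Fin m → Set L.Op} (hS : L.SetDominated α S Φ) (hQ : L.SetDominated α Q Θ) :
    L.SetDominated α (S * Q) (fun j => Φ j * Θ j) := by
  rintro _ ⟨T, hT, U, hU, rfl⟩
  obtain ⟨A, hA, hTA⟩ := hS T hT
  obtain ⟨B, hB, hUB⟩ := hQ U hU
  exact ⟨fun j => A j * B j, fun j => Set.mul_mem_mul (hA j) (hB j), hTA.mul hα hH hUB⟩

lemma SetDominated.pow (hα : ∀ j, 0 ≤ α j) (hH : HolderInequality μ α) {S : Set L.Op}
    {Φ : Fin m → Set L.Op} (hS : L.SetDominated α S Φ) {p : ℕ} (hp : 0 < p) :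
    L.SetDominated α (S ^ p) (fun j => Φ j ^ p) := by
  induction p, hp using Nat.le_induction with
  | base => simpa using hS
  | succ p _ ih =>
    simp only [pow_succ]
    exact ih.mul hα hH hS

lemma SetDominated.setProduct (hα : ∀ j, 0 ≤ α j) (hH : HolderInequality μ α) {k : ℕ}
    (hk : 0 < k) {S : Fin k → Set L.Op} {Φ : Fin k → Fin m → Set L.Op}
    (hS : ∀ i, L.SetDominated α (S i) (Φ i)) :
    L.SetDominated α (setProduct S) (fun j => setProduct fun i => Φ i j) := by
  induction k, hk using Nat.le_induction with
  | base =>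
    simp only [setProduct_one]
    exact hS 0
  | succ k _ ih =>
    simp only [setProduct_succ]
    exact (hS 0).mul hα hH (ih fun i => hS i.succ)

/-- If the geometric means exist, then an element dominated by elements of the `Φ j` is below an
element of the mean of the `Φ j`. -/
lemma SetDominated.hadamardMean (hmeans : L.HasHadamardMeans α) {S : Set L.Op}
    {Φ : Fin m → Set L.Op} (hS : L.SetDominated α S Φ) :
    L.SetDominated (fun _ : Fin 1 => 1) S (fun _ => L.hadamardMean α Φ) := by
  intro T hT
  obtain ⟨A, hA, hTA⟩ := hS T hT
  obtain ⟨t, a, ht, ha, hle⟩ := id hTA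
  obtain ⟨B, hB⟩ := hmeans A a ha
  exact ⟨fun _ => B, fun _ => ⟨A, hA, a, ha, hB⟩, hTA.kernelLE ha hB⟩

/-- The properties of `φ` that yield the chain of inequalities for `growthRate φ`. -/
structure IsLogConvexSize (L : BanachFunctionSpace μ) (α : Fin m → ℝ) (φ : L.Op → ℝ≥0∞) :
    Prop where
  le_prod : ∀ (T : L.Op) (A : Fin m → L.Op), L.Dominated α T A → φ T ≤ ∏ j, φ (A j) ^ α j
  mono : ∀ T B : L.Op, L.KernelLE T B → φ T ≤ φ B
  le_enorm : ∀ A, φ A ≤ ‖A‖ₑ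
  growthRate_le_pow : ∀ S : Set L.Op, (∃ C : ℝ≥0, ∀ A ∈ S, ‖A‖ₑ ≤ C) → ∀ n : ℕ, 0 < n →
    growthRate φ S ≤ growthRate φ (S ^ n) ^ (1 / (n : ℝ))

lemma IsLogConvexSize.growthRate_le_prod {φ : L.Op → ℝ≥0∞} (hφ : L.IsLogConvexSize α φ)
    (hα : ∀ j, 0 < α j) (hH : HolderInequality μ α) {S : Set L.Op} {Φ : Fin m → Set L.Op}
    (hΦ : ∀ j, ∃ C : ℝ≥0, ∀ A ∈ Φ j, ‖A‖ₑ ≤ C) (hS : L.SetDominated α S Φ) :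
    growthRate φ S ≤ ∏ j, growthRate φ (Φ j) ^ α j := by
  refine _root_.growthRate_le_prod hα (fun j => ?_) fun p hp => iSup₂_le fun T hT => ?_
  · obtain ⟨C, hC⟩ := hΦ j
    exact ne_top_of_le_ne_top ENNReal.coe_ne_top (growthRate_le_of_le_enorm hφ.le_enorm hC)
  · obtain ⟨A, hA, hTA⟩ := hS.pow (fun j => (hα j).le) hH hp T hT
    refine (hφ.le_prod T A hTA).trans (Finset.prod_le_prod' fun j _ => ?_)
    exact ENNReal.rpow_le_rpow (le_iSup₂ (f := fun A (_ : A ∈ Φ j ^ p) => φ A) (A j) (hA j))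
      (hα j).le

lemma IsLogConvexSize.growthRate_mono {φ : L.Op → ℝ≥0∞} (hφ : L.IsLogConvexSize α φ)
    {S Q : Set L.Op} (hS : L.SetDominated (fun _ : Fin 1 => 1) S (fun _ => Q)) :
    growthRate φ S ≤ growthRate φ Q := by
  refine _root_.growthRate_mono fun p hp => iSup₂_le fun T hT => ?_
  obtain ⟨A, hA, hTA⟩ := hS.pow (fun _ => zero_le_one)
    (holderInequality_of_sum_eq_one μ (fun _ => zero_le_one) (by simp)) hp T hT
  have h1 : (fun _ : Fin 1 => A 0) = A := by
    ext1 j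
    rw [Subsingleton.elim j 0]
  refine (hφ.mono T (A 0) (by rw [KernelLE, h1]; exact hTA)).trans ?_
  exact le_iSup₂ (f := fun A (_ : A ∈ Q ^ p) => φ A) (A 0) (hA 0)

/-- The passage from a norm (or a measure of noncompactness) to the corresponding spectral
radius. -/
lemma IsLogConvexSize.growthRate_singleton {φ : L.Op → ℝ≥0∞} (hφ : L.IsLogConvexSize α φ)
    (hα : ∀ j, 0 < α j) (hH : HolderInequality μ α) :
    L.IsLogConvexSize α (fun A => growthRate φ {A}) := by
  have hbdd : ∀ A : L.Op, ∃ C : ℝ≥0, ∀ B ∈ ({A} : Set L.Op), ‖B‖ₑ ≤ C := fun A =>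
    ⟨‖A‖₊, fun B hB => by rw [Set.mem_singleton_iff.1 hB]; exact le_rfl⟩
  refine ⟨fun T A hTA => ?_, fun T B hTB => ?_, fun A => ?_, fun S hS n hn => ?_⟩
  · refine hφ.growthRate_le_prod hα hH (fun j => hbdd (A j)) ?_
    rintro _ rfl
    exact ⟨A, fun j => rfl, hTA⟩
  · refine hφ.growthRate_mono ?_
    rintro _ rfl
    exact ⟨fun _ => B, fun _ => rfl, hTB⟩
  · exact growthRate_le_of_le_enorm (C := ‖A‖₊) hφ.le_enorm fun B hB => by
      rw [Set.mem_singleton_iff.1 hB]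
      exact le_rfl
  · refine growthRate_le_pow_of_pow_le S hn fun A => ?_
    have h1 := hφ.growthRate_le_pow {A} (hbdd A) n hn
    rw [Set.singleton_pow] at h1
    have hn0 : (n : ℝ) ≠ 0 := by positivity
    calc growthRate φ {A} ^ n ≤ (growthRate φ {A ^ n} ^ (1 / (n : ℝ))) ^ n := by gcongr
      _ = growthRate φ {A ^ n} := by
        rw [← ENNReal.rpow_natCast, ← ENNReal.rpow_mul, one_div_mul_cancel hn0, ENNReal.rpow_one]

/-- The chain of inequalities between the growth rate of a product of geometric means, of the geometric
mean of the products, of its refinement with `n`-th powers, and the product of the growth rates. -/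
theorem IsLogConvexSize.growthRate_chain {φ : L.Op → ℝ≥0∞} (hφ : L.IsLogConvexSize α φ)
    (hnorm : ∀ (T : L.Op) (A : Fin m → L.Op), L.Dominated α T A → ‖T‖ₑ ≤ ∏ j, ‖A j‖ₑ ^ α j)
    (hα : ∀ j, 0 < α j) (hH : HolderInequality μ α) (hmeans : L.HasHadamardMeans α)
    {k n : ℕ} (hk : 0 < k) (hn : 0 < n) {Ψ : Fin k → Fin m → Set L.Op}
    (hΨ : ∀ i j, Bornology.IsBounded (Ψ i j)) :
    growthRate φ (setProduct fun i => L.hadamardMean α (Ψ i)) ≤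
        growthRate φ (L.hadamardMean α fun j => setProduct fun i => Ψ i j) ∧
      growthRate φ (L.hadamardMean α fun j => setProduct fun i => Ψ i j) ≤
        growthRate φ (L.hadamardMean α fun j => (setProduct fun i => Ψ i j) ^ n) ^
          (1 / (n : ℝ)) ∧
      growthRate φ (L.hadamardMean α fun j => (setProduct fun i => Ψ i j) ^ n) ^ (1 / (n : ℝ)) ≤
        ∏ j, growthRate φ (setProduct fun i => Ψ i j) ^ α j := by
  have hα0 : ∀ j, 0 ≤ α j := fun j => (hα j).le
  set Φ : Fin m → Set L.Op := fun j => setProduct fun i => Ψ i j with hΦ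
  have hΦb : ∀ j, ∃ C : ℝ≥0, ∀ A ∈ Φ j, ‖A‖ₑ ≤ C := fun j =>
    exists_enorm_le_setProduct hk fun i => exists_enorm_le_of_isBounded (hΨ i j)
  have hn1 : 0 ≤ 1 / (n : ℝ) := by positivity
  refine ⟨?_, ?_, ?_⟩
  · exact hφ.growthRate_mono (SetDominated.hadamardMean hmeans
      (SetDominated.setProduct hα0 hH hk fun i => setDominated_hadamardMean (Ψ i)))
  · have hb : ∃ C : ℝ≥0, ∀ T ∈ L.hadamardMean α Φ, ‖T‖ₑ ≤ C := by
      choose C hC using hΦb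
      refine ⟨∏ j, C j ^ α j, ?_⟩
      rintro T ⟨A, hA, hT⟩
      refine (hnorm T A hT.dominated).trans ?_
      rw [ENNReal.ofNNReal_finsetProd]
      refine Finset.prod_le_prod' fun j _ => ?_
      rw [ENNReal.coe_rpow_of_nonneg _ (hα0 j)]
      exact ENNReal.rpow_le_rpow (hC j _ (hA j)) (hα0 j)
    refine (hφ.growthRate_le_pow _ hb n hn).trans (ENNReal.rpow_le_rpow ?_ hn1)
    exact hφ.growthRate_mono (SetDominated.hadamardMean hmeans
      ((setDominated_hadamardMean Φ).pow hα0 hH hn))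
  · calc growthRate φ (L.hadamardMean α fun j => Φ j ^ n) ^ (1 / (n : ℝ))
        ≤ (∏ j, growthRate φ (Φ j ^ n) ^ α j) ^ (1 / (n : ℝ)) :=
          ENNReal.rpow_le_rpow (hφ.growthRate_le_prod hα hH
            (fun j => exists_enorm_le_pow (hΦb j) hn) (setDominated_hadamardMean _)) hn1
      _ = ∏ j, (growthRate φ (Φ j ^ n) ^ (1 / (n : ℝ))) ^ α j := by
          rw [← ENNReal.prod_rpow_of_nonneg hn1]
          refine Finset.prod_congr rfl fun j _ => ?_
          rw [← ENNReal.rpow_mul, ← ENNReal.rpow_mul, mul_comm]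
      _ ≤ ∏ j, growthRate φ (Φ j) ^ α j := Finset.prod_le_prod' fun j _ =>
          ENNReal.rpow_le_rpow (growthRate_pow_le φ (Φ j) hn) (hα0 j)

lemma isLogConvexSize_enorm
    (hnorm : ∀ (T : L.Op) (A : Fin m → L.Op), L.Dominated α T A → ‖T‖ₑ ≤ ∏ j, ‖A j‖ₑ ^ α j) :
    L.IsLogConvexSize α (fun A => ‖A‖ₑ) where
  le_prod := hnorm
  mono _ _ h := h.enorm_le
  le_enorm _ := le_rfl
  growthRate_le_pow S hS n hn := by
    obtain ⟨C, hC⟩ := hS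
    exact growthRate_le_pow_of_submultiplicative S hn enorm_op_mul_le hC

/-- The norm is logarithmically convex when the exponents sum to one. -/
lemma Dominated.enorm_le_prod_rpow (hα : ∀ j, 0 < α j) (hsum : ∑ j, α j = 1) {T : L.Op}
    {A : Fin m → L.Op} (h : L.Dominated α T A) : ‖T‖ₑ ≤ ∏ j, ‖A j‖ₑ ^ α j :=
  h.le_prod_rpow_of_monotone (fun _ => enorm_ne_top) enorm_op_add_le enorm_smul_le_coe
    (fun _ _ h => h.enorm_le) hα hsum

lemma isLogConvexSize_hausdorffMNC (hα : ∀ j, 0 < α j) (hsum : ∑ j, α j = 1)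
    (hoc : HasOrderContinuousNorm L.posCone) (hod : HasOrderContinuousNorm L.dualPosCone) :
    L.IsLogConvexSize α hausdorffMNC where
  le_prod _ _ h := h.le_prod_rpow_of_monotone hausdorffMNC_ne_top hausdorffMNC_add_le
    (fun c A => (hausdorffMNC_smul_le _ A).trans_eq (by
      rw [enorm_eq_nnnorm, Complex.nnnorm_real, Real.nnnorm_of_nonneg c.coe_nonneg]
      rfl))
    (fun _ _ h => h.hausdorffMNC_le hoc hod) hα hsum
  mono _ _ h := h.hausdorffMNC_le hoc hod
  le_enorm := hausdorffMNC_le_enorm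
  growthRate_le_pow S hS n hn := by
    obtain ⟨C, hC⟩ := hS
    exact growthRate_le_pow_of_submultiplicative S hn hausdorffMNC_mul_le
      fun A hA => (hausdorffMNC_le_enorm A).trans (hC A hA)

lemma generalizedSpectralRadius_eq (S : Set L.Op) :
    generalizedSpectralRadius S = growthRate (fun A => growthRate (fun A => ‖A‖ₑ) {A}) S := by
  simp_rw [growthRate_enorm_singleton]
  rfl

lemma generalizedEssentialSpectralRadius_eq (S : Set L.Op) :
    generalizedEssentialSpectralRadius S =
      growthRate (fun A => growthRate hausdorffMNC {A}) S := by
  simp_rw [growthRate_hausdorffMNC_singleton]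
  rfl

end BanachFunctionSpace

/-! ### Banach sequence spaces -/

section Counting

variable {R : Type*} [MeasurableSpace R] [MeasurableSingletonClass R]

lemma tsum_rpow_le_rpow_tsum {ι : Type*} (f : ι → ℝ≥0∞) {s : ℝ} (hs : 1 ≤ s) :
    ∑' i, f i ^ s ≤ (∑' i, f i) ^ s := by
  have hsplit : ∀ x : ℝ≥0∞, x ^ s = x * x ^ (s - 1) := fun x => by
    conv_lhs => rw [show s = 1 + (s - 1) by ring]
    rw [ENNReal.rpow_add_of_nonneg _ _ zero_le_one (by linarith), ENNReal.rpow_one]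
  rw [hsplit (∑' i, f i), ← ENNReal.tsum_mul_right]
  refine ENNReal.tsum_le_tsum fun i => ?_
  rw [hsplit]
  exact mul_le_mul' le_rfl (ENNReal.rpow_le_rpow (ENNReal.le_tsum i) (by linarith))

/-- For the counting measure, Hölder's inequality extends to exponents with sum at least one. -/
lemma holderInequality_count {m : ℕ} {α : Fin m → ℝ} (hα : ∀ j, 0 ≤ α j) (hsum : 1 ≤ ∑ j, α j) :
    HolderInequality (Measure.count : Measure R) α := by
  intro f hf
  set s := ∑ j, α j with hs
  have hs0 : 0 < s := zero_lt_one.trans_le hsum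
  have hβ : ∀ j, s * (α j / s) = α j := fun j => mul_div_cancel₀ _ hs0.ne'
  have h := holderInequality_of_sum_eq_one (Measure.count : Measure R)
    (α := fun j => α j / s) (fun j => div_nonneg (hα j) hs0.le)
    (by rw [← Finset.sum_div, ← hs, div_self hs0.ne']) (fun j x => f j x ^ s)
    (fun j => (hf j).pow_const s)
  simp only [← ENNReal.rpow_mul, hβ] at h
  refine h.trans (Finset.prod_le_prod' fun j _ => ?_)
  rw [lintegral_count, lintegral_count]
  calc (∑' x, f j x ^ s) ^ (α j / s) ≤ ((∑' x, f j x) ^ s) ^ (α j / s) :=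
        ENNReal.rpow_le_rpow (tsum_rpow_le_rpow_tsum _ hsum) (div_nonneg (hα j) hs0.le)
    _ = (∑' x, f j x) ^ α j := by rw [← ENNReal.rpow_mul, hβ]

lemma integral_count_eq_tsum [Countable R] {f : R → ℂ} (hf : Integrable f Measure.count) :
    ∫ x, f x ∂Measure.count = ∑' x, f x := by
  rw [integral_countable hf]
  simp [measureReal_def]

end Counting

namespace BanachFunctionSpace

variable {R : Type*} [Countable R] [MeasurableSpace R] [MeasurableSingletonClass R]
  {L : BanachFunctionSpace (Measure.count : Measure R)} {m : ℕ} {α : Fin m → ℝ}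

lemma IsNonnegMatrixOperator.exists_hasNonnegKernel {A : L.Op} (h : L.IsNonnegMatrixOperator A) :
    ∃ a : R × R → ℝ≥0, L.HasNonnegKernel A a := by
  obtain ⟨a, ha⟩ := h
  refine ⟨fun p => a p.1 p.2, (Measurable.of_discrete).aemeasurable, fun f => ?_⟩
  refine Eventually.of_forall fun i => ?_
  have h1 : Integrable (fun j => ((a i j : ℝ) : ℂ) * f j) (Measure.count : Measure R) :=
    integrable_count_iff.2 (ha f i).summable.norm
  exact ⟨h1, by
    rw [integral_count_eq_tsum h1, (ha f i).tsum_eq]⟩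

/-- Point evaluations have norm at most one, since `|f i| e_i ≤ |f|`. -/
lemma norm_apply_le_norm (hL : L.HasUnitVectors) (f : L.Space) (i : R) : ‖f i‖ ≤ ‖f‖ := by
  obtain ⟨e, he, he1⟩ := hL i
  have h1 : ‖(f i) • e‖ = ‖f i‖ := by rw [norm_smul, he1, mul_one]
  rw [← h1]
  refine norm_le_norm ?_
  filter_upwards [coeFn_smul (f i) e] with x hx
  rw [hx, he]
  by_cases hxi : x = i
  · rw [hxi, Set.indicator_of_mem (Set.mem_singleton i), mul_one]
  · rw [Set.indicator_of_notMem (show x ∉ ({i} : Set R) from hxi), mul_zero, norm_zero]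
    exact norm_nonneg _

/-- The entries of a matrix are bounded by the norm of the operator. -/
lemma HasNonnegKernel.apply_le_nnnorm (hL : L.HasUnitVectors) {A : L.Op} {a : R × R → ℝ≥0}
    (hA : L.HasNonnegKernel A a) (p : R × R) : a p ≤ ‖A‖₊ := by
  obtain ⟨i, j⟩ := p
  obtain ⟨e, he, he1⟩ := hL j
  obtain ⟨h0, h1⟩ := Measure.ae_count_iff.1 (hA.2 e) i
  have h2 : A e i = ((a (i, j) : ℝ) : ℂ) := by
    rw [h1, integral_count_eq_tsum h0, tsum_eq_single j]
    · rw [he, Set.indicator_of_mem (Set.mem_singleton j), mul_one]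
    · intro l hl
      rw [he, Set.indicator_of_notMem (show l ∉ ({j} : Set R) from hl), mul_zero]
  have h3 : ‖A e i‖ ≤ ‖A‖ := (norm_apply_le_norm hL _ i).trans (by
    have := A.le_opNorm e
    rwa [he1, mul_one] at this)
  rw [h2, Complex.norm_real, Real.norm_of_nonneg (a (i, j)).coe_nonneg] at h3
  exact h3

/-- Since the entries of `a_j` are bounded by `‖A_j‖`, the product `∏ a_j ^ α_j` is bounded by a
constant times the product with the normalized exponents `α_j / ∑ α`. -/
lemma prod_rpow_le_mul_prod_rpow (hL : L.HasUnitVectors) (hα : ∀ j, 0 < α j)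
    (hsum : 1 ≤ ∑ j, α j) {A : Fin m → L.Op} {a : Fin m → R × R → ℝ≥0}
    (ha : ∀ j, L.HasNonnegKernel (A j) (a j)) (p : R × R) :
    ∏ j, a j p ^ α j ≤ (∏ j, ‖A j‖₊ ^ (α j - α j / ∑ i, α i)) *
      ∏ j, a j p ^ (α j / ∑ i, α i) := by
  have hs0 : 0 < ∑ i, α i := zero_lt_one.trans_le hsum
  rw [← Finset.prod_mul_distrib]
  refine Finset.prod_le_prod' fun j _ => ?_
  have h1 : α j / ∑ i, α i ≤ α j := div_le_self (hα j).le hsum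
  calc a j p ^ α j = a j p ^ (α j - α j / ∑ i, α i) * a j p ^ (α j / ∑ i, α i) := by
        rw [← NNReal.rpow_add_of_nonneg _ (sub_nonneg.2 h1) (div_nonneg (hα j).le hs0.le),
          sub_add_cancel]
    _ ≤ _ := by
        gcongr
        exact (ha j).apply_le_nnnorm hL p

lemma hasHadamardMeans_of_one_le_sum (hL : L.HasUnitVectors) (hα : ∀ j, 0 < α j)
    (hsum : 1 ≤ ∑ j, α j) : L.HasHadamardMeans α := fun _ _ ha => by
  have hs0 : 0 < ∑ i, α i := zero_lt_one.trans_le hsum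
  exact exists_hasNonnegKernel_of_le_mul_prod (α := fun j => α j / ∑ i, α i)
    (fun j => div_pos (hα j) hs0) (by rw [← Finset.sum_div, div_self hs0.ne']) ha
    (aemeasurable_prod_rpow ha) _
    (Eventually.of_forall fun p => prod_rpow_le_mul_prod_rpow hL hα hsum ha p)

/-- The norm of matrices is logarithmically convex for exponents with sum at least one: the powers
`‖A_j‖ ^ (α_j - α_j / ∑ α)` in the constant make up for the normalized exponents. -/
lemma Dominated.enorm_le_prod_rpow_of_one_le_sum (hL : L.HasUnitVectors) (hα : ∀ j, 0 < α j)
    (hsum : 1 ≤ ∑ j, α j) {T : L.Op} {A : Fin m → L.Op} (h : L.Dominated α T A) :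
    ‖T‖ₑ ≤ ∏ j, ‖A j‖ₑ ^ α j := by
  obtain ⟨t, a, ht, ha, hle⟩ := h
  have hs0 : 0 < ∑ i, α i := zero_lt_one.trans_le hsum
  have h1 := enorm_le_mul_prod_rpow (α := fun j => α j / ∑ i, α i)
    (fun j => div_pos (hα j) hs0) (by rw [← Finset.sum_div, div_self hs0.ne']) ht ha
    (∏ j, ‖A j‖₊ ^ (α j - α j / ∑ i, α i))
    (hle.mono fun p hp => hp.trans (prod_rpow_le_mul_prod_rpow hL hα hsum ha p))
  refine h1.trans_eq ?_
  rw [ENNReal.ofNNReal_finsetProd, ← Finset.prod_mul_distrib]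
  refine Finset.prod_congr rfl fun j _ => ?_
  have h2 : α j / ∑ i, α i ≤ α j := div_le_self (hα j).le hsum
  rw [ENNReal.coe_rpow_of_nonneg _ (sub_nonneg.2 h2), ← enorm_eq_nnnorm,
    ← ENNReal.rpow_add_of_nonneg _ _ (sub_nonneg.2 h2) (div_nonneg (hα j).le hs0.le),
    sub_add_cancel]

end BanachFunctionSpace

namespace BanachFunctionSpace

variable {X : Type*} [MeasurableSpace X] {μ : Measure X} {L : BanachFunctionSpace μ}

lemma isHadamardPower_iff {t : ℝ} {A B : L.Op} :
    L.IsHadamardPower t A B ↔ L.IsHadamardMean (fun _ : Fin 1 => t) (fun _ => A) B := by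
  constructor
  · rintro ⟨a, hA, hB⟩
    exact ⟨fun _ => a, fun _ => hA, by simpa using hB⟩
  · rintro ⟨a, hA, hB⟩
    exact ⟨a 0, hA 0, by simpa using hB⟩

/-- The Hadamard power is the weighted geometric mean for `m = 1`. -/
lemma hadamardPower_eq (t : ℝ) (Ψ : Set L.Op) :
    L.hadamardPower t Ψ = L.hadamardMean (fun _ : Fin 1 => t) (fun _ => Ψ) := by
  ext B
  constructor
  · rintro ⟨A, hA, hB⟩
    exact ⟨fun _ => A, fun _ => hA, isHadamardPower_iff.1 hB⟩
  · rintro ⟨A, hA, hB⟩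
    refine ⟨A 0, hA 0, isHadamardPower_iff.2 ?_⟩
    have h1 : (fun _ : Fin 1 => A 0) = A := by
      ext1 j
      rw [Subsingleton.elim j 0]
    rwa [h1]

end BanachFunctionSpace

/-! ### Kernel operators and nonnegative matrices -/

theorem theorem3p3 {k m n : ℕ} (hk : 0 < k) (hn : 0 < n) :
    -- (i) positive kernel operators on a Banach function space
    (∀ {X : Type*} [MeasurableSpace X] [Nonempty X] (μ : Measure X) [SigmaFinite μ]
      (L : BanachFunctionSpace μ) (α : Fin m → ℝ), (∀ j, 0 < α j) → ∑ j, α j = 1 →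
      -- weighted geometric means of positive kernel operators are well defined on `L`
      (∀ A : Fin m → L.Op, (∀ j, L.IsPositiveKernelOperator (A j)) →
        ∃! B : L.Op, L.IsHadamardMean α A B) ∧
      ∀ Ψ : Fin k → Fin m → Set L.Op,
        (∀ i j, Bornology.IsBounded (Ψ i j)) →
        (∀ i j, ∀ A ∈ Ψ i j, L.IsPositiveKernelOperator A) →
        ∀ r : Set L.Op → ℝ≥0∞,
          (r = generalizedSpectralRadius ∨ r = jointSpectralRadius ∨
            (HasOrderContinuousNorm L.posCone ∧ HasOrderContinuousNorm L.dualPosCone ∧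
              (r = generalizedEssentialSpectralRadius ∨ r = jointEssentialSpectralRadius))) →
          r (setProduct fun i => L.hadamardMean α (Ψ i)) ≤
            r (L.hadamardMean α fun j => setProduct fun i => Ψ i j) ∧
          r (L.hadamardMean α fun j => setProduct fun i => Ψ i j) ≤
            r (L.hadamardMean α fun j => (setProduct fun i => Ψ i j) ^ n) ^ (1 / (n : ℝ)) ∧
          r (L.hadamardMean α fun j => (setProduct fun i => Ψ i j) ^ n) ^ (1 / (n : ℝ)) ≤
            ∏ j, r (setProduct fun i => Ψ i j) ^ α j) ∧
    -- (ii) nonnegative matrices on a Banach sequence space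
    (∀ {R : Type*} [Countable R] [Nonempty R] [MeasurableSpace R] [MeasurableSingletonClass R]
      (L : BanachFunctionSpace (Measure.count : Measure R)), L.HasUnitVectors →
      (∀ α : Fin m → ℝ, (∀ j, 0 < α j) → 1 ≤ ∑ j, α j →
        (∀ A : Fin m → L.Op, (∀ j, L.IsNonnegMatrixOperator (A j)) →
          ∃! B : L.Op, L.IsHadamardMean α A B) ∧
        ∀ Ψ : Fin k → Fin m → Set L.Op,
          (∀ i j, Bornology.IsBounded (Ψ i j)) →
          (∀ i j, ∀ A ∈ Ψ i j, L.IsNonnegMatrixOperator A) →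
          ∀ r : Set L.Op → ℝ≥0∞,
            (r = generalizedSpectralRadius ∨ r = jointSpectralRadius) →
            r (setProduct fun i => L.hadamardMean α (Ψ i)) ≤
              r (L.hadamardMean α fun j => setProduct fun i => Ψ i j) ∧
            r (L.hadamardMean α fun j => setProduct fun i => Ψ i j) ≤
              r (L.hadamardMean α fun j => (setProduct fun i => Ψ i j) ^ n) ^ (1 / (n : ℝ)) ∧
            r (L.hadamardMean α fun j => (setProduct fun i => Ψ i j) ^ n) ^ (1 / (n : ℝ)) ≤
              ∏ j, r (setProduct fun i => Ψ i j) ^ α j) ∧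
      (∀ t : ℝ, 1 ≤ t →
        (∀ A : L.Op, L.IsNonnegMatrixOperator A → ∃! B : L.Op, L.IsHadamardPower t A B) ∧
        ∀ Ψ : Fin k → Set L.Op,
          (∀ i, Bornology.IsBounded (Ψ i)) →
          (∀ i, ∀ A ∈ Ψ i, L.IsNonnegMatrixOperator A) →
          ∀ r : Set L.Op → ℝ≥0∞,
            (r = generalizedSpectralRadius ∨ r = jointSpectralRadius) →
            r (setProduct fun i => L.hadamardPower t (Ψ i)) ≤
              r (L.hadamardPower t (setProduct Ψ)) ∧
            r (L.hadamardPower t (setProduct Ψ)) ≤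
              r (L.hadamardPower t (setProduct Ψ ^ n)) ^ (1 / (n : ℝ)) ∧
            r (L.hadamardPower t (setProduct Ψ ^ n)) ^ (1 / (n : ℝ)) ≤
              r (setProduct Ψ) ^ t)) := by
  refine ⟨?_, ?_⟩
  · intro X _ _ μ _ L α hα hsum
    have hmeans := BanachFunctionSpace.hasHadamardMeans_of_sum_eq_one (L := L) hα hsum
    have hH := holderInequality_of_sum_eq_one μ (fun j => (hα j).le) hsum
    have hnorm : ∀ (T : L.Op) (A : Fin m → L.Op), L.Dominated α T A →
        ‖T‖ₑ ≤ ∏ j, ‖A j‖ₑ ^ α j := fun T A h => h.enorm_le_prod_rpow hα hsum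
    refine ⟨fun A hA => hmeans.existsUnique fun j => (hA j).exists_hasNonnegKernel, ?_⟩
    intro Ψ hΨ _ r hr
    have hN := BanachFunctionSpace.isLogConvexSize_enorm hnorm
    rcases hr with rfl | rfl | ⟨hoc, hod, rfl | rfl⟩
    · simp only [BanachFunctionSpace.generalizedSpectralRadius_eq]
      exact (hN.growthRate_singleton hα hH).growthRate_chain hnorm hα hH hmeans hk hn hΨ
    · exact hN.growthRate_chain hnorm hα hH hmeans hk hn hΨ
    · simp only [BanachFunctionSpace.generalizedEssentialSpectralRadius_eq]
      exact ((BanachFunctionSpace.isLogConvexSize_hausdorffMNC hα hsum hoc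
        hod).growthRate_singleton hα hH).growthRate_chain hnorm hα hH hmeans hk hn hΨ
    · exact (BanachFunctionSpace.isLogConvexSize_hausdorffMNC hα hsum hoc
        hod).growthRate_chain hnorm hα hH hmeans hk hn hΨ
  · intro R _ _ _ _ L hL
    -- the assertion for any number of factors; Hadamard powers are the case of one factor
    have key : ∀ {l : ℕ} (α : Fin l → ℝ), (∀ j, 0 < α j) → 1 ≤ ∑ j, α j →
        (∀ A : Fin l → L.Op, (∀ j, L.IsNonnegMatrixOperator (A j)) →
          ∃! B : L.Op, L.IsHadamardMean α A B) ∧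
        ∀ Ψ : Fin k → Fin l → Set L.Op, (∀ i j, Bornology.IsBounded (Ψ i j)) →
          ∀ r : Set L.Op → ℝ≥0∞, (r = generalizedSpectralRadius ∨ r = jointSpectralRadius) →
            r (setProduct fun i => L.hadamardMean α (Ψ i)) ≤
              r (L.hadamardMean α fun j => setProduct fun i => Ψ i j) ∧
            r (L.hadamardMean α fun j => setProduct fun i => Ψ i j) ≤
              r (L.hadamardMean α fun j => (setProduct fun i => Ψ i j) ^ n) ^ (1 / (n : ℝ)) ∧
            r (L.hadamardMean α fun j => (setProduct fun i => Ψ i j) ^ n) ^ (1 / (n : ℝ)) ≤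
              ∏ j, r (setProduct fun i => Ψ i j) ^ α j := by
      intro l α hα hsum
      have hmeans := BanachFunctionSpace.hasHadamardMeans_of_one_le_sum hL hα hsum
      have hH := holderInequality_count (R := R) (fun j => (hα j).le) hsum
      have hnorm : ∀ (T : L.Op) (A : Fin l → L.Op), L.Dominated α T A →
          ‖T‖ₑ ≤ ∏ j, ‖A j‖ₑ ^ α j := fun T A h => h.enorm_le_prod_rpow_of_one_le_sum hL hα hsum
      have hN := BanachFunctionSpace.isLogConvexSize_enorm hnorm
      refine ⟨fun A hA => hmeans.existsUnique fun j => (hA j).exists_hasNonnegKernel, ?_⟩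
      intro Ψ hΨ r hr
      rcases hr with rfl | rfl
      · simp only [BanachFunctionSpace.generalizedSpectralRadius_eq]
        exact (hN.growthRate_singleton hα hH).growthRate_chain hnorm hα hH hmeans hk hn hΨ
      · exact hN.growthRate_chain hnorm hα hH hmeans hk hn hΨ
    refine ⟨fun α hα hsum => ⟨(key α hα hsum).1, fun Ψ hΨ _ r hr =>
      (key α hα hsum).2 Ψ hΨ r hr⟩, fun t ht => ?_⟩
    have h1 := key (fun _ : Fin 1 => t) (fun _ => zero_lt_one.trans_le ht) (by simpa using ht)
    refine ⟨fun A hA => ?_, fun Ψ hΨ _ r hr => ?_⟩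
    · simp only [BanachFunctionSpace.isHadamardPower_iff]
      exact h1.1 (fun _ => A) fun _ => hA
    · simp only [BanachFunctionSpace.hadamardPower_eq]
      have h2 := h1.2 (fun i _ => Ψ i) (fun i _ => hΨ i) r hr
      simpa only [Finset.univ_unique, Finset.prod_singleton] using h2
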